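/- Theorem 2. Let $k,n\ge 1$ be integers and let $\Theta$, $X$, $N$ be independent, where $\Theta$ is a $k\times n$ random matrix whose entries are i.i.d. Gaussian with mean $0$ and variance $1/n$, $X$ is a random vector in $\mathbb{R}^n$ with finite second moment $\frac1n\mathbb{E}[\|X\|^2]=\gamma\in(0,\infty)$, and $N\sim\mathcal{N}(0,I_k)$. For $t>0$ let $Y=\Theta X+\sqrt{t}\,N$, let $P_{Y\mid\Theta}$ be the conditional distribution of $Y$ given $\Theta$, and let $G_Y$ be the Gaussian distribution with the same mean and covariance as $Y$, which is $G_Y=\mathcal{N}(0,(\gamma+t)I_k)$. Set $$\alpha(X)=\frac1n\,\mathbb{E}\Big[\big|\|X\|^2-\mathbb{E}[\|X\|^2]\big|\Big],\qquad \beta_r(X)=\frac1n\Big(\mathbb{E}\big[|\langle X_1,X_2\rangle|^r\big]\Big)^{1/r}\quad(r\in\{1,2\}),$$ where $X_1,X_2$ are independent with the same distribution as $X$. Let $D(P\|Q)=\int\log\frac{dP}{dQ}\,dP$ denote relative entropy (natural logarithm), equal to $+\infty$ if $P\not\ll Q$ or the integral does not exist. Then for all $t\in(0,\infty)$ and $\epsilon\in(0,1]$,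 $$\mathbb{E}\big[D(P_{Y\mid\Theta}\,\|\,G_Y)\big]\le C\,k\log\Big(1+\frac{\gamma}{t}\Big)\frac{\alpha(X)}{\epsilon\gamma}+C\,k^{3/4}\Big(\frac{\beta_1(X)}{\gamma}\Big)^{1/2}+C\,k^{1/4}\Big(1+\frac{(2+\epsilon)\gamma}{t}\Big)^{k/4}\frac{\beta_2(X)}{\gamma}$$ with the universal constant $C=3$. -/

import Mathlib

open MeasureTheory ProbabilityTheory InformationTheory
open scoped NNReal ENNReal RealInnerProductSpace

noncomputable section

/-- `α(X) = (1/n) E | ‖X‖² - E ‖X‖² |` for an `n`-dimensional random vector `X`. -/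
def alphaDev {Ω : Type*} [MeasurableSpace Ω] (P : Measure Ω) {n : ℕ}
    (X : Ω → EuclideanSpace ℝ (Fin n)) : ℝ :=
  1 / (n : ℝ) * ∫ ω, |‖X ω‖ ^ 2 - ∫ ω', ‖X ω'‖ ^ 2 ∂P| ∂P

/-- `β_r(X) = (1/n) (E |⟨X₁, X₂⟩|^r)^(1/r)`, where `X₁, X₂` are independent copies of `X`,
realised as `X ∘ fst` and `X ∘ snd` on the product space. -/
def betaCorr {Ω : Type*} [MeasurableSpace Ω] (P : Measure Ω) {n : ℕ} (r : ℝ)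
    (X : Ω → EuclideanSpace ℝ (Fin n)) : ℝ :=
  1 / (n : ℝ) * (∫ p : Ω × Ω, |⟪X p.1, X p.2⟫| ^ r ∂(P.prod P)) ^ (1 / r)

/-- The noisy random projection `Y = Θ X + √t N`. The random `k × n` matrix `Θ` is given by
its entries. -/
def noisyProj {Ω : Type*} {k n : ℕ} (Θ : Ω → Fin k → Fin n → ℝ)
    (X : Ω → EuclideanSpace ℝ (Fin n)) (N : Ω → EuclideanSpace ℝ (Fin k)) (t : ℝ) :
    Ω → EuclideanSpace ℝ (Fin k) :=
  fun ω => WithLp.toLp 2 (Matrix.mulVec (Matrix.of (Θ ω)) (WithLp.ofLp (X ω))) + √t • N ω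

/-- The Gaussian distribution with the same mean and covariance matrix as `Y`. -/
def gaussianApprox {Ω : Type*} [MeasurableSpace Ω] (P : Measure Ω) {k : ℕ}
    (Y : Ω → EuclideanSpace ℝ (Fin k)) : Measure (EuclideanSpace ℝ (Fin k)) :=
  multivariateGaussian (∫ ω, Y ω ∂P)
    (Matrix.of fun i j => covariance (fun ω => Y ω i) (fun ω => Y ω j) P)

end

/-! Put c = γ + t and W = ‖X‖²/n, let g be the density of N(0, c I), and let p_θ(y) be the mean over
X of φ_t(y - θX), where φ_t is the density of √t N. Since `klFun u = u log u + 1 - u` is nonnegative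
and convex, the relative entropy given Θ = θ equals ∫ g klFun(p_θ/g) dy. By Tonelli it can be
averaged over Θ at a fixed y, with no integrability questions.

At fixed y, split the mixture along A = {|W - γ| ≤ εγ/5} by Jensen (`integral_klFun_mixture_le`).
Off A, each component N(θx, t I) is compared with g on its own. On A, the components stay averaged,
and `integral_mul_klFun_div_le` separates the mean over Θ from the fluctuation: the excess is at
most q log(1 + Var/q²) ≤ √Var, where q is the mean. The mean consists of Gaussians of variance W +
t, because Θx is Gaussian with variance ‖x‖²/n. The explicit Gaussian divergences on A and off A are
both at most a multiple of k log(1 + γ/t) |W - γ|/(εγ) (`fluctuation_cost_near`,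
`fluctuation_cost_far`), which gives the α term.

For the variance, take two replicas x, x'. The vectors Θx and Θx' are jointly Gaussian with
cross-covariance ⟪x, x'⟫/n, so Var is an integral over A × A of `overlap` minus its value at zero
correlation (`variance_condDens_eq`). The overlap is governed by Mehler's kernel. In
`overlap_sub_le` it is expanded to first order in the correlation, and the quadratic remainder is
measured at the largest correlation ω = √(W₁W₂) that Cauchy-Schwarz allows. The linear part produces
β₁; the remainder produces β₂ with the exponential factor in k.

What is left is the integral over ℝᵏ of the square root of a mixture of squared Gaussian densities
with comparable variances. Cauchy-Schwarz against a single probability density, a grid of about √k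
Gaussians (`exists_weight`), costs only √k under the root. This is the k^(1/4); the linear term
carries one more factor k under the root, hence k^(3/4). -/

/-- The density of the centred Gaussian distribution on `ℝᵏ` with covariance `v • 1`. -/
noncomputable def gaussDens {k : ℕ} (v : ℝ) (y : EuclideanSpace ℝ (Fin k)) : ℝ :=
  (√(2 * Real.pi * v))⁻¹ ^ k * Real.exp (-(‖y‖ ^ 2 / (2 * v)))

/-! ### Isotropic Gaussian densities: normalisation, identification, convolution -/

section GaussDens

variable {k : ℕ}

lemma gaussDens_pos {v : ℝ} (hv : 0 < v) (y : EuclideanSpace ℝ (Fin k)) :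
    0 < gaussDens v y := by
  unfold gaussDens; positivity

lemma gaussDens_nonneg (v : ℝ) (y : EuclideanSpace ℝ (Fin k)) : 0 ≤ gaussDens v y := by
  unfold gaussDens; positivity

lemma gaussDens_le {v : ℝ} (hv : 0 < v) (y : EuclideanSpace ℝ (Fin k)) :
    gaussDens v y ≤ (√(2 * Real.pi * v))⁻¹ ^ k := by
  unfold gaussDens
  have : Real.exp (-(‖y‖ ^ 2 / (2 * v))) ≤ 1 := Real.exp_le_one_iff.2 (by
    have : 0 ≤ ‖y‖ ^ 2 / (2 * v) := by positivity
    linarith)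
  exact mul_le_of_le_one_right (by positivity) this

@[fun_prop]
lemma continuous_gaussDens (v : ℝ) :
    Continuous (gaussDens v : EuclideanSpace ℝ (Fin k) → ℝ) := by
  unfold gaussDens; fun_prop

@[fun_prop]
lemma measurable_gaussDens (v : ℝ) :
    Measurable (gaussDens v : EuclideanSpace ℝ (Fin k) → ℝ) :=
  (continuous_gaussDens v).measurable

lemma integral_exp_neg_mul_norm_sq {b : ℝ} (hb : 0 < b) :
    ∫ y : EuclideanSpace ℝ (Fin k), Real.exp (-(b * ‖y‖ ^ 2)) = √(Real.pi / b) ^ k := by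
  have := GaussianFourier.integral_rexp_neg_mul_sq_norm (V := EuclideanSpace ℝ (Fin k)) hb
  simp only [neg_mul] at this
  rw [this, Real.sqrt_eq_rpow, ← Real.rpow_mul_natCast (by positivity)]
  congr 1
  simp
  ring

/-- A nonzero Bochner integral certifies integrability, so the computed value suffices. -/
lemma integrable_exp_neg_mul_norm_sq {b : ℝ} (hb : 0 < b) :
    Integrable fun y : EuclideanSpace ℝ (Fin k) ↦ Real.exp (-(b * ‖y‖ ^ 2)) := by
  refine Integrable.of_integral_ne_zero ?_
  rw [integral_exp_neg_mul_norm_sq hb]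
  positivity

lemma integral_gaussDens {v : ℝ} (hv : 0 < v) :
    ∫ y : EuclideanSpace ℝ (Fin k), gaussDens v y = 1 := by
  unfold gaussDens
  rw [integral_const_mul]
  have h : ∀ y : EuclideanSpace ℝ (Fin k), -(‖y‖ ^ 2 / (2 * v)) = -((1 / (2 * v)) * ‖y‖ ^ 2) :=
    fun y ↦ by ring
  simp_rw [h]
  rw [integral_exp_neg_mul_norm_sq (by positivity), ← mul_pow]
  have : Real.pi / (1 / (2 * v)) = 2 * Real.pi * v := by field_simp
  rw [this, inv_mul_cancel₀ (by positivity), one_pow]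

lemma integrable_gaussDens {v : ℝ} (hv : 0 < v) :
    Integrable (gaussDens v : EuclideanSpace ℝ (Fin k) → ℝ) :=
  Integrable.of_integral_ne_zero (by rw [integral_gaussDens hv]; exact one_ne_zero)

/-- The centred Gaussian measure on `ℝᵏ` with covariance `v • 1`, as a density. -/
noncomputable def gaussMeas (k : ℕ) (v : ℝ) : Measure (EuclideanSpace ℝ (Fin k)) :=
  volume.withDensity fun y ↦ ENNReal.ofReal (gaussDens v y)

lemma isProbabilityMeasure_gaussMeas {v : ℝ} (hv : 0 < v) :
    IsProbabilityMeasure (gaussMeas k v) := by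
  constructor
  rw [gaussMeas, withDensity_apply _ MeasurableSet.univ, Measure.restrict_univ,
    ← ofReal_integral_eq_lintegral_ofReal (integrable_gaussDens hv)
      (ae_of_all _ fun y ↦ gaussDens_nonneg v y), integral_gaussDens hv, ENNReal.ofReal_one]

/-- Matching this characteristic function identifies the explicit density with the scaled standard
Gaussian and with `multivariateGaussian`. -/
lemma charFun_gaussMeas {v : ℝ} (hv : 0 < v) (s : EuclideanSpace ℝ (Fin k)) :
    charFun (gaussMeas k v) s = Complex.exp (-(v * ‖s‖ ^ 2 / 2 : ℝ)) := by
  rw [charFun_apply, gaussMeas, integral_withDensity_eq_integral_toReal_smul (by fun_prop)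
    (ae_of_all _ fun _ ↦ ENNReal.ofReal_lt_top)]
  have hb : 0 < (((1 / (2 * v) : ℝ) : ℂ)).re := by simp; positivity
  have key := GaussianFourier.integral_cexp_neg_mul_sq_norm_add hb Complex.I s
  have e1 : ∀ y : EuclideanSpace ℝ (Fin k),
      (ENNReal.ofReal (gaussDens v y)).toReal • Complex.exp ((⟪y, s⟫ : ℝ) * Complex.I)
      = (((√(2 * Real.pi * v))⁻¹ ^ k : ℝ) : ℂ) *
        Complex.exp (-((1 / (2 * v) : ℝ) : ℂ) * ‖y‖ ^ 2 + Complex.I * (⟪s, y⟫ : ℝ)) := by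
    intro y
    rw [ENNReal.toReal_ofReal (gaussDens_nonneg v y), Complex.real_smul, gaussDens, Complex.exp_add,
      real_inner_comm s y]
    push_cast
    rw [mul_assoc]
    congr 2
    · congr 1
      ring
    · rw [mul_comm]
  simp_rw [e1]
  rw [integral_const_mul, key]
  have e2 : (Real.pi / ((1 / (2 * v) : ℝ) : ℂ)) = ((2 * Real.pi * v : ℝ) : ℂ) := by
    push_cast; field_simp
  have e3 : ((2 * Real.pi * v : ℝ) : ℂ) ^ ((Module.finrank ℝ (EuclideanSpace ℝ (Fin k)) : ℂ) / 2)
      = ((√(2 * Real.pi * v) ^ k : ℝ) : ℂ) := by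
    rw [Real.sqrt_eq_rpow, ← Real.rpow_mul_natCast (by positivity),
      Complex.ofReal_cpow (by positivity)]
    congr 1
    simp
    ring
  rw [e2, e3, ← mul_assoc, ← Complex.ofReal_mul, ← mul_pow, inv_mul_cancel₀ (by positivity)]
  simp only [one_pow, Complex.ofReal_one, one_mul, Complex.I_sq]
  congr 1
  push_cast
  field_simp
  ring

lemma charFun_map_sqrt_smul_stdGaussian {v : ℝ} (hv : 0 ≤ v) (s : EuclideanSpace ℝ (Fin k)) :
    charFun ((stdGaussian (EuclideanSpace ℝ (Fin k))).map (fun z ↦ √v • z)) s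
      = Complex.exp (-(v * ‖s‖ ^ 2 / 2 : ℝ)) := by
  rw [charFun_map_smul, charFun_stdGaussian, norm_smul]
  congr 1
  have : (‖√v‖ * ‖s‖) ^ 2 = v * ‖s‖ ^ 2 := by
    rw [mul_pow, Real.norm_eq_abs, sq_abs, Real.sq_sqrt hv]
  rw [← Complex.ofReal_pow, this]
  push_cast
  ring

lemma map_sqrt_smul_stdGaussian {v : ℝ} (hv : 0 < v) :
    (stdGaussian (EuclideanSpace ℝ (Fin k))).map (fun z ↦ √v • z) = gaussMeas k v := by
  have := isProbabilityMeasure_gaussMeas (k := k) hv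
  have : IsFiniteMeasure ((stdGaussian (EuclideanSpace ℝ (Fin k))).map (fun z ↦ √v • z)) :=
    inferInstance
  apply Measure.ext_of_charFun
  ext s
  rw [charFun_map_sqrt_smul_stdGaussian hv.le, charFun_gaussMeas hv]

lemma multivariateGaussian_smul_one {v : ℝ} (hv : 0 < v) :
    multivariateGaussian 0 (v • (1 : Matrix (Fin k) (Fin k) ℝ)) = gaussMeas k v := by
  have := isProbabilityMeasure_gaussMeas (k := k) hv
  apply Measure.ext_of_charFun
  ext s
  rw [charFun_gaussMeas hv, charFun_multivariateGaussian (Matrix.PosSemidef.one.smul hv.le)]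
  congr 1
  have : (WithLp.ofLp s ⬝ᵥ (v • (1 : Matrix (Fin k) (Fin k) ℝ)).mulVec (WithLp.ofLp s))
      = v * ‖s‖ ^ 2 := by
    rw [Matrix.smul_mulVec, Matrix.one_mulVec, dotProduct_smul, EuclideanSpace.real_norm_sq_eq,
      smul_eq_mul]
    simp [dotProduct, sq]
  rw [this]
  simp

lemma stdGaussian_eq_gaussMeas :
    stdGaussian (EuclideanSpace ℝ (Fin k)) = gaussMeas k 1 := by
  rw [← map_sqrt_smul_stdGaussian one_pos]
  simp

lemma integral_gaussMeas {v : ℝ} (F : EuclideanSpace ℝ (Fin k) → ℝ) :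
    ∫ y, F y ∂(gaussMeas k v) = ∫ y, gaussDens v y * F y := by
  rw [gaussMeas, integral_withDensity_eq_integral_toReal_smul (by fun_prop)
    (ae_of_all _ fun _ ↦ ENNReal.ofReal_lt_top)]
  simp_rw [ENNReal.toReal_ofReal (gaussDens_nonneg v _), smul_eq_mul]

/-- Exponential moment of a quadratic function of a standard Gaussian vector. -/
lemma integral_exp_quadratic_stdGaussian {p : ℝ} (hp : 0 ≤ p) (q : EuclideanSpace ℝ (Fin k)) :
    ∫ z, Real.exp (-(p * ‖z‖ ^ 2) + ⟪q, z⟫) ∂(stdGaussian (EuclideanSpace ℝ (Fin k)))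
      = (√(1 + 2 * p))⁻¹ ^ k * Real.exp (‖q‖ ^ 2 / (2 * (1 + 2 * p))) := by
  rw [stdGaussian_eq_gaussMeas, integral_gaussMeas]
  set B := 1 + 2 * p with hB
  -- Completing the square: the integrand is a Gaussian of precision B recentred at B⁻¹ q.
  have hB0 : 0 < B := by positivity
  have e : ∀ z : EuclideanSpace ℝ (Fin k),
      gaussDens 1 z * Real.exp (-(p * ‖z‖ ^ 2) + ⟪q, z⟫)
      = ((√(2 * Real.pi * 1))⁻¹ ^ k * Real.exp (‖q‖ ^ 2 / (2 * B)))
        * Real.exp (-((B / 2) * ‖z - B⁻¹ • q‖ ^ 2)) := by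
    intro z
    have h : Real.exp (-(‖z‖ ^ 2 / (2 * 1))) * Real.exp (-(p * ‖z‖ ^ 2) + ⟪q, z⟫)
        = Real.exp (‖q‖ ^ 2 / (2 * B)) * Real.exp (-((B / 2) * ‖z - B⁻¹ • q‖ ^ 2)) := by
      rw [← Real.exp_add, ← Real.exp_add]
      congr 1
      rw [norm_sub_sq_real, norm_smul, inner_smul_right, real_inner_comm, mul_pow, Real.norm_eq_abs,
        sq_abs]
      field_simp
      rw [hB]
      ring
    rw [gaussDens]
    linear_combination (√(2 * Real.pi * 1))⁻¹ ^ k * h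
  simp_rw [e]
  rw [integral_const_mul, integral_sub_right_eq_self (fun z ↦ Real.exp (-((B / 2) * ‖z‖ ^ 2))),
    integral_exp_neg_mul_norm_sq (by positivity)]
  have : Real.pi / (B / 2) = (2 * Real.pi * 1) * B⁻¹ := by field_simp
  rw [this, Real.sqrt_mul (x := 2 * Real.pi * 1) (by positivity) B⁻¹, mul_pow (√(2 * Real.pi * 1)),
    Real.sqrt_inv]
  have h2 : (√(2 * Real.pi * 1))⁻¹ ^ k * √(2 * Real.pi * 1) ^ k = 1 := by
    rw [← mul_pow, inv_mul_cancel₀ (by positivity), one_pow]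
  linear_combination ((√B)⁻¹ ^ k * Real.exp (‖q‖ ^ 2 / (2 * B))) * h2

lemma sqrt_mul_gaussDens_aux {a b : ℝ} (ha : 0 ≤ a) :
    (√a)⁻¹ ^ k * (√b)⁻¹ ^ k = (√(a * b))⁻¹ ^ k := by
  rw [← mul_pow, ← mul_inv, Real.sqrt_mul ha]

lemma integral_gaussDens_sub_smul {t : ℝ} (ht : 0 < t) (β : ℝ) (y : EuclideanSpace ℝ (Fin k)) :
    ∫ z, gaussDens t (y - β • z) ∂(stdGaussian (EuclideanSpace ℝ (Fin k)))
      = gaussDens (t + β ^ 2) y := by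
  have e : ∀ z : EuclideanSpace ℝ (Fin k), gaussDens t (y - β • z)
      = gaussDens t y * Real.exp (-((β ^ 2 / (2 * t)) * ‖z‖ ^ 2) + ⟪(β / t) • y, z⟫) := by
    intro z
    have h : Real.exp (-(‖y - β • z‖ ^ 2 / (2 * t))) = Real.exp (-(‖y‖ ^ 2 / (2 * t))) *
        Real.exp (-((β ^ 2 / (2 * t)) * ‖z‖ ^ 2) + ⟪(β / t) • y, z⟫) := by
      rw [← Real.exp_add]
      congr 1
      rw [norm_sub_sq_real, norm_smul, inner_smul_right, real_inner_smul_left, mul_pow,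
        Real.norm_eq_abs, sq_abs]
      field_simp
      ring
    simp only [gaussDens]
    rw [h]
    exact (mul_assoc _ _ _).symm
  simp_rw [e]
  rw [integral_const_mul, integral_exp_quadratic_stdGaussian (by positivity), gaussDens, gaussDens]
  have h1 : 1 + 2 * (β ^ 2 / (2 * t)) = (t + β ^ 2) / t := by field_simp
  rw [h1, mul_mul_mul_comm, sqrt_mul_gaussDens_aux (by positivity), ← Real.exp_add]
  congr 3
  · congr 1; field_simp
  · rw [norm_smul, mul_pow, Real.norm_eq_abs, sq_abs]
    field_simp
    ring

/-- The Gaussian overlap integral `E φ_t(y - U) φ_t(y - V)` for `U = w z`, `V = α z + β u`. -/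
lemma integral_gaussDens_mul_gaussDens {t τ : ℝ} (ht : 0 < t) (hτ : 0 < τ) (w α : ℝ)
    (y : EuclideanSpace ℝ (Fin k)) :
    ∫ z, gaussDens t (y - w • z) * gaussDens τ (y - α • z)
        ∂(stdGaussian (EuclideanSpace ℝ (Fin k)))
      = (√((2 * Real.pi) ^ 2 * ((t + w ^ 2) * (τ + α ^ 2) - (w * α) ^ 2)))⁻¹ ^ k *
        Real.exp (-(‖y‖ ^ 2 * ((t + w ^ 2) + (τ + α ^ 2) - 2 * (w * α)) /
          (2 * ((t + w ^ 2) * (τ + α ^ 2) - (w * α) ^ 2)))) := by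
  have e : ∀ z : EuclideanSpace ℝ (Fin k), gaussDens t (y - w • z) * gaussDens τ (y - α • z)
      = gaussDens t y * gaussDens τ y *
        Real.exp (-((w ^ 2 / (2 * t) + α ^ 2 / (2 * τ)) * ‖z‖ ^ 2)
          + ⟪(w / t + α / τ) • y, z⟫) := by
    intro z
    have h : Real.exp (-(‖y - w • z‖ ^ 2 / (2 * t))) * Real.exp (-(‖y - α • z‖ ^ 2 / (2 * τ)))
        = Real.exp (-(‖y‖ ^ 2 / (2 * t))) * Real.exp (-(‖y‖ ^ 2 / (2 * τ))) *
          Real.exp (-((w ^ 2 / (2 * t) + α ^ 2 / (2 * τ)) * ‖z‖ ^ 2)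
            + ⟪(w / t + α / τ) • y, z⟫) := by
      rw [← Real.exp_add, ← Real.exp_add, ← Real.exp_add]
      congr 1
      rw [norm_sub_sq_real, norm_sub_sq_real, norm_smul, norm_smul, inner_smul_right,
        inner_smul_right, real_inner_smul_left, mul_pow, Real.norm_eq_abs,
        sq_abs, mul_pow, Real.norm_eq_abs, sq_abs]
      field_simp
      ring
    simp only [gaussDens]
    linear_combination (√(2 * Real.pi * t))⁻¹ ^ k * (√(2 * Real.pi * τ))⁻¹ ^ k * h
  simp_rw [e]
  rw [integral_const_mul, integral_exp_quadratic_stdGaussian (by positivity)]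
  simp only [gaussDens]
  have hD : (t + w ^ 2) * (τ + α ^ 2) - (w * α) ^ 2 = t * τ + w ^ 2 * τ + α ^ 2 * t := by ring
  have h1 : 1 + 2 * (w ^ 2 / (2 * t) + α ^ 2 / (2 * τ))
      = (t * τ + w ^ 2 * τ + α ^ 2 * t) / (t * τ) := by
    field_simp
    ring
  rw [h1, hD, mul_mul_mul_comm (_ ^ k) (Real.exp _), mul_mul_mul_comm, sqrt_mul_gaussDens_aux (by positivity),
    sqrt_mul_gaussDens_aux (by positivity), ← Real.exp_add, ← Real.exp_add]
  have hD0 : 0 < t * τ + w ^ 2 * τ + α ^ 2 * t := by positivity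
  have h2 : 2 * Real.pi * t * (2 * Real.pi * τ) * ((t * τ + w ^ 2 * τ + α ^ 2 * t) / (t * τ))
      = (2 * Real.pi) ^ 2 * (t * τ + w ^ 2 * τ + α ^ 2 * t) := by field_simp
  rw [h2]
  congr 2
  rw [norm_smul, mul_pow, Real.norm_eq_abs, sq_abs]
  field_simp
  ring

end GaussDens

/-! ### Joint Gaussian law of the projections of two fixed vectors -/

/-- The linear projection `Θ x` as a vector of Euclidean space. -/
noncomputable def randProj {k n : ℕ} (θ : Fin k → Fin n → ℝ) (x : EuclideanSpace ℝ (Fin n)) :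
    EuclideanSpace ℝ (Fin k) :=
  WithLp.toLp 2 (Matrix.mulVec (Matrix.of θ) (WithLp.ofLp x))

section RandProj

variable {k n : ℕ}

lemma randProj_apply (θ : Fin k → Fin n → ℝ) (x : EuclideanSpace ℝ (Fin n)) (i : Fin k) :
    randProj θ x i = ∑ j, θ i j * x j := rfl

lemma randProj_add (θ : Fin k → Fin n → ℝ) (x x' : EuclideanSpace ℝ (Fin n)) :
    randProj θ (x + x') = randProj θ x + randProj θ x' := by
  ext i
  simp [randProj_apply, mul_add, Finset.sum_add_distrib]

lemma randProj_smul (θ : Fin k → Fin n → ℝ) (c : ℝ) (x : EuclideanSpace ℝ (Fin n)) :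
    randProj θ (c • x) = c • randProj θ x := by
  ext i
  simp only [randProj_apply, PiLp.smul_apply, smul_eq_mul, Finset.mul_sum]
  exact Finset.sum_congr rfl fun j _ ↦ by ring

lemma continuous_randProj :
    Continuous fun p : (Fin k → Fin n → ℝ) × EuclideanSpace ℝ (Fin n) ↦ randProj p.1 p.2 := by
  refine (PiLp.continuous_toLp 2 _).comp (continuous_pi fun i ↦ ?_)
  simp only [Matrix.mulVec, dotProduct, Matrix.of_apply]
  fun_prop

@[fun_prop]
lemma measurable_randProj {α : Type*} [MeasurableSpace α] {f : α → Fin k → Fin n → ℝ}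
    {g : α → EuclideanSpace ℝ (Fin n)} (hf : Measurable f) (hg : Measurable g) :
    Measurable fun a ↦ randProj (f a) (g a) :=
  continuous_randProj.measurable.comp (hf.prodMk hg)

variable {Ω : Type*} [MeasurableSpace Ω] {P : Measure Ω}
  {Θ : Ω → Fin k → Fin n → ℝ}

/-- The characteristic function of a matrix with i.i.d. centred Gaussian entries. -/
lemma integral_cexp_sum_entries (hΘm : Measurable Θ)
    (hΘlaw : ∀ i j, HasLaw (fun ω => Θ ω i j) (gaussianReal 0 (1 / (n : ℝ≥0))) P)
    (hΘindep : iIndepFun (fun (ij : Fin k × Fin n) ω => Θ ω ij.1 ij.2) P)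
    (a : Fin k × Fin n → ℝ) :
    ∫ ω, Complex.exp ((∑ ij, a ij * Θ ω ij.1 ij.2 : ℝ) * Complex.I) ∂P
      = Complex.exp (-((1 / n) * (∑ ij, a ij ^ 2) / 2 : ℝ)) := by
  have hm : ∀ ij : Fin k × Fin n, Measurable fun ω ↦ Θ ω ij.1 ij.2 := fun ij ↦ by fun_prop
  have hind : iIndepFun (fun (ij : Fin k × Fin n) ω ↦
      Complex.exp ((a ij * Θ ω ij.1 ij.2 : ℝ) * Complex.I)) P :=
    hΘindep.comp (fun ij (x : ℝ) ↦ Complex.exp ((a ij * x : ℝ) * Complex.I)) fun ij ↦ by fun_prop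
  have e : ∀ ω, Complex.exp ((∑ ij, a ij * Θ ω ij.1 ij.2 : ℝ) * Complex.I)
      = ∏ ij : Fin k × Fin n, Complex.exp ((a ij * Θ ω ij.1 ij.2 : ℝ) * Complex.I) := by
    intro ω
    rw [← Complex.exp_sum, Complex.ofReal_sum, Finset.sum_mul]
  simp_rw [e]
  rw [hind.integral_fun_prod_eq_prod_integral fun ij ↦ by
    have := hm ij
    exact Measurable.aestronglyMeasurable (by fun_prop)]
  have h1 : ∀ ij : Fin k × Fin n,
      ∫ ω, Complex.exp ((a ij * Θ ω ij.1 ij.2 : ℝ) * Complex.I) ∂P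
        = Complex.exp (-((1 / n) * a ij ^ 2 / 2 : ℝ)) := by
    intro ij
    have := charFun_gaussianReal (μ := 0) (v := 1 / (n : ℝ≥0)) (a ij)
    rw [← (hΘlaw ij.1 ij.2).map_eq, charFun_apply_real,
      integral_map (hm ij).aemeasurable (by fun_prop)] at this
    push_cast at this ⊢
    rw [this]
    congr 1
    ring
  simp_rw [h1]
  rw [← Complex.exp_sum, Finset.sum_neg_distrib, ← Complex.ofReal_sum, Finset.mul_sum,
    Finset.sum_div]

lemma inner_randProj_add (θ : Fin k → Fin n → ℝ) (x x' : EuclideanSpace ℝ (Fin n))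
    (s s' : EuclideanSpace ℝ (Fin k)) :
    ⟪randProj θ x, s⟫ + ⟪randProj θ x', s'⟫
      = ∑ ij : Fin k × Fin n, (s ij.1 * x ij.2 + s' ij.1 * x' ij.2) * θ ij.1 ij.2 := by
  rw [Fintype.sum_prod_type]
  simp only [PiLp.inner_apply, randProj_apply, RCLike.inner_apply, conj_trivial]
  rw [← Finset.sum_add_distrib]
  refine Finset.sum_congr rfl fun i _ ↦ ?_
  rw [Finset.mul_sum, Finset.mul_sum, ← Finset.sum_add_distrib]
  exact Finset.sum_congr rfl fun j _ ↦ by ring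

/-- The cross term is the Frobenius product of two rank-one matrices; this is how ⟪x, x'⟫ becomes
the correlation of the two projections. -/
lemma sum_sq_outer_add (x x' : EuclideanSpace ℝ (Fin n)) (s s' : EuclideanSpace ℝ (Fin k)) :
    ∑ ij : Fin k × Fin n, (s ij.1 * x ij.2 + s' ij.1 * x' ij.2) ^ 2
      = ‖s‖ ^ 2 * ‖x‖ ^ 2 + 2 * ⟪s, s'⟫ * ⟪x, x'⟫ + ‖s'‖ ^ 2 * ‖x'‖ ^ 2 := by
  rw [Fintype.sum_prod_type]
  simp only [EuclideanSpace.real_norm_sq_eq, PiLp.inner_apply, RCLike.inner_apply, conj_trivial]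
  rw [Finset.sum_mul_sum, Finset.sum_mul_sum, mul_assoc, Finset.sum_mul_sum, Finset.mul_sum,
    ← Finset.sum_add_distrib, ← Finset.sum_add_distrib]
  refine Finset.sum_congr rfl fun i _ ↦ ?_
  rw [Finset.mul_sum, ← Finset.sum_add_distrib, ← Finset.sum_add_distrib]
  exact Finset.sum_congr rfl fun j _ ↦ by ring

lemma integral_cexp_inner_randProj (hΘm : Measurable Θ)
    (hΘlaw : ∀ i j, HasLaw (fun ω => Θ ω i j) (gaussianReal 0 (1 / (n : ℝ≥0))) P)
    (hΘindep : iIndepFun (fun (ij : Fin k × Fin n) ω => Θ ω ij.1 ij.2) P)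
    (x x' : EuclideanSpace ℝ (Fin n)) (s s' : EuclideanSpace ℝ (Fin k)) :
    ∫ ω, Complex.exp ((⟪randProj (Θ ω) x, s⟫ + ⟪randProj (Θ ω) x', s'⟫ : ℝ) * Complex.I) ∂P
      = Complex.exp (-((1 / n) * (‖s‖ ^ 2 * ‖x‖ ^ 2 + 2 * ⟪s, s'⟫ * ⟪x, x'⟫
          + ‖s'‖ ^ 2 * ‖x'‖ ^ 2) / 2 : ℝ)) := by
  simp_rw [inner_randProj_add]
  rw [integral_cexp_sum_entries hΘm hΘlaw hΘindep (fun ij ↦ s ij.1 * x ij.2 + s' ij.1 * x' ij.2),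
    sum_sq_outer_add]

/-- `Θ x` is a centred isotropic Gaussian vector with variance `‖x‖² / n`. -/
lemma map_randProj [IsProbabilityMeasure P] (hΘm : Measurable Θ)
    (hΘlaw : ∀ i j, HasLaw (fun ω => Θ ω i j) (gaussianReal 0 (1 / (n : ℝ≥0))) P)
    (hΘindep : iIndepFun (fun (ij : Fin k × Fin n) ω => Θ ω ij.1 ij.2) P)
    (x : EuclideanSpace ℝ (Fin n)) :
    P.map (fun ω ↦ randProj (Θ ω) x)
      = (stdGaussian (EuclideanSpace ℝ (Fin k))).map fun z ↦ √(‖x‖ ^ 2 / n) • z := by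
  have hm : Measurable fun ω ↦ randProj (Θ ω) x := by fun_prop
  have := Measure.isProbabilityMeasure_map (μ := P) hm.aemeasurable
  apply Measure.ext_of_charFun
  ext s
  rw [charFun_map_sqrt_smul_stdGaussian (by positivity), charFun_apply,
    integral_map hm.aemeasurable (by fun_prop)]
  have := integral_cexp_inner_randProj hΘm hΘlaw hΘindep x 0 s 0
  simp only [inner_zero_right, add_zero] at this
  rw [this]
  congr 3
  simp
  ring

/-- Projections of orthogonal vectors are independent. -/
lemma indepFun_randProj [IsProbabilityMeasure P] (hΘm : Measurable Θ)
    (hΘlaw : ∀ i j, HasLaw (fun ω => Θ ω i j) (gaussianReal 0 (1 / (n : ℝ≥0))) P)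
    (hΘindep : iIndepFun (fun (ij : Fin k × Fin n) ω => Θ ω ij.1 ij.2) P)
    {x x' : EuclideanSpace ℝ (Fin n)} (hxx' : ⟪x, x'⟫ = 0) :
    IndepFun (fun ω ↦ randProj (Θ ω) x) (fun ω ↦ randProj (Θ ω) x') P := by
  have hm : Measurable fun ω ↦ randProj (Θ ω) x := by fun_prop
  have hm' : Measurable fun ω ↦ randProj (Θ ω) x' := by fun_prop
  rw [indepFun_iff_charFun_prod hm.aemeasurable hm'.aemeasurable]
  intro s
  have hmm : Measurable fun ω ↦ WithLp.toLp 2 (randProj (Θ ω) x, randProj (Θ ω) x') := by fun_prop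
  rw [map_randProj hΘm hΘlaw hΘindep, map_randProj hΘm hΘlaw hΘindep,
    charFun_map_sqrt_smul_stdGaussian (by positivity),
    charFun_map_sqrt_smul_stdGaussian (by positivity), charFun_apply,
    integral_map hmm.aemeasurable (by fun_prop)]
  have := integral_cexp_inner_randProj hΘm hΘlaw hΘindep x x' s.ofLp.1 s.ofLp.2
  simp only [WithLp.prod_inner_apply]
  -- Orthogonality removes the only cross term, so the joint characteristic function factors.
  rw [this, ← Complex.exp_add, hxx']
  congr 1
  push_cast
  simp
  ring

lemma hasLaw_randProj_pair [IsProbabilityMeasure P] (hΘm : Measurable Θ)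
    (hΘlaw : ∀ i j, HasLaw (fun ω => Θ ω i j) (gaussianReal 0 (1 / (n : ℝ≥0))) P)
    (hΘindep : iIndepFun (fun (ij : Fin k × Fin n) ω => Θ ω ij.1 ij.2) P)
    {x x' : EuclideanSpace ℝ (Fin n)} (hxx' : ⟪x, x'⟫ = 0) :
    P.map (fun ω ↦ (randProj (Θ ω) x, randProj (Θ ω) x'))
      = ((stdGaussian (EuclideanSpace ℝ (Fin k))).prod
          (stdGaussian (EuclideanSpace ℝ (Fin k)))).map
        fun z ↦ (√(‖x‖ ^ 2 / n) • z.1, √(‖x'‖ ^ 2 / n) • z.2) := by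
  have hm : Measurable fun ω ↦ randProj (Θ ω) x := by fun_prop
  have hm' : Measurable fun ω ↦ randProj (Θ ω) x' := by fun_prop
  rw [(indepFun_iff_map_prod_eq_prod_map_map hm.aemeasurable hm'.aemeasurable).1
    (indepFun_randProj hΘm hΘlaw hΘindep hxx'), map_randProj hΘm hΘlaw hΘindep,
    map_randProj hΘm hΘlaw hΘindep, Measure.map_prod_map _ _ (by fun_prop) (by fun_prop)]
  rfl

/-- The two-point overlap of the conditional densities, averaged over `Θ`. -/
noncomputable def overlap (k : ℕ) (a b s r : ℝ) : ℝ :=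
  (√((2 * Real.pi) ^ 2 * (a * b - s ^ 2)))⁻¹ ^ k *
    Real.exp (-(r * (a + b - 2 * s) / (2 * (a * b - s ^ 2))))

lemma integral_gaussDens_randProj [IsProbabilityMeasure P] (hΘm : Measurable Θ)
    (hΘlaw : ∀ i j, HasLaw (fun ω => Θ ω i j) (gaussianReal 0 (1 / (n : ℝ≥0))) P)
    (hΘindep : iIndepFun (fun (ij : Fin k × Fin n) ω => Θ ω ij.1 ij.2) P)
    {t : ℝ} (ht : 0 < t) (x : EuclideanSpace ℝ (Fin n)) (y : EuclideanSpace ℝ (Fin k)) :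
    ∫ ω, gaussDens t (y - randProj (Θ ω) x) ∂P = gaussDens (‖x‖ ^ 2 / n + t) y := by
  have hm : Measurable fun ω ↦ randProj (Θ ω) x := by fun_prop
  rw [← integral_map (f := fun u ↦ gaussDens t (y - u)) hm.aemeasurable (by fun_prop),
    map_randProj hΘm hΘlaw hΘindep, integral_map (by fun_prop) (by fun_prop),
    integral_gaussDens_sub_smul ht, Real.sq_sqrt (by positivity), add_comm]

lemma integral_gaussDens_mul_randProj [IsProbabilityMeasure P] (hΘm : Measurable Θ)
    (hΘlaw : ∀ i j, HasLaw (fun ω => Θ ω i j) (gaussianReal 0 (1 / (n : ℝ≥0))) P)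
    (hΘindep : iIndepFun (fun (ij : Fin k × Fin n) ω => Θ ω ij.1 ij.2) P) (hn : 0 < n)
    {t : ℝ} (ht : 0 < t) {x : EuclideanSpace ℝ (Fin n)} (hx : x ≠ 0)
    (x' : EuclideanSpace ℝ (Fin n)) (y : EuclideanSpace ℝ (Fin k)) :
    ∫ ω, gaussDens t (y - randProj (Θ ω) x) * gaussDens t (y - randProj (Θ ω) x') ∂P
      = overlap k (‖x‖ ^ 2 / n + t) (‖x'‖ ^ 2 / n + t) (⟪x, x'⟫ / n) (‖y‖ ^ 2) := by
  have hx0 : 0 < ‖x‖ := norm_pos_iff.2 hx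
  -- Gram-Schmidt: x' = l x + o with o orthogonal to x, so Θx and Θo are independent and the
  -- integral reduces to two successive Gaussian convolutions. Dividing by ‖x‖² requires x ≠ 0.
  set l : ℝ := ⟪x, x'⟫ / ‖x‖ ^ 2 with hl
  set o : EuclideanSpace ℝ (Fin n) := x' - l • x with ho
  have hox : ⟪x, o⟫ = 0 := by
    rw [ho, inner_sub_right, inner_smul_right, real_inner_self_eq_norm_sq, hl]
    field_simp
    ring
  have hx' : x' = l • x + o := by rw [ho]; abel
  have hon : ‖o‖ ^ 2 = ‖x'‖ ^ 2 - ⟪x, x'⟫ ^ 2 / ‖x‖ ^ 2 := by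
    rw [ho, norm_sub_sq_real, norm_smul, inner_smul_right, real_inner_comm, mul_pow,
      Real.norm_eq_abs, sq_abs, hl]
    field_simp
    ring
  have e : ∀ ω, gaussDens t (y - randProj (Θ ω) x) * gaussDens t (y - randProj (Θ ω) x')
      = (fun p : EuclideanSpace ℝ (Fin k) × EuclideanSpace ℝ (Fin k) ↦
        gaussDens t (y - p.1) * gaussDens t (y - (l • p.1 + p.2)))
        (randProj (Θ ω) x, randProj (Θ ω) o) := by
    intro ω
    simp only
    rw [← randProj_smul, ← randProj_add, ← hx']
  have hmm : Measurable fun ω ↦ (randProj (Θ ω) x, randProj (Θ ω) o) := by fun_prop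
  have hc : Continuous (fun p : EuclideanSpace ℝ (Fin k) × EuclideanSpace ℝ (Fin k) ↦
        gaussDens t (y - p.1) * gaussDens t (y - (l • p.1 + p.2))) := by fun_prop
  simp_rw [e]
  rw [← integral_map hmm.aemeasurable hc.aestronglyMeasurable,
    hasLaw_randProj_pair hΘm hΘlaw hΘindep hox,
    integral_map (by fun_prop) hc.aestronglyMeasurable]
  set w := √(‖x‖ ^ 2 / n) with hw
  set β := √(‖o‖ ^ 2 / n) with hβ
  have hint : Integrable (fun z : EuclideanSpace ℝ (Fin k) × EuclideanSpace ℝ (Fin k) ↦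
      gaussDens t (y - w • z.1) * gaussDens t (y - (l • w • z.1 + β • z.2)))
      ((stdGaussian (EuclideanSpace ℝ (Fin k))).prod
          (stdGaussian (EuclideanSpace ℝ (Fin k)))) := by
    refine Integrable.of_bound (C := (√(2 * Real.pi * t))⁻¹ ^ k * (√(2 * Real.pi * t))⁻¹ ^ k)
      (Continuous.aestronglyMeasurable (by fun_prop)) (ae_of_all _ fun z ↦ ?_)
    rw [Real.norm_of_nonneg (mul_nonneg (gaussDens_nonneg _ _) (gaussDens_nonneg _ _))]
    exact mul_le_mul (gaussDens_le ht _) (gaussDens_le ht _) (gaussDens_nonneg _ _) (by positivity)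
  rw [integral_prod _ hint]
  have e2 : ∀ z : EuclideanSpace ℝ (Fin k),
      ∫ z', gaussDens t (y - w • z) * gaussDens t (y - (l • w • z + β • z'))
        ∂(stdGaussian (EuclideanSpace ℝ (Fin k)))
      = gaussDens t (y - w • z) * gaussDens (t + β ^ 2) (y - (l * w) • z) := by
    intro z
    rw [integral_const_mul, ← integral_gaussDens_sub_smul ht]
    simp_rw [smul_smul, sub_sub]
  simp_rw [e2]
  rw [integral_gaussDens_mul_gaussDens ht (by positivity), overlap]
  have hw2 : w ^ 2 = ‖x‖ ^ 2 / n := Real.sq_sqrt (by positivity)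
  have hβ2 : β ^ 2 = ‖o‖ ^ 2 / n := Real.sq_sqrt (by positivity)
  have hn' : (n : ℝ) ≠ 0 := by positivity
  have h1 : t + w ^ 2 = ‖x‖ ^ 2 / n + t := by rw [hw2, add_comm]
  have h2 : t + β ^ 2 + (l * w) ^ 2 = ‖x'‖ ^ 2 / n + t := by
    rw [mul_pow, hw2, hβ2, hon, hl]
    field_simp
    ring
  have h3 : w * (l * w) = ⟪x, x'⟫ / n := by
    rw [mul_left_comm, ← sq, hw2, hl]
    field_simp
  rw [h1, h2, h3]

end RandProj

/-! ### Mehler-type expansion of the overlap in the correlation -/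

section OverlapBounds

lemma one_le_inv_sqrt_one_sub_sq {u : ℝ} (hu1 : u ^ 2 < 1) : 1 ≤ (√(1 - u ^ 2))⁻¹ := by
  rw [one_le_inv₀ (Real.sqrt_pos.2 (by linarith))]
  exact Real.sqrt_le_one.2 (by nlinarith [sq_nonneg u])

/-- Convexity of `z ↦ (1 - z)^(-k/2)`, along the chord from `0` to `ρ²`. -/
lemma inv_sqrt_pow_sub_one_le (k : ℕ) {u ρ : ℝ} (hu : 0 ≤ u) (huρ : u ≤ ρ) (hρ0 : 0 < ρ)
    (hρ : ρ < 1) :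
    (√(1 - u ^ 2))⁻¹ ^ k - 1 ≤ (u / ρ) ^ 2 * ((√(1 - ρ ^ 2))⁻¹ ^ k - 1) := by
  set l := (u / ρ) ^ 2 with hl
  have hl0 : 0 ≤ l := sq_nonneg _
  have hl1 : l ≤ 1 := by
    rw [hl, sq_le_one_iff₀ (by positivity), div_le_one hρ0]
    exact huρ
  have hρ2 : ρ ^ 2 < 1 := by nlinarith
  have hu2 : u ^ 2 < 1 := by nlinarith
  have hulρ : u ^ 2 = l * ρ ^ 2 := by rw [hl]; field_simp
  set b := (√(1 - ρ ^ 2))⁻¹ with hb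
  have hb1 : 1 ≤ b := one_le_inv_sqrt_one_sub_sq hρ2
  have hb2 : 1 - ρ ^ 2 = (b⁻¹) ^ 2 := by rw [hb, inv_inv, Real.sq_sqrt (by linarith)]
  have hf0 : 0 < (1 - l) + l * b := by nlinarith
  -- The chord bound for the inverse square root: 1 - u² = (1-l) + l b⁻² ≥ ((1-l) + l b⁻¹)² ≥ ((1-l)
  -- + l b)⁻², by convexity of squaring and then by b + b⁻¹ ≥ 2. Convexity of the k-th power
  -- finishes.
  have h1 : (√(1 - u ^ 2))⁻¹ ≤ (1 - l) + l * b := by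
    rw [inv_le_comm₀ (Real.sqrt_pos.2 (by linarith)) hf0]
    refine Real.le_sqrt_of_sq_le ?_
    have e : 1 - u ^ 2 = (1 - l) + l * (b⁻¹) ^ 2 := by rw [← hb2, hulρ]; ring
    have hinv : ((1 - l) + l * b)⁻¹ ≤ (1 - l) + l * b⁻¹ := by
      rw [inv_le_iff_one_le_mul₀ hf0]
      have : b * b⁻¹ = 1 := mul_inv_cancel₀ (by positivity)
      have h2 : 2 ≤ b + b⁻¹ := by
        have : (b - 1) ^ 2 * b⁻¹ = b + b⁻¹ - 2 := by
          field_simp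
          ring
        have h0 : 0 ≤ (b - 1) ^ 2 * b⁻¹ := by positivity
        linarith
      have : ((1 - l) + l * b⁻¹) * ((1 - l) + l * b)
          = 1 + l * (1 - l) * (b + b⁻¹ - 2) + l ^ 2 * (b * b⁻¹ - 1) := by ring
      rw [this, mul_inv_cancel₀ (by positivity)]
      nlinarith [mul_nonneg (mul_nonneg hl0 (sub_nonneg.2 hl1)) (sub_nonneg.2 h2)]
    calc (((1 - l) + l * b)⁻¹) ^ 2 ≤ ((1 - l) + l * b⁻¹) ^ 2 :=
          pow_le_pow_left₀ (by positivity) hinv 2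
      _ ≤ (1 - l) + l * (b⁻¹) ^ 2 := by
          nlinarith [mul_nonneg (mul_nonneg hl0 (sub_nonneg.2 hl1)) (sq_nonneg (1 - b⁻¹))]
      _ = _ := e.symm
  have h2 : ((1 - l) + l * b) ^ k ≤ (1 - l) * 1 ^ k + l * b ^ k := by
    have := (convexOn_pow (𝕜 := ℝ) k).2 (Set.mem_Ici.2 zero_le_one)
      (Set.mem_Ici.2 (zero_le_one.trans hb1)) (sub_nonneg.2 hl1) hl0 (by ring)
    simpa using this
  have h3 := pow_le_pow_left₀ (inv_nonneg.2 (Real.sqrt_nonneg _)) h1 k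
  rw [one_pow] at h2
  linarith

/-- Only powers of degree at least two remain in the series, and on each of them l ≤ 1 yields a
factor l². -/
lemma exp_sub_one_sub_le {l x : ℝ} (hl : 0 ≤ l) (hl1 : l ≤ 1) (hx : 0 ≤ x) :
    Real.exp (l * x) - 1 - l * x ≤ l ^ 2 * (Real.exp x - 1 - x) := by
  have hs : ∀ z : ℝ, HasSum (fun n : ℕ ↦ z ^ (n + 2) / (n + 2).factorial)
      (Real.exp z - 1 - z) := by
    intro z
    have h := NormedSpace.expSeries_div_hasSum_exp z
    rw [← Real.exp_eq_exp_ℝ] at h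
    have := (hasSum_nat_add_iff' 2).2 h
    simpa [Finset.sum_range_succ, sub_sub] using this
  refine hasSum_le (fun n ↦ ?_) (hs (l * x)) ((hs x).mul_left (l ^ 2))
  rw [mul_pow, ← mul_div_assoc]
  have : l ^ (n + 2) ≤ l ^ 2 := pow_le_pow_of_le_one hl hl1 (by omega)
  gcongr

/-- With A the prefactor and e the exponential, A e - 1 = (A - 1) e + (e - 1). The prefactor depends
on u² only, so the sole linear contribution is r u, from the exponential. All remainders are
compared with the kernel at the extreme value ρ, at the rate (u/ρ)². -/
lemma mehler_sub_one_le (k : ℕ) {r u ρ : ℝ} (hr : 0 ≤ r) (hu : 0 ≤ u) (huρ : u ≤ ρ)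
    (hρ0 : 0 < ρ) (hρ : ρ < 1) :
    (√(1 - u ^ 2))⁻¹ ^ k * Real.exp (r * (u / (1 + u))) - 1
      ≤ r * u + 4 * (u / ρ) ^ 2 * ((√(1 - ρ ^ 2))⁻¹ ^ k * Real.exp (r * (ρ / (1 + ρ)))) := by
  have hA := inv_sqrt_pow_sub_one_le k hu huρ hρ0 hρ
  have hA1 : 1 ≤ (√(1 - u ^ 2))⁻¹ ^ k := one_le_pow₀ (one_le_inv_sqrt_one_sub_sq (by nlinarith))
  have hB1 : 1 ≤ (√(1 - ρ ^ 2))⁻¹ ^ k := one_le_pow₀ (one_le_inv_sqrt_one_sub_sq (by nlinarith))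
  set A := (√(1 - u ^ 2))⁻¹ ^ k
  set B := (√(1 - ρ ^ 2))⁻¹ ^ k
  set x := r * (ρ / (1 + ρ)) with hx
  have hx0 : 0 ≤ x := by positivity
  set l := (u / (1 + u)) / (ρ / (1 + ρ)) with hl
  have hl0 : 0 ≤ l := by positivity
  have hll : u / (1 + u) ≤ ρ / (1 + ρ) := by
    rw [div_le_div_iff₀ (by positivity) (by positivity)]
    nlinarith
  have hl1 : l ≤ 1 := (div_le_one (by positivity)).2 hll
  -- The loss is (1 + ρ)/(1 + u) ≤ 2; its square is the 4 in the conclusion.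
  have hl2 : l ≤ 2 * (u / ρ) := by
    have : l = (u / ρ) * ((1 + ρ) / (1 + u)) := by rw [hl]; field_simp
    rw [this, mul_comm 2]
    refine mul_le_mul_of_nonneg_left ?_ (by positivity)
    rw [div_le_iff₀ (by positivity)]
    linarith
  have hlx : r * (u / (1 + u)) = l * x := by rw [hl, hx]; field_simp
  have hexp := exp_sub_one_sub_le hl0 hl1 hx0
  rw [← hlx] at hexp
  have hmono : Real.exp (r * (u / (1 + u))) ≤ Real.exp x :=
    Real.exp_le_exp.2 (mul_le_mul_of_nonneg_left hll hr)
  have hru : r * (u / (1 + u)) ≤ r * u :=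
    mul_le_mul_of_nonneg_left (div_le_self hu (by linarith)) hr
  have hlsq : l ^ 2 ≤ 4 * (u / ρ) ^ 2 := by
    calc l ^ 2 ≤ (2 * (u / ρ)) ^ 2 := pow_le_pow_left₀ hl0 hl2 2
      _ = _ := by ring
  set e := Real.exp (r * (u / (1 + u)))
  set E := Real.exp x
  have hE : 0 < E := Real.exp_pos x
  have hE1 : 0 ≤ E - 1 - x := by linarith [Real.add_one_le_exp x]
  have h1 : (A - 1) * e ≤ (u / ρ) ^ 2 * (B - 1) * E :=
    mul_le_mul hA hmono (Real.exp_pos _).le (by nlinarith [sq_nonneg (u / ρ)])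
  have h2 : l ^ 2 * (E - 1 - x) ≤ 4 * (u / ρ) ^ 2 * E :=
    mul_le_mul hlsq (by linarith) hE1 (by positivity)
  have h3 : 0 ≤ (u / ρ) ^ 2 * E * (B - 1) :=
    mul_nonneg (by positivity) (by linarith)
  nlinarith

/-- The inequalities a + b ≥ 2√(ab) and s ≤ |s| reduce to equal variances √(ab) and nonnegative
correlation, where the ratio to the uncorrelated overlap is exactly Mehler's kernel. -/
lemma overlap_le {k : ℕ} {a b s r : ℝ} (ha : 0 < a) (hb : 0 < b) (hr : 0 ≤ r)
    (hs : |s| < √(a * b)) :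
    overlap k a b s r ≤ overlap k a b 0 r * ((√(1 - (|s| / √(a * b)) ^ 2))⁻¹ ^ k *
      Real.exp (r / √(a * b) * ((|s| / √(a * b)) / (1 + |s| / √(a * b))))) := by
  set d := √(a * b) with hd
  have hd0 : 0 < d := Real.sqrt_pos.2 (by positivity)
  have hd2 : a * b = d ^ 2 := (Real.sq_sqrt (by positivity)).symm
  have hs0 := abs_nonneg s
  have hss : s ^ 2 = |s| ^ 2 := (sq_abs s).symm
  have hlt : |s| ^ 2 < d ^ 2 := by nlinarith
  have hab : 2 * d ≤ a + b := by nlinarith [sq_nonneg (a - b)]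
  have hz : d ^ 2 - (0 : ℝ) ^ 2 = d ^ 2 := by ring
  simp only [overlap, hd2]
  rw [hz, mul_mul_mul_comm, sqrt_mul_gaussDens_aux (by positivity), ← Real.exp_add]
  have e1 : (2 * Real.pi) ^ 2 * d ^ 2 * (1 - (|s| / d) ^ 2)
      = (2 * Real.pi) ^ 2 * (d ^ 2 - s ^ 2) := by
    rw [hss]
    field_simp
  rw [e1]
  refine mul_le_mul_of_nonneg_left (Real.exp_le_exp.2 ?_) (by positivity)
  have hkey : s * (2 * d ^ 2 - (a + b) * s) ≤ 2 * |s| * d * (d - |s|) := by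
    have h1 : s * (2 * d ^ 2) ≤ |s| * (2 * d ^ 2) :=
      mul_le_mul_of_nonneg_right (le_abs_self s) (by positivity)
    have h2 : 2 * d * s ^ 2 ≤ (a + b) * s ^ 2 := mul_le_mul_of_nonneg_right hab (sq_nonneg s)
    nlinarith
  have e2 : -(r * (a + b - 2 * 0) / (2 * d ^ 2)) + r / d * (|s| / d / (1 + |s| / d))
      - -(r * (a + b - 2 * s) / (2 * (d ^ 2 - s ^ 2)))
      = r * ((2 * |s| * d * (d - |s|)) - s * (2 * d ^ 2 - (a + b) * s))
          / (2 * d ^ 2 * (d ^ 2 - s ^ 2)) := by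
    have h1 : d + |s| ≠ 0 := by positivity
    have h2 : d - |s| ≠ 0 := by linarith
    have h3 : d ^ 2 - s ^ 2 = (d - |s|) * (d + |s|) := by rw [hss]; ring
    rw [h3]
    field_simp
    linear_combination (-(r * (a + b))) * hss
  have : 0 ≤ r * ((2 * |s| * d * (d - |s|)) - s * (2 * d ^ 2 - (a + b) * s))
          / (2 * d ^ 2 * (d ^ 2 - s ^ 2)) := by
    refine div_nonneg (mul_nonneg hr (by linarith)) (mul_nonneg (by positivity) ?_)
    rw [hss]
    linarith
  linarith

variable {k : ℕ}

lemma gaussDens_sq (d : ℝ) (y : EuclideanSpace ℝ (Fin k)) :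
    gaussDens d y ^ 2 = (√(2 * Real.pi * d))⁻¹ ^ k * (√(2 * Real.pi * d))⁻¹ ^ k *
      Real.exp (-(‖y‖ ^ 2 / d)) := by
  rw [gaussDens, mul_pow, ← Real.exp_nat_mul, sq]
  congr 2
  rw [Nat.cast_ofNat]
  by_cases hd : d = 0
  · simp [hd]
  · field_simp

lemma overlap_zero_le {a b : ℝ} (ha : 0 < a) (hb : 0 < b) (y : EuclideanSpace ℝ (Fin k)) :
    overlap k a b 0 (‖y‖ ^ 2) ≤ gaussDens (√(a * b)) y ^ 2 := by
  set d := √(a * b) with hd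
  have hd0 : 0 < d := Real.sqrt_pos.2 (by positivity)
  have hd2 : a * b = d ^ 2 := (Real.sq_sqrt (by positivity)).symm
  have hab : 2 * d ≤ a + b := by nlinarith [sq_nonneg (a - b)]
  have e : (2 * Real.pi) ^ 2 * (d ^ 2 - 0 ^ 2) = 2 * Real.pi * d * (2 * Real.pi * d) := by ring
  have hz : d ^ 2 - (0 : ℝ) ^ 2 = d ^ 2 := by ring
  rw [gaussDens_sq, overlap, hd2, sqrt_mul_gaussDens_aux (by positivity), e, hz]
  refine mul_le_mul_of_nonneg_left (Real.exp_le_exp.2 (neg_le_neg ?_)) (by positivity)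
  rw [div_le_div_iff₀ hd0 (by positivity)]
  have : 0 ≤ ‖y‖ ^ 2 * d := by positivity
  nlinarith

/-- At the extreme correlation, Mehler's factor times a squared Gaussian density is again a squared
Gaussian density up to a constant. The quadratic remainder therefore keeps the form that
`lintegral_sqrt_mixture_le` can integrate. -/
lemma gaussDens_sq_mul_mehler {d ω : ℝ} (hω : 0 ≤ ω) (hωd : ω < d)
    (y : EuclideanSpace ℝ (Fin k)) :
    gaussDens d y ^ 2 * ((√(1 - (ω / d) ^ 2))⁻¹ ^ k *
        Real.exp (‖y‖ ^ 2 / d * ((ω / d) / (1 + ω / d))))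
      = √((d + ω) / (d - ω)) ^ k * gaussDens (d + ω) y ^ 2 := by
  have hd : 0 < d := hω.trans_lt hωd
  have hsub : 0 < d - ω := by linarith
  have hq : 0 < 1 - (ω / d) ^ 2 := by
    have : (ω / d) < 1 := (div_lt_one hd).2 hωd
    have h0 : 0 ≤ ω / d := by positivity
    nlinarith
  rw [gaussDens_sq, gaussDens_sq, mul_mul_mul_comm, ← Real.exp_add,
    sqrt_mul_gaussDens_aux (by positivity), sqrt_mul_gaussDens_aux (by positivity),
    sqrt_mul_gaussDens_aux (by positivity)]
  have e0 : √((d + ω) / (d - ω)) ^ k = (√((d - ω) / (d + ω)))⁻¹ ^ k := by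
    rw [← Real.sqrt_inv, inv_div]
  rw [e0, ← mul_assoc ((√((d - ω) / (d + ω)))⁻¹ ^ k), sqrt_mul_gaussDens_aux (by positivity)]
  congr 3
  · congr 1
    field_simp
    ring
  · field_simp
    ring

/-- The quadratic factor is absorbed by widening the variance by 1 + 1/k. The maximum of r
exp(-r/(k+1)) is (k+1)/e, and the normalisation loses (1 + 1/k)^k ≤ e; the two factors e cancel, and
k + 1 ≤ 2k. -/
lemma norm_sq_mul_gaussDens_sq_le (hk : 0 < k) {d : ℝ} (hd : 0 < d)
    (y : EuclideanSpace ℝ (Fin k)) :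
    gaussDens d y ^ 2 * (‖y‖ ^ 2 / d) ≤ 2 * k * gaussDens (d * (1 + 1 / k)) y ^ 2 := by
  have hk0 : (0 : ℝ) < k := by exact_mod_cast hk
  have hk1 : (1 : ℝ) ≤ k := by exact_mod_cast hk
  rw [gaussDens_sq, gaussDens_sq]
  set r := ‖y‖ ^ 2 / d with hr
  set c := (√(2 * Real.pi * d))⁻¹ with hc
  have e1 : (√(2 * Real.pi * (d * (1 + 1 / (k : ℝ)))))⁻¹ ^ k
      * (√(2 * Real.pi * (d * (1 + 1 / (k : ℝ)))))⁻¹ ^ k = c ^ k * c ^ k * ((1 + 1 / (k : ℝ)) ^ k)⁻¹ := by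
    rw [hc, ← mul_pow, ← mul_pow, ← mul_inv, ← mul_inv, Real.mul_self_sqrt (by positivity),
      Real.mul_self_sqrt (by positivity), ← inv_pow, ← mul_pow, ← mul_inv]
    congr 2
    ring
  rw [e1]
  have hb : (1 + 1 / (k : ℝ)) ^ k ≤ Real.exp 1 := by
    calc (1 + 1 / (k : ℝ)) ^ k ≤ Real.exp (1 / k) ^ k := by
          refine pow_le_pow_left₀ (by positivity) ?_ k
          linarith [Real.add_one_le_exp (1 / (k : ℝ))]
      _ = Real.exp 1 := by
          rw [← Real.exp_nat_mul]
          congr 1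
          field_simp
  have hx : r / (k + 1) ≤ Real.exp (r / (k + 1) - 1) := by
    linarith [Real.add_one_le_exp (r / ((k : ℝ) + 1) - 1)]
  have e2 : ‖y‖ ^ 2 / (d * (1 + 1 / (k : ℝ))) = r - r / (k + 1) := by
    rw [hr]; field_simp; ring
  rw [e2]
  have h1 : Real.exp (-r) * r ≤ 2 * k * (((1 + 1 / (k : ℝ)) ^ k)⁻¹ * Real.exp (-(r - r / (k + 1)))) := by
    have h2 : r ≤ (k + 1) * Real.exp (r / (k + 1) - 1) := by
      rw [div_le_iff₀ (by positivity)] at hx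
      linarith
    have h3 : Real.exp (-(r - r / (k + 1))) = Real.exp (-r) * Real.exp (r / (k + 1) - 1) * Real.exp 1 := by
      rw [← Real.exp_add, ← Real.exp_add]; congr 1; ring
    have h4 : 1 ≤ ((1 + 1 / (k : ℝ)) ^ k)⁻¹ * Real.exp 1 := by
      rw [inv_mul_eq_div, one_le_div (by positivity)]
      exact hb
    calc Real.exp (-r) * r ≤ Real.exp (-r) * ((k + 1) * Real.exp (r / (k + 1) - 1)) := by gcongr
      _ ≤ Real.exp (-r) * ((2 * k) * Real.exp (r / (k + 1) - 1)) := by gcongr; linarith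
      _ = (2 * k * (Real.exp (-r) * Real.exp (r / (k + 1) - 1))) * 1 := by ring
      _ ≤ (2 * k * (Real.exp (-r) * Real.exp (r / (k + 1) - 1))) *
          (((1 + 1 / (k : ℝ)) ^ k)⁻¹ * Real.exp 1) := by gcongr
      _ = _ := by rw [h3]; ring
  calc c ^ k * c ^ k * Real.exp (-r) * r = c ^ k * c ^ k * (Real.exp (-r) * r) := by ring
    _ ≤ c ^ k * c ^ k * (2 * k * (((1 + 1 / (k : ℝ)) ^ k)⁻¹ * Real.exp (-(r - r / (k + 1))))) := by
        gcongr
    _ = _ := by ring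

/-- The covariance of the conditional densities at a point is controlled by the correlation. -/
lemma overlap_sub_le (hk : 0 < k) {a b s ω : ℝ} (ha : 0 < a) (hb : 0 < b) (hs : |s| ≤ ω)
    (hω : 0 < ω) (hωd : ω < √(a * b)) (y : EuclideanSpace ℝ (Fin k)) :
    overlap k a b s (‖y‖ ^ 2) - overlap k a b 0 (‖y‖ ^ 2)
      ≤ 2 * k * (|s| / √(a * b)) * gaussDens (√(a * b) * (1 + 1 / k)) y ^ 2
        + 4 * (s / ω) ^ 2 * (√((√(a * b) + ω) / (√(a * b) - ω)) ^ k
          * gaussDens (√(a * b) + ω) y ^ 2) := by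
  have h0 := overlap_zero_le (k := k) ha hb y
  have h1 := overlap_le (k := k) ha hb (sq_nonneg ‖y‖) (hs.trans_lt hωd)
  set d := √(a * b) with hd
  have hd0 : 0 < d := hω.trans hωd
  have hm := mehler_sub_one_le k (r := ‖y‖ ^ 2 / d) (u := |s| / d) (ρ := ω / d)
    (by positivity) (by positivity) (by gcongr) (by positivity) ((div_lt_one hd0).2 hωd)
  have hs2 : (|s| / d / (ω / d)) ^ 2 = (s / ω) ^ 2 := by
    rw [div_div_div_cancel_right₀ hd0.ne', div_pow, div_pow, sq_abs]
  rw [hs2] at hm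
  rw [← gaussDens_sq_mul_mehler hω.le hωd]
  have hlin := norm_sq_mul_gaussDens_sq_le hk hd0 y
  have hov0 : 0 ≤ overlap k a b 0 (‖y‖ ^ 2) := by unfold overlap; positivity
  set M := (√(1 - (ω / d) ^ 2))⁻¹ ^ k * Real.exp (‖y‖ ^ 2 / d * (ω / d / (1 + ω / d))) with hM
  have hM0 : 0 ≤ M := by positivity
  calc overlap k a b s (‖y‖ ^ 2) - overlap k a b 0 (‖y‖ ^ 2)
      ≤ overlap k a b 0 (‖y‖ ^ 2) * (‖y‖ ^ 2 / d * (|s| / d) + 4 * (s / ω) ^ 2 * M) := by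
        have := mul_le_mul_of_nonneg_left hm hov0
        linarith
    _ ≤ gaussDens d y ^ 2 * (‖y‖ ^ 2 / d * (|s| / d) + 4 * (s / ω) ^ 2 * M) := by gcongr
    _ = (gaussDens d y ^ 2 * (‖y‖ ^ 2 / d)) * (|s| / d)
        + 4 * (s / ω) ^ 2 * (gaussDens d y ^ 2 * M) := by ring
    _ ≤ (2 * k * gaussDens (d * (1 + 1 / k)) y ^ 2) * (|s| / d)
        + 4 * (s / ω) ^ 2 * (gaussDens d y ^ 2 * M) := by gcongr
    _ = _ := by ring

end OverlapBounds

/-! ### A weight dominating Gaussians of comparable variance -/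

section GaussMixtureWeight

variable {k : ℕ}

lemma gaussDens_sq_div {D D' : ℝ} (hD : 0 < D) (hD' : 0 < D') (y : EuclideanSpace ℝ (Fin k)) :
    gaussDens D y ^ 2 / gaussDens D' y
      = ((√(2 * Real.pi * D))⁻¹ ^ k * (√(2 * Real.pi * D))⁻¹ ^ k * √(2 * Real.pi * D') ^ k) *
        Real.exp (-((1 / D - 1 / (2 * D')) * ‖y‖ ^ 2)) := by
  have h : Real.exp (-(‖y‖ ^ 2 / D)) = Real.exp (-((1 / D - 1 / (2 * D')) * ‖y‖ ^ 2)) *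
      Real.exp (-(‖y‖ ^ 2 / (2 * D'))) := by
    rw [← Real.exp_add]
    congr 1
    field_simp
    ring
  rw [gaussDens_sq, gaussDens, h, div_eq_iff (by positivity), inv_pow (√(2 * Real.pi * D'))]
  field_simp

/-- This is one plus the χ² divergence of two centred Gaussians; D < 2D' is exactly what makes it
finite when k > 0. -/
lemma lintegral_gaussDens_sq_div {D D' : ℝ} (hD : 0 < D) (hD' : 0 < D') (h : D < 2 * D') :
    ∫⁻ y : EuclideanSpace ℝ (Fin k), ENNReal.ofReal (gaussDens D y ^ 2 / gaussDens D' y)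
      = ENNReal.ofReal ((√(1 - (D / D' - 1) ^ 2))⁻¹ ^ k) := by
  have hb : 0 < 1 / D - 1 / (2 * D') := by
    rw [sub_pos]
    exact one_div_lt_one_div_of_lt hD h
  have h2 : 0 < 2 * D' - D := by linarith
  simp_rw [gaussDens_sq_div hD hD']
  rw [← ofReal_integral_eq_lintegral_ofReal ((integrable_exp_neg_mul_norm_sq hb).const_mul _)
    (ae_of_all _ fun y ↦ by positivity), integral_const_mul, integral_exp_neg_mul_norm_sq hb]
  congr 1
  rw [← mul_pow, ← mul_pow, ← mul_pow]
  congr 1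
  rw [mul_assoc, ← Real.sqrt_mul (by positivity), ← mul_inv, Real.mul_self_sqrt (by positivity),
    ← Real.sqrt_inv]
  rw [eq_comm, Real.sqrt_eq_iff_mul_self_eq_of_pos]
  · rw [mul_mul_mul_comm, Real.mul_self_sqrt (by positivity)]
    have e1 : 1 / D - 1 / (2 * D') = (2 * D' - D) / (2 * D * D') := by
      field_simp
    have e2 : 1 - (D / D' - 1) ^ 2 = D * (2 * D' - D) / D' ^ 2 := by
      field_simp
      ring
    rw [e1, e2]
    field_simp
  · positivity

lemma exists_grid_point {J : ℕ} (hJ : 0 < J) {v : ℝ} (hv0 : 0 ≤ v) (hvJ : v ≤ J) :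
    ∃ j ∈ Finset.range J, |v - (j + 1 / 2)| ≤ 1 / 2 := by
  by_cases h : v < J
  · refine ⟨⌊v⌋₊, Finset.mem_range.2 ((Nat.floor_lt hv0).2 h), ?_⟩
    have h1 := Nat.floor_le hv0
    have h2 := Nat.lt_floor_add_one v
    rw [abs_le]
    constructor <;> linarith
  -- The right endpoint v = J is assigned to the last cell.
  · refine ⟨J - 1, Finset.mem_range.2 (by omega), ?_⟩
    have : v = J := le_antisymm hvJ (not_lt.1 h)
    rw [this, Nat.cast_sub hJ, abs_le]
    push_cast
    constructor <;> linarith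

/-- A probability density that dominates, up to a factor of order `√k`, every isotropic Gaussian
density with variance in `[D₀, 3 D₀ / 2]`, in the `χ²` sense. -/
lemma exists_weight (hk : 0 < k) {D₀ : ℝ} (hD₀ : 0 < D₀) :
    ∃ h : EuclideanSpace ℝ (Fin k) → ℝ, Continuous h ∧ (∀ y, 0 < h y) ∧
      ∫⁻ y, ENNReal.ofReal (h y) = 1 ∧
      ∀ D, D₀ ≤ D → D ≤ 3 / 2 * D₀ →
        ∫⁻ y, ENNReal.ofReal (gaussDens D y ^ 2 / h y) ≤ ENNReal.ofReal (6 / 5 * √k) := by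
  -- J = ⌊√k⌋ cells balance two costs. The relative error 1/(4J) in the variance is of order
  -- k^(-1/2), at which the χ² divergence in dimension k stays bounded, while the mixture weight 1/J
  -- loses only J ≤ √k.
  set J := Nat.sqrt k with hJdef
  have hJ : 0 < J := Nat.sqrt_pos.2 hk
  have hJ0 : (0 : ℝ) < J := by exact_mod_cast hJ
  have hk0 : (0 : ℝ) < k := by exact_mod_cast hk
  set c : ℕ → ℝ := fun j ↦ D₀ * (1 + (j + 1 / 2) / (2 * J)) with hc
  have hcD : ∀ j, D₀ ≤ c j := fun j ↦ le_mul_of_one_le_right hD₀.le (by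
    have : (0 : ℝ) ≤ (j + 1 / 2) / (2 * J) := by positivity
    linarith)
  have hc0 : ∀ j, 0 < c j := fun j ↦ hD₀.trans_le (hcD j)
  have hpos : ∀ y : EuclideanSpace ℝ (Fin k), 0 < (1 / (J : ℝ)) * ∑ j ∈ Finset.range J,
      gaussDens (c j) y := fun y ↦ mul_pos (by positivity)
    (Finset.sum_pos (fun j _ ↦ gaussDens_pos (hc0 j) y) (Finset.nonempty_range_iff.2 hJ.ne'))
  refine ⟨fun y ↦ (1 / (J : ℝ)) * ∑ j ∈ Finset.range J, gaussDens (c j) y, by fun_prop, hpos,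
    ?_, ?_⟩
  · rw [← ofReal_integral_eq_lintegral_ofReal
      ((integrable_finsetSum _ fun j _ ↦ integrable_gaussDens (hc0 j)).const_mul _)
      (ae_of_all _ fun y ↦ (hpos y).le), integral_const_mul,
      integral_finsetSum _ fun j _ ↦ integrable_gaussDens (hc0 j)]
    simp_rw [integral_gaussDens (hc0 _)]
    simp [hJ0.ne']
  · intro D hD hD'
    have hD0 : 0 < D := hD₀.trans_le hD
    obtain ⟨j, hj, hjv⟩ := exists_grid_point hJ (v := (D / D₀ - 1) * (2 * J))
      (mul_nonneg (by rw [sub_nonneg, one_le_div hD₀]; exact hD) (by positivity))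
      (by
        have : D / D₀ ≤ 3 / 2 := by rwa [div_le_iff₀ hD₀]
        nlinarith)
    have hdev : |D / c j - 1| ≤ 1 / (4 * J) := by
      have e : D / c j - 1 = (((D / D₀ - 1) * (2 * J) - (j + 1 / 2)) / (2 * J)) * (D₀ / c j) := by
        have := (hc0 j).ne'
        have h2 : c j = D₀ + D₀ * (j + 1 / 2) / (2 * J) := by rw [hc]; ring
        field_simp
        rw [h2]
        field_simp
        ring
      rw [e, abs_mul, abs_div, abs_of_pos (show (0 : ℝ) < 2 * J by positivity),
        abs_of_pos (div_pos hD₀ (hc0 j))]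
      calc _ ≤ (1 / 2) / (2 * (J : ℝ)) * 1 := by
            gcongr
            exact (div_le_one (hc0 j)).2 (hcD j)
        _ = 1 / (4 * J) := by field_simp; norm_num
    have hJk : (k : ℝ) ≤ 4 * J ^ 2 := by
      have h1 : k < (J + 1) * (J + 1) := Nat.lt_succ_sqrt k
      have : k ≤ 4 * J ^ 2 := by nlinarith
      exact_mod_cast this
    have hJk' : (J : ℝ) ≤ √k := by
      refine Real.le_sqrt_of_sq_le ?_
      have : J ^ 2 ≤ k := by rw [sq]; exact Nat.sqrt_le k
      exact_mod_cast this
    have hdev2 : (D / c j - 1) ^ 2 ≤ 1 / (4 * k) := by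
      calc (D / c j - 1) ^ 2 = |D / c j - 1| ^ 2 := (sq_abs _).symm
        _ ≤ (1 / (4 * (J : ℝ))) ^ 2 := pow_le_pow_left₀ (abs_nonneg _) hdev 2
        _ ≤ 1 / (4 * k) := by
          rw [div_pow, one_pow]
          refine one_div_le_one_div_of_le (by positivity) ?_
          nlinarith
    have hk1 : (1 : ℝ) ≤ k := by exact_mod_cast hk
    have hsmall : (1 : ℝ) / (4 * k) ≤ 1 / 4 := one_div_le_one_div_of_le (by norm_num) (by linarith)
    have hlt : D < 2 * c j := by
      have h1 : D / c j - 1 < 1 := by nlinarith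
      have h2 : D / c j < 2 := by linarith
      rwa [div_lt_iff₀ (hc0 j)] at h2
    have hpw : ∀ y : EuclideanSpace ℝ (Fin k),
        ENNReal.ofReal (gaussDens D y ^ 2 / ((1 / (J : ℝ)) * ∑ i ∈ Finset.range J,
          gaussDens (c i) y)) ≤ ENNReal.ofReal J * ENNReal.ofReal (gaussDens D y ^ 2 / gaussDens (c j) y) := by
      intro y
      rw [← ENNReal.ofReal_mul hJ0.le]
      refine ENNReal.ofReal_le_ofReal ?_
      have h1 : gaussDens (c j) y ≤ ∑ i ∈ Finset.range J, gaussDens (c i) y :=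
        Finset.single_le_sum (f := fun i ↦ gaussDens (c i) y) (fun i _ ↦ gaussDens_nonneg _ y) hj
      have h0 := gaussDens_pos (hc0 j) y
      calc _ ≤ gaussDens D y ^ 2 / ((1 / (J : ℝ)) * gaussDens (c j) y) := by gcongr
        _ = _ := by field_simp
    refine (lintegral_mono hpw).trans ?_
    rw [lintegral_const_mul' _ _ ENNReal.ofReal_ne_top, lintegral_gaussDens_sq_div hD0 (hc0 j) hlt,
      ← ENNReal.ofReal_mul hJ0.le]
    refine ENNReal.ofReal_le_ofReal ?_
    -- Bernoulli: (1 - 1/(4k))^k ≥ 3/4, and (3/4)^(-1/2) ≤ 6/5.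
    have hbern : (3 / 4 : ℝ) ≤ (1 - (D / c j - 1) ^ 2) ^ k := by
      calc (3 / 4 : ℝ) = 1 + (k : ℝ) * (-(1 / (4 * k))) := by field_simp; norm_num
        _ ≤ (1 + -(1 / (4 * (k : ℝ)))) ^ k := one_add_mul_le_pow (by linarith) k
        _ ≤ (1 - (D / c j - 1) ^ 2) ^ k := pow_le_pow_left₀ (by linarith) (by linarith) k
    have hfac : (√(1 - (D / c j - 1) ^ 2))⁻¹ ^ k ≤ 6 / 5 := by
      rw [inv_pow]
      refine inv_le_of_inv_le₀ (by norm_num) ?_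
      refine abs_le_of_sq_le_sq' ?_ (by positivity) |>.2
      rw [← pow_mul, mul_comm k 2, pow_mul, Real.sq_sqrt (by linarith)]
      refine le_trans (by norm_num) hbern
    calc (J : ℝ) * (√(1 - (D / c j - 1) ^ 2))⁻¹ ^ k ≤ √k * (6 / 5) := by gcongr
      _ = _ := mul_comm _ _

/-- Cauchy-Schwarz with respect to a positive probability density. -/
lemma lintegral_sqrt_le_sqrt_lintegral_div {α : Type*} [MeasurableSpace α] {μ : Measure α}
    {V H : α → ℝ≥0∞} (hV : Measurable V) (hH : Measurable H) (hH0 : ∀ y, H y ≠ 0)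
    (hHt : ∀ y, H y ≠ ∞) (hint : ∫⁻ y, H y ∂μ = 1) :
    ∫⁻ y, V y ^ (1 / 2 : ℝ) ∂μ ≤ (∫⁻ y, V y / H y ∂μ) ^ (1 / 2 : ℝ) := by
  have hsplit : ∀ y, V y ^ (1 / 2 : ℝ)
      = ((fun y ↦ (V y / H y) ^ (1 / 2 : ℝ)) * fun y ↦ H y ^ (1 / 2 : ℝ)) y := by
    intro y
    rw [Pi.mul_apply, ← ENNReal.mul_rpow_of_nonneg _ _ (by norm_num),
      ENNReal.div_mul_cancel (hH0 y) (hHt y)]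
  rw [lintegral_congr hsplit]
  have hr : ∀ z : ℝ≥0∞, (z ^ (1 / 2 : ℝ)) ^ (2 : ℝ) = z := fun z ↦ by
    rw [← ENNReal.rpow_mul]; norm_num
  have := ENNReal.lintegral_mul_le_Lp_mul_Lq μ Real.HolderConjugate.two_two
    (f := fun y ↦ (V y / H y) ^ (1 / 2 : ℝ)) (g := fun y ↦ H y ^ (1 / 2 : ℝ))
    ((hV.div hH).pow_const _).aemeasurable (hH.pow_const _).aemeasurable
  simp only [hr, hint, ENNReal.one_rpow, mul_one] at this
  exact this

/-- Integral of the square root of a mixture of squared Gaussian densities with comparable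
variances. -/
lemma lintegral_sqrt_mixture_le {Λ : Type*} [MeasurableSpace Λ] (μ : Measure Λ) [SFinite μ]
    (hk : 0 < k) {D₀ : ℝ} (hD₀ : 0 < D₀) {w : Λ → ℝ≥0∞} (hw : Measurable w) {D : Λ → ℝ}
    (hD : Measurable D) (hDw : ∀ l, w l ≠ 0 → D₀ ≤ D l ∧ D l ≤ 3 / 2 * D₀) :
    ∫⁻ y : EuclideanSpace ℝ (Fin k),
        (∫⁻ l, w l * ENNReal.ofReal (gaussDens (D l) y ^ 2) ∂μ) ^ (1 / 2 : ℝ)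
      ≤ (ENNReal.ofReal (6 / 5 * √k) * ∫⁻ l, w l ∂μ) ^ (1 / 2 : ℝ) := by
  obtain ⟨h, hcont, hpos, hint, hbd⟩ := exists_weight hk hD₀
  have hmG : Measurable fun p : EuclideanSpace ℝ (Fin k) × Λ ↦ gaussDens (D p.2) p.1 := by
    unfold gaussDens
    fun_prop
  have hmF : Measurable fun p : EuclideanSpace ℝ (Fin k) × Λ ↦
      w p.2 * ENNReal.ofReal (gaussDens (D p.2) p.1 ^ 2) := by fun_prop
  set V : EuclideanSpace ℝ (Fin k) → ℝ≥0∞ := fun y ↦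
    ∫⁻ l, w l * ENNReal.ofReal (gaussDens (D l) y ^ 2) ∂μ with hV
  have hVm : Measurable V := hmF.lintegral_prod_right'
  have hH0 : ∀ y, ENNReal.ofReal (h y) ≠ 0 := fun y ↦ by simpa using hpos y
  have hhm : Measurable h := hcont.measurable
  refine (lintegral_sqrt_le_sqrt_lintegral_div hVm hhm.ennreal_ofReal hH0
    (fun _ ↦ ENNReal.ofReal_ne_top) hint).trans ?_
  refine ENNReal.rpow_le_rpow ?_ (by norm_num)
  have e1 : ∀ y, V y / ENNReal.ofReal (h y)
      = ∫⁻ l, w l * ENNReal.ofReal (gaussDens (D l) y ^ 2 / h y) ∂μ := by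
    intro y
    rw [hV, div_eq_mul_inv, ← lintegral_mul_const' _ _ (ENNReal.inv_ne_top.2 (hH0 y))]
    refine lintegral_congr fun l ↦ ?_
    rw [mul_assoc, ← div_eq_mul_inv, ← ENNReal.ofReal_div_of_pos (hpos y)]
  -- The weight h does not depend on l, so after Tonelli a single bound serves every component.
  rw [lintegral_congr e1, lintegral_lintegral_swap (Measurable.aemeasurable (by
    change Measurable fun p : EuclideanSpace ℝ (Fin k) × Λ ↦
      w p.2 * ENNReal.ofReal (gaussDens (D p.2) p.1 ^ 2 / h p.1)
    fun_prop)), mul_comm, ← lintegral_mul_const' _ _ ENNReal.ofReal_ne_top]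
  refine lintegral_mono fun l ↦ ?_
  by_cases hwl : w l = 0
  · simp [hwl]
  rw [lintegral_const_mul _ (by fun_prop)]
  gcongr
  exact hbd _ (hDw l hwl).1 (hDw l hwl).2

end GaussMixtureWeight

/-! ### Entropy splitting, and divergences between Gaussians -/

section EntropyBounds

/-- With x = √z, exp x ≥ 1 + x + x²/2 + x³/6 ≥ 1 + x². -/
lemma log_one_add_le_sqrt {z : ℝ} (hz : 0 ≤ z) : Real.log (1 + z) ≤ √z := by
  rw [Real.log_le_iff_le_exp (by linarith)]
  have h := Real.sum_le_exp_of_nonneg (Real.sqrt_nonneg z) 4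
  simp only [Finset.sum_range_succ, Finset.sum_range_zero, Nat.factorial] at h
  have h2 : √z ^ 2 = z := Real.sq_sqrt hz
  have h0 := Real.sqrt_nonneg z
  push_cast at h
  nlinarith [sq_nonneg (√z - 3 / 2), mul_nonneg h0 (sq_nonneg (√z - 3 / 2))]

lemma mul_klFun_div {a g : ℝ} (hg : 0 < g) : g * klFun (a / g) = a * Real.log (a / g) + g - a := by
  rw [klFun_apply]
  field_simp

lemma exists_klFun_bound (M : ℝ) : ∃ C, ∀ x, 0 ≤ x → x ≤ M → ‖klFun x‖ ≤ C := by
  obtain ⟨C, hC⟩ := (isCompact_Icc (a := (0 : ℝ)) (b := M)).exists_bound_of_continuousOn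
    continuous_klFun.continuousOn
  exact ⟨C, fun x h0 hM ↦ hC x ⟨h0, hM⟩⟩

lemma integrable_klFun_of_bounded {Ω : Type*} [MeasurableSpace Ω] {P : Measure Ω}
    [IsFiniteMeasure P] {f : Ω → ℝ} (hf : Measurable f) (hf0 : ∀ ω, 0 ≤ f ω) {M : ℝ}
    (hfM : ∀ ω, f ω ≤ M) : Integrable (fun ω ↦ klFun (f ω)) P := by
  obtain ⟨C, hC⟩ := exists_klFun_bound M
  exact Integrable.of_bound (measurable_klFun.comp hf).aestronglyMeasurable C
    (ae_of_all _ fun ω ↦ hC _ (hf0 ω) (hfM ω))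

/-- The relative entropy of a random density value splits into the relative entropy of its mean and
a fluctuation term bounded by the standard deviation. -/
lemma integral_mul_klFun_div_le {Ω : Type*} [MeasurableSpace Ω] {P : Measure Ω}
    [IsProbabilityMeasure P] {f : Ω → ℝ} (hf : Measurable f) (hf0 : ∀ ω, 0 ≤ f ω) {M : ℝ}
    (hfM : ∀ ω, f ω ≤ M) {g : ℝ} (hg : 0 < g) (hq : 0 < ∫ ω, f ω ∂P) :
    ∫ ω, g * klFun (f ω / g) ∂P
      ≤ g * klFun ((∫ ω, f ω ∂P) / g) + √(∫ ω, f ω ^ 2 ∂P - (∫ ω, f ω ∂P) ^ 2) := by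
  have hfi : Integrable f P := Integrable.of_bound hf.aestronglyMeasurable M
    (ae_of_all _ fun ω ↦ by rw [Real.norm_of_nonneg (hf0 ω)]; exact hfM ω)
  have hf2i : Integrable (fun ω ↦ f ω ^ 2) P := Integrable.of_bound (by fun_prop) (M ^ 2)
    (ae_of_all _ fun ω ↦ by
      rw [Real.norm_of_nonneg (sq_nonneg _)]
      exact pow_le_pow_left₀ (hf0 ω) (hfM ω) 2)
  have hvar : (∫ ω, f ω ∂P) ^ 2 ≤ ∫ ω, f ω ^ 2 ∂P := by
    have := (convexOn_pow (𝕜 := ℝ) 2).map_integral_le (continuous_pow 2).continuousOn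
      isClosed_Ici (ae_of_all P fun ω ↦ Set.mem_Ici.2 (hf0 ω)) hfi hf2i
    exact this
  set q := ∫ ω, f ω ∂P with hqdef
  set s := ∫ ω, f ω ^ 2 ∂P with hs
  have hs0 : 0 < s := lt_of_lt_of_le (by positivity) hvar
  -- The tangent of log is taken at l = E f²/E f, for which E[f log(f/l)] ≤ E f²/l - E f = 0. Only q
  -- log(l/g) survives, and l/q = 1 + Var/q².
  set l := s / q with hl
  have hl0 : 0 < l := by positivity
  have hpt : ∀ ω, g * klFun (f ω / g) ≤ f ω * Real.log (l / g) + f ω ^ 2 / l - f ω + g - f ω := by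
    intro ω
    rw [mul_klFun_div hg]
    rcases (hf0 ω).eq_or_lt with h | h
    · simp [← h]
    · have h1 := Real.log_le_sub_one_of_pos (div_pos h hl0)
      have h2 : Real.log (f ω / g) = Real.log (f ω / l) + Real.log (l / g) := by
        rw [← Real.log_mul (by positivity) (by positivity)]
        congr 1
        field_simp
      have h3 : f ω * Real.log (f ω / l) ≤ f ω * (f ω / l - 1) :=
        mul_le_mul_of_nonneg_left h1 h.le
      have h4 : f ω * (f ω / l - 1) = f ω ^ 2 / l - f ω := by ring
      rw [h2]
      linarith
  have hint : Integrable (fun ω ↦ f ω * Real.log (l / g) + f ω ^ 2 / l - f ω + g - f ω) P :=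
    (((((hfi.mul_const _).add (hf2i.div_const _)).sub hfi).add (integrable_const _)).sub hfi)
  have hint0 : Integrable (fun ω ↦ g * klFun (f ω / g)) P :=
    (integrable_klFun_of_bounded (hf.div_const g) (fun ω ↦ div_nonneg (hf0 ω) hg.le)
      (fun ω ↦ div_le_div_of_nonneg_right (hfM ω) hg.le)).const_mul g
  refine (integral_mono hint0 hint hpt).trans ?_
  have e : ∫ ω, (f ω * Real.log (l / g) + f ω ^ 2 / l - f ω + g - f ω) ∂P
      = q * Real.log (l / g) + s / l - q + g - q := by
    rw [integral_sub (by fun_prop) hfi, integral_add (by fun_prop) (by fun_prop),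
      integral_sub (by fun_prop) hfi, integral_add (by fun_prop) (by fun_prop),
      integral_mul_const, integral_div]
    simp [hqdef, hs]
  rw [e, mul_klFun_div hg]
  have hsl : s / l = q := by rw [hl]; field_simp
  have h2 : Real.log (l / g) = Real.log (q / g) + Real.log (1 + (s - q ^ 2) / q ^ 2) := by
    rw [← Real.log_mul (by positivity) (by
      have : 0 ≤ (s - q ^ 2) / q ^ 2 := div_nonneg (by linarith) (by positivity)
      linarith)]
    congr 1
    rw [hl]
    field_simp
    ring
  have h3 := log_one_add_le_sqrt (div_nonneg (sub_nonneg.2 hvar) (sq_nonneg q))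
  rw [Real.sqrt_div (by linarith), Real.sqrt_sq hq.le, le_div_iff₀ hq] at h3
  rw [hsl, h2]
  linarith

/-- Splitting the mixture according to an event `A` of the mixing variable `x`. -/
lemma integral_klFun_mixture_le {Ω : Type*} [MeasurableSpace Ω] {P : Measure Ω}
    [IsProbabilityMeasure P] {F : Ω → Ω → ℝ} (hF : Measurable (Function.uncurry F))
    (hF0 : ∀ θ x, 0 < F θ x) {M : ℝ} (hFM : ∀ θ x, F θ x ≤ M) {g : ℝ} (hg : 0 < g)
    {A : Set Ω} (hA : MeasurableSet A) :
    ∫ θ, g * klFun ((∫ x, F θ x ∂P) / g) ∂P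
      ≤ (∫ x in Aᶜ, ∫ θ, g * klFun (F θ x / g) ∂P ∂P)
        + (∫ x in A, g * klFun ((∫ θ, F θ x ∂P) / g) ∂P)
        + √(∫ θ, (∫ x in A, F θ x ∂P) ^ 2 ∂P - (∫ θ, ∫ x in A, F θ x ∂P ∂P) ^ 2) := by
  have hFx : ∀ θ, Measurable (F θ) := fun θ ↦ hF.of_uncurry_left
  have hFθ : ∀ x, Measurable fun θ ↦ F θ x := fun x ↦ hF.of_uncurry_right
  have hFi : ∀ θ, Integrable (F θ) P := fun θ ↦
    Integrable.of_bound (hFx θ).aestronglyMeasurable M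
      (ae_of_all _ fun x ↦ by rw [Real.norm_of_nonneg (hF0 θ x).le]; exact hFM θ x)
  have hFi' : ∀ x, Integrable (fun θ ↦ F θ x) P := fun x ↦
    Integrable.of_bound (hFθ x).aestronglyMeasurable M
      (ae_of_all _ fun θ ↦ by rw [Real.norm_of_nonneg (hF0 θ x).le]; exact hFM θ x)
  have hM0 : 0 ≤ M := by
    obtain ⟨x⟩ := nonempty_of_isProbabilityMeasure P
    exact (hF0 x x).le.trans (hFM x x)
  set m := P.real A with hm
  set pt : Ω → ℝ := fun θ ↦ ∫ x in A, F θ x ∂P with hpt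
  have hptm : Measurable pt :=
    (hF.stronglyMeasurable.integral_prod_right (ν := P.restrict A)).measurable
  have hpm : Measurable fun θ ↦ ∫ x, F θ x ∂P :=
    (hF.stronglyMeasurable.integral_prod_right (ν := P)).measurable
  have hpt0 : ∀ θ, 0 ≤ pt θ := fun θ ↦ integral_nonneg fun x ↦ (hF0 θ x).le
  have hptM : ∀ θ, pt θ ≤ M * m := by
    intro θ
    calc pt θ ≤ ∫ _ in A, M ∂P := integral_mono (hFi θ).integrableOn (integrable_const _) (hFM θ)
      _ = M * m := by simp [hm, mul_comm]
  have hp0 : ∀ θ, 0 ≤ ∫ x, F θ x ∂P := fun θ ↦ integral_nonneg fun x ↦ (hF0 θ x).le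
  have hpM : ∀ θ, ∫ x, F θ x ∂P ≤ M := by
    intro θ
    calc ∫ x, F θ x ∂P ≤ ∫ _, M ∂P := integral_mono (hFi θ) (integrable_const _) (hFM θ)
      _ = M := by simp
  -- The cancellation holds even when A is null, since the integral over A then vanishes as well.
  have hptm0 : ∀ θ, m * (pt θ / (m * g)) = pt θ / g := by
    intro θ
    rcases eq_or_ne m 0 with h | h
    · have : pt θ = 0 := le_antisymm (by simpa [h] using hptM θ) (hpt0 θ)
      simp [this]
    · field_simp
  have hstep : ∀ θ, g * klFun ((∫ x, F θ x ∂P) / g)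
      ≤ g * (m * klFun (pt θ / (m * g))) + ∫ x in Aᶜ, g * klFun (F θ x / g) ∂P := by
    intro θ
    -- Z is F/g with its values on A replaced by their average over A. Its mean is unchanged, so
    -- Jensen leaves the A-part averaged and splits only the complement.
    set Z : Ω → ℝ := fun x ↦ A.indicator (fun _ ↦ pt θ / (m * g)) x
      + Aᶜ.indicator (fun x ↦ F θ x / g) x with hZ
    have hZm : Measurable Z := ((measurable_const).indicator hA).add
      (((hFx θ).div_const g).indicator hA.compl)
    have hc0 : 0 ≤ pt θ / (m * g) := div_nonneg (hpt0 θ) (mul_nonneg measureReal_nonneg hg.le)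
    have hZ0 : ∀ x, 0 ≤ Z x := fun x ↦ add_nonneg (Set.indicator_nonneg (fun _ _ ↦ hc0) x)
      (Set.indicator_nonneg (fun x _ ↦ div_nonneg (hF0 θ x).le hg.le) x)
    have hZM : ∀ x, Z x ≤ pt θ / (m * g) + M / g := fun x ↦ add_le_add
      (Set.indicator_le_self' (fun _ _ ↦ hc0) x)
      (Set.indicator_le' (fun x _ ↦ div_le_div_of_nonneg_right (hFM θ x) hg.le)
        (fun _ _ ↦ div_nonneg hM0 hg.le) x)
    have hZi : Integrable Z P := Integrable.of_bound hZm.aestronglyMeasurable _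
      (ae_of_all _ fun x ↦ by rw [Real.norm_of_nonneg (hZ0 x)]; exact hZM x)
    have hki := integrable_klFun_of_bounded (P := P) hZm hZ0 hZM
    have hJ := convexOn_klFun.map_integral_le continuous_klFun.continuousOn isClosed_Ici
      (ae_of_all P fun x ↦ Set.mem_Ici.2 (hZ0 x)) hZi hki
    have hZint : ∫ x, Z x ∂P = (∫ x, F θ x ∂P) / g := by
      rw [hZ, integral_add ((integrable_const _).indicator hA)
        (((hFi θ).div_const g).indicator hA.compl), integral_indicator hA,
        integral_indicator hA.compl, setIntegral_const, smul_eq_mul, hptm0, integral_div,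
        ← add_div, integral_add_compl hA (hFi θ)]
    have hkZ : ∫ x, klFun (Z x) ∂P
        = m * klFun (pt θ / (m * g)) + ∫ x in Aᶜ, klFun (F θ x / g) ∂P := by
      rw [← integral_add_compl hA hki]
      congr 1
      · rw [setIntegral_congr_fun (g := fun _ ↦ klFun (pt θ / (m * g))) hA, setIntegral_const,
          smul_eq_mul]
        intro x hx
        simp [hZ, hx]
      · refine setIntegral_congr_fun hA.compl fun x hx ↦ ?_
        have hx' : x ∉ A := hx
        simp [hZ, hx']
    rw [hZint, hkZ] at hJ
    rw [integral_const_mul, ← mul_add]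
    exact mul_le_mul_of_nonneg_left hJ hg.le
  have hi0 : Integrable (fun θ ↦ g * klFun ((∫ x, F θ x ∂P) / g)) P :=
    (integrable_klFun_of_bounded (hpm.div_const g) (fun θ ↦ div_nonneg (hp0 θ) hg.le)
      (fun θ ↦ div_le_div_of_nonneg_right (hpM θ) hg.le)).const_mul g
  have hi1 : Integrable (fun θ ↦ g * (m * klFun (pt θ / (m * g)))) P :=
    ((integrable_klFun_of_bounded (hptm.div_const (m * g))
      (fun θ ↦ div_nonneg (hpt0 θ) (mul_nonneg measureReal_nonneg hg.le))
      (fun θ ↦ div_le_div_of_nonneg_right (hptM θ)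
        (mul_nonneg measureReal_nonneg hg.le))).const_mul m).const_mul g
  obtain ⟨C, hC⟩ := exists_klFun_bound (M / g)
  have hiF : Integrable (fun z : Ω × Ω ↦ g * klFun (F z.1 z.2 / g)) (P.prod (P.restrict Aᶜ)) := by
    refine (Integrable.of_bound (C := C) (measurable_klFun.comp
      (hF.div_const g)).aestronglyMeasurable (ae_of_all _ fun z ↦ ?_)).const_mul g
    exact hC _ (div_nonneg (hF0 _ _).le hg.le) (div_le_div_of_nonneg_right (hFM _ _) hg.le)
  have hi2 : Integrable (fun θ ↦ ∫ x in Aᶜ, g * klFun (F θ x / g) ∂P) P := hiF.integral_prod_left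
  have hmono := integral_mono hi0 (hi1.add hi2) hstep
  simp only [Pi.add_apply] at hmono
  rw [integral_add hi1 hi2] at hmono
  have hswap : ∫ θ, ∫ x in Aᶜ, g * klFun (F θ x / g) ∂P ∂P
      = ∫ x in Aᶜ, ∫ θ, g * klFun (F θ x / g) ∂P ∂P := integral_integral_swap hiF
  rw [hswap] at hmono
  suffices hmain : ∫ θ, g * (m * klFun (pt θ / (m * g))) ∂P
      ≤ (∫ x in A, g * klFun ((∫ θ, F θ x ∂P) / g) ∂P) + √(∫ θ, pt θ ^ 2 ∂P - (∫ θ, pt θ ∂P) ^ 2) by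
    linarith
  have hrhs0 : 0 ≤ ∫ x in A, g * klFun ((∫ θ, F θ x ∂P) / g) ∂P :=
    integral_nonneg fun x ↦ mul_nonneg hg.le
      (klFun_nonneg (div_nonneg (integral_nonneg fun θ ↦ (hF0 θ x).le) hg.le))
  rcases eq_or_ne m 0 with h | h
  · simp only [h, zero_mul, mul_zero, integral_zero]
    positivity
  have hm0 : 0 < m := lt_of_le_of_ne measureReal_nonneg (Ne.symm h)
  have hFim : Integrable (fun z : Ω × Ω ↦ F z.1 z.2) (P.prod (P.restrict A)) :=
    Integrable.of_bound hF.aestronglyMeasurable M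
      (ae_of_all _ fun z ↦ by rw [Real.norm_of_nonneg (hF0 _ _).le]; exact hFM _ _)
  have hqswap : ∫ θ, pt θ ∂P = ∫ x in A, ∫ θ, F θ x ∂P ∂P := integral_integral_swap hFim
  have hhpos : ∀ x, 0 < ∫ θ, F θ x ∂P := fun x ↦ by
    rw [integral_pos_iff_support_of_nonneg (fun θ ↦ (hF0 θ x).le) (hFi' x)]
    have : Function.support (fun θ ↦ F θ x) = Set.univ := by
      ext θ
      simp [(hF0 θ x).ne']
    simp [this]
  have hhi : Integrable (fun x ↦ ∫ θ, F θ x ∂P) (P.restrict A) := hFim.integral_prod_right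
  have hAne : P A ≠ 0 := fun h0 ↦ h (by simp [hm, measureReal_def, h0])
  have hqpos : 0 < ∫ θ, pt θ ∂P := by
    rw [hqswap, integral_pos_iff_support_of_nonneg (fun x ↦ (hhpos x).le) hhi]
    have : Function.support (fun x ↦ ∫ θ, F θ x ∂P) = Set.univ := by
      ext x
      simp [(hhpos x).ne']
    simpa [this, pos_iff_ne_zero] using hAne
  have hL := integral_mul_klFun_div_le (P := P) (f := fun θ ↦ pt θ / m) (hptm.div_const m)
    (fun θ ↦ div_nonneg (hpt0 θ) hm0.le)
    (M := M) (fun θ ↦ by rw [div_le_iff₀ hm0]; exact hptM θ) hg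
    (by rw [integral_div]; exact div_pos hqpos hm0)
  have hhm : Measurable fun x ↦ ∫ θ, F θ x ∂P :=
    (hF.stronglyMeasurable.integral_prod_left (μ := P)).measurable
  have hhM : ∀ x, ∫ θ, F θ x ∂P ≤ M := fun x ↦ by
    calc ∫ θ, F θ x ∂P ≤ ∫ _, M ∂P := integral_mono (hFi' x) (integrable_const _)
          fun θ ↦ hFM θ x
      _ = M := by simp
  -- A second Jensen, now over A and after averaging over θ, compares each Θ-averaged component with
  -- g separately.
  have hAvg := convexOn_klFun.map_set_average_le continuous_klFun.continuousOn isClosed_Ici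
    hAne (measure_ne_top P A) (f := fun x ↦ (∫ θ, F θ x ∂P) / g)
    (ae_of_all _ fun x ↦ Set.mem_Ici.2 (div_nonneg (hhpos x).le hg.le)) (hhi.div_const g)
    (integrable_klFun_of_bounded (M := M / g) (hhm.div_const g)
      (fun x ↦ div_nonneg (hhpos x).le hg.le)
      (fun x ↦ div_le_div_of_nonneg_right (hhM x) hg.le))
  rw [setAverage_eq, setAverage_eq, smul_eq_mul, smul_eq_mul, integral_div, ← hqswap, ← hm] at hAvg
  have hsq : ∫ θ, (pt θ / m) ^ 2 ∂P - (∫ θ, pt θ / m ∂P) ^ 2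
      = (∫ θ, pt θ ^ 2 ∂P - (∫ θ, pt θ ∂P) ^ 2) / m ^ 2 := by
    simp_rw [div_pow]
    rw [integral_div, integral_div]
    ring
  rw [hsq, Real.sqrt_div' _ (sq_nonneg m), Real.sqrt_sq hm0.le, integral_div] at hL
  simp_rw [div_div] at hL
  have e1 : ∫ θ, g * (m * klFun (pt θ / (m * g))) ∂P
      = m * ∫ θ, g * klFun (pt θ / (m * g)) ∂P := by
    rw [← integral_const_mul]
    exact integral_congr_ae (ae_of_all _ fun θ ↦ by ring)
  rw [e1, integral_const_mul (μ := P.restrict A) g]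
  have e2 : m⁻¹ * ((∫ θ, pt θ ∂P) / g) = (∫ θ, pt θ ∂P) / (m * g) := by field_simp
  rw [e2] at hAvg
  calc m * ∫ θ, g * klFun (pt θ / (m * g)) ∂P
      ≤ m * (g * klFun ((∫ θ, pt θ ∂P) / (m * g))
          + √(∫ θ, pt θ ^ 2 ∂P - (∫ θ, pt θ ∂P) ^ 2) / m) :=
        mul_le_mul_of_nonneg_left hL hm0.le
    _ ≤ m * (g * (m⁻¹ * ∫ x in A, klFun ((∫ θ, F θ x ∂P) / g) ∂P)
          + √(∫ θ, pt θ ^ 2 ∂P - (∫ θ, pt θ ∂P) ^ 2) / m) := by gcongr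
    _ = g * ∫ x in A, klFun ((∫ θ, F θ x ∂P) / g) ∂P
          + √(∫ θ, pt θ ^ 2 ∂P - (∫ θ, pt θ ∂P) ^ 2) := by
        rw [mul_add, mul_div_cancel₀ _ h, mul_left_comm, mul_inv_cancel_left₀ h]

variable {k : ℕ}

lemma integrable_norm_sq_stdGaussian :
    Integrable (fun z ↦ ‖z‖ ^ 2) (stdGaussian (EuclideanSpace ℝ (Fin k))) :=
  (IsGaussian.memLp_two_id (μ := stdGaussian (EuclideanSpace ℝ (Fin k)))).integrable_norm_pow
    two_ne_zero

lemma integral_norm_sq_stdGaussian :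
    ∫ z, ‖z‖ ^ 2 ∂(stdGaussian (EuclideanSpace ℝ (Fin k))) = k := by
  have hmem := IsGaussian.memLp_two_id (μ := stdGaussian (EuclideanSpace ℝ (Fin k)))
  have hi : ∀ i : Fin k, MemLp (fun z : EuclideanSpace ℝ (Fin k) ↦ z i) 2
      (stdGaussian (EuclideanSpace ℝ (Fin k))) := fun i ↦
    hmem.continuousLinearMap_comp (EuclideanSpace.proj i : EuclideanSpace ℝ (Fin k) →L[ℝ] ℝ)
  have hvar : ∀ i : Fin k, ∫ z : EuclideanSpace ℝ (Fin k), z i ^ 2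
      ∂(stdGaussian (EuclideanSpace ℝ (Fin k))) = 1 := by
    intro i
    have h := variance_eval_multivariateGaussian (μ := 0)
      (Matrix.PosSemidef.one (n := Fin k) (R := ℝ)) i
    rw [multivariateGaussian_zero_one, Matrix.one_apply_eq, variance_eq_sub (hi i)] at h
    have h0 : ∫ z : EuclideanSpace ℝ (Fin k), z i ∂(stdGaussian (EuclideanSpace ℝ (Fin k))) = 0 :=
      integral_strongDual_stdGaussian (EuclideanSpace.proj i : EuclideanSpace ℝ (Fin k) →L[ℝ] ℝ)
    rw [h0] at h
    simpa using h
  simp_rw [EuclideanSpace.real_norm_sq_eq]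
  rw [integral_finsetSum _ fun i _ ↦ (hi i).integrable_sq]
  simp [hvar]

lemma gaussDens_mul_klFun {v c : ℝ} (hv : 0 < v) (hc : 0 < c) (y μ : EuclideanSpace ℝ (Fin k)) :
    gaussDens c y * klFun (gaussDens v (y - μ) / gaussDens c y)
      = gaussDens v (y - μ) * (k / 2 * Real.log (c / v) - ‖y - μ‖ ^ 2 / (2 * v)
          + ‖y‖ ^ 2 / (2 * c)) + gaussDens c y - gaussDens v (y - μ) := by
  rw [mul_klFun_div (gaussDens_pos hc y)]
  congr 3
  rw [Real.log_div (gaussDens_pos hv _).ne' (gaussDens_pos hc y).ne']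
  simp only [gaussDens]
  rw [Real.log_mul (by positivity) (by positivity), Real.log_mul (by positivity) (by positivity),
    Real.log_exp, Real.log_exp, Real.log_pow, Real.log_pow, Real.log_inv, Real.log_inv,
    Real.log_sqrt (by positivity), Real.log_sqrt (by positivity),
    Real.log_mul (by positivity) hv.ne', Real.log_mul (by positivity) hc.ne',
    Real.log_div hc.ne' hv.ne']
  ring

/-- This is the divergence of N(μ, v I) from N(0, c I). The substitution y = √v z + μ makes the
log-ratio quadratic in a standard Gaussian z, and the two extra densities coming from `klFun` have
equal mass and cancel. -/
lemma lintegral_gaussDens_mul_klFun {v c : ℝ} (hv : 0 < v) (hc : 0 < c)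
    (μ : EuclideanSpace ℝ (Fin k)) :
    ∫⁻ y, ENNReal.ofReal (gaussDens c y * klFun (gaussDens v (y - μ) / gaussDens c y))
      = ENNReal.ofReal (k / 2 * (v / c - 1 + Real.log (c / v)) + ‖μ‖ ^ 2 / (2 * c)) := by
  set R : EuclideanSpace ℝ (Fin k) → ℝ := fun y ↦
    k / 2 * Real.log (c / v) - ‖y - μ‖ ^ 2 / (2 * v) + ‖y‖ ^ 2 / (2 * c) with hR
  have hRs : ∀ z, R (√v • z + μ) = (k / 2 * Real.log (c / v) + ‖μ‖ ^ 2 / (2 * c))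
      + (v / (2 * c) - 1 / 2) * ‖z‖ ^ 2 + √v / c * ⟪μ, z⟫ := by
    intro z
    rw [hR]
    simp only [add_sub_cancel_right]
    rw [norm_add_sq_real, norm_smul, mul_pow, Real.norm_eq_abs, sq_abs, Real.sq_sqrt hv.le,
      real_inner_smul_left, real_inner_comm]
    field_simp
    ring
  have hIi : Integrable (fun z ↦ ⟪μ, z⟫) (stdGaussian (EuclideanSpace ℝ (Fin k))) :=
    (IsGaussian.integrable_id (μ := stdGaussian (EuclideanSpace ℝ (Fin k)))).const_inner μ
  have hI0 : ∫ z, ⟪μ, z⟫ ∂(stdGaussian (EuclideanSpace ℝ (Fin k))) = 0 :=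
    integral_strongDual_stdGaussian (innerSL ℝ μ)
  have hRi : Integrable (fun z ↦ R (√v • z + μ)) (stdGaussian (EuclideanSpace ℝ (Fin k))) := by
    simp_rw [hRs]
    exact ((integrable_const _).add (integrable_norm_sq_stdGaussian.const_mul _)).add
      (hIi.const_mul _)
  have hRint : ∫ z, R (√v • z + μ) ∂(stdGaussian (EuclideanSpace ℝ (Fin k)))
      = k / 2 * (v / c - 1 + Real.log (c / v)) + ‖μ‖ ^ 2 / (2 * c) := by
    have hQ : Integrable (fun z ↦ (k / 2 * Real.log (c / v) + ‖μ‖ ^ 2 / (2 * c))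
        + (v / (2 * c) - 1 / 2) * ‖z‖ ^ 2) (stdGaussian (EuclideanSpace ℝ (Fin k))) :=
      (integrable_const _).add (integrable_norm_sq_stdGaussian.const_mul _)
    simp_rw [hRs]
    rw [integral_add hQ (hIi.const_mul _), integral_add (integrable_const _)
      (integrable_norm_sq_stdGaussian.const_mul _), integral_const_mul, integral_const_mul, hI0,
      integral_norm_sq_stdGaussian]
    simp
    ring
  have hRc : Continuous R := by rw [hR]; fun_prop
  have hstep : Integrable (fun z ↦ R (z + μ)) (gaussMeas k v) := by
    rw [← map_sqrt_smul_stdGaussian hv, integrable_map_measure (by fun_prop) (by fun_prop)]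
    exact hRi
  have hmi : Integrable (fun y ↦ gaussDens v (y - μ) * R y) := by
    rw [gaussMeas, integrable_withDensity_iff_integrable_smul' (by fun_prop)
      (ae_of_all _ fun _ ↦ ENNReal.ofReal_lt_top)] at hstep
    simp_rw [ENNReal.toReal_ofReal (gaussDens_nonneg v _), smul_eq_mul] at hstep
    simpa using hstep.comp_sub_right μ
  have hval : ∫ y, gaussDens v (y - μ) * R y
      = k / 2 * (v / c - 1 + Real.log (c / v)) + ‖μ‖ ^ 2 / (2 * c) := by
    rw [← hRint, ← integral_map (φ := fun z ↦ √v • z) (f := fun z ↦ R (z + μ)) (by fun_prop)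
      (by fun_prop), map_sqrt_smul_stdGaussian hv, integral_gaussMeas,
      ← integral_sub_right_eq_self (fun y ↦ gaussDens v y * R (y + μ)) μ]
    simp only [sub_add_cancel]
  have hvi : Integrable (fun y : EuclideanSpace ℝ (Fin k) ↦ gaussDens v (y - μ)) :=
    (integrable_gaussDens hv).comp_sub_right μ
  have hv1 : ∫ y : EuclideanSpace ℝ (Fin k), gaussDens v (y - μ) = 1 := by
    rw [integral_sub_right_eq_self (gaussDens v), integral_gaussDens hv]
  rw [← ofReal_integral_eq_lintegral_ofReal]
  · congr 1
    have hsum : Integrable fun y ↦ gaussDens v (y - μ) * R y + gaussDens c y :=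
      hmi.add (integrable_gaussDens hc)
    simp_rw [gaussDens_mul_klFun hv hc]
    rw [integral_sub hsum hvi, integral_add hmi (integrable_gaussDens hc), hval, hv1, integral_gaussDens hc]
    ring
  · simp_rw [gaussDens_mul_klFun hv hc]
    exact (hmi.add (integrable_gaussDens hc)).sub hvi
  · exact ae_of_all _ fun y ↦ mul_nonneg (gaussDens_nonneg c y)
      (klFun_nonneg (div_nonneg (gaussDens_nonneg _ _) (gaussDens_nonneg _ _)))

lemma div_add_le_log_one_add_div {γ t : ℝ} (hγ : 0 < γ) (ht : 0 < t) :
    γ / (γ + t) ≤ Real.log (1 + γ / t) := by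
  have h := Real.one_sub_inv_le_log_of_pos (show 0 < 1 + γ / t by positivity)
  have e : 1 - (1 + γ / t)⁻¹ = γ / (γ + t) := by
    field_simp
    ring
  linarith

/-- By log z ≤ z - 1 the cost is at most a multiple of (W-γ)²/((γ+t)(W+t)). Inside the window |W-γ|
≤ W + t, so one factor drops, and γ/(γ+t) ≤ log(1 + γ/t) handles the other. -/
lemma fluctuation_cost_near {K γ t ε W : ℝ} (hK : 0 ≤ K) (hγ : 0 < γ) (ht : 0 < t) (hε : 0 < ε)
    (hε1 : ε ≤ 1) (hW : |W - γ| ≤ ε * γ / 5) :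
    K / 2 * ((W + t) / (γ + t) - 1 + Real.log ((γ + t) / (W + t)))
      ≤ 3 * K * Real.log (1 + γ / t) * (|W - γ| / (ε * γ)) := by
  have hWl := abs_le.1 hW
  have hεγ : ε * γ ≤ γ := by nlinarith
  have hWt : 0 < W + t := by nlinarith
  have hlog := Real.log_le_sub_one_of_pos (show 0 < (γ + t) / (W + t) by positivity)
  have hL := div_add_le_log_one_add_div hγ ht
  set L := Real.log (1 + γ / t)
  have h1 : (W + t) / (γ + t) - 1 + ((γ + t) / (W + t) - 1)
      = (|W - γ| / (γ + t)) * (|W - γ| / (W + t)) := by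
    rw [div_mul_div_comm, ← abs_mul, abs_of_nonneg (mul_self_nonneg _)]
    field_simp
    ring
  have h2 : |W - γ| / (W + t) ≤ 1 := by
    rw [div_le_one hWt]
    nlinarith
  have h3 : |W - γ| / (γ + t) = (γ / (γ + t)) * (|W - γ| / γ) := by field_simp
  have h4 : |W - γ| / γ ≤ |W - γ| / (ε * γ) :=
    div_le_div_of_nonneg_left (abs_nonneg _) (by positivity) hεγ
  have h0 : 0 ≤ |W - γ| / (γ + t) := by positivity
  have h5 : (γ / (γ + t)) * (|W - γ| / γ) ≤ L * (|W - γ| / (ε * γ)) :=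
    mul_le_mul hL h4 (by positivity) ((by positivity : 0 ≤ γ / (γ + t)).trans hL)
  have h6 : (|W - γ| / (γ + t)) * (|W - γ| / (W + t)) ≤ |W - γ| / (γ + t) :=
    mul_le_of_le_one_right h0 h2
  have h7 : (W + t) / (γ + t) - 1 + Real.log ((γ + t) / (W + t)) ≤ L * (|W - γ| / (ε * γ)) := by
    linarith
  have h8 : 0 ≤ L * (|W - γ| / (ε * γ)) := by linarith
  nlinarith [mul_le_mul_of_nonneg_left h7 hK, mul_nonneg hK h8]

/-- Outside the window 1 ≤ 5|W-γ|/(εγ), which pays for the bare logarithm. The term linear in W - γ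
adds one more unit, and 5 + 1 = 6 times K/2 is the constant 3. -/
lemma fluctuation_cost_far {K γ t ε W : ℝ} (hK : 0 ≤ K) (hγ : 0 < γ) (ht : 0 < t) (hε : 0 < ε)
    (hε1 : ε ≤ 1) (hW : ε * γ / 5 < |W - γ|) :
    K / 2 * (t / (γ + t) - 1 + Real.log ((γ + t) / t)) + K * W / (2 * (γ + t))
      ≤ 3 * K * Real.log (1 + γ / t) * (|W - γ| / (ε * γ)) := by
  have hεγ : ε * γ ≤ γ := by nlinarith
  have hL := div_add_le_log_one_add_div hγ ht
  have e : (γ + t) / t = 1 + γ / t := by field_simp; ring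
  rw [e]
  set L := Real.log (1 + γ / t)
  have hL0 : 0 ≤ L := (by positivity : 0 ≤ γ / (γ + t)).trans hL
  have h1 : 1 ≤ 5 * (|W - γ| / (ε * γ)) := by
    rw [← mul_div_assoc, one_le_div (by positivity)]
    linarith
  have h3 : (W - γ) / (γ + t) ≤ (γ / (γ + t)) * (|W - γ| / γ) := by
    have : (γ / (γ + t)) * (|W - γ| / γ) = |W - γ| / (γ + t) := by field_simp
    rw [this]
    exact div_le_div_of_nonneg_right (le_abs_self _) (by positivity)
  have h4 : |W - γ| / γ ≤ |W - γ| / (ε * γ) :=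
    div_le_div_of_nonneg_left (abs_nonneg _) (by positivity) hεγ
  have h5 : (γ / (γ + t)) * (|W - γ| / γ) ≤ L * (|W - γ| / (ε * γ)) :=
    mul_le_mul hL h4 (by positivity) hL0
  have h6 : L ≤ L * (5 * (|W - γ| / (ε * γ))) := le_mul_of_one_le_right hL0 h1
  have e2 : K / 2 * (t / (γ + t) - 1 + L) + K * W / (2 * (γ + t))
      = K / 2 * (L + (W - γ) / (γ + t)) := by
    field_simp
    ring
  rw [e2]
  have h7 : L + (W - γ) / (γ + t) ≤ 6 * (L * (|W - γ| / (ε * γ))) := by linarith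
  nlinarith [mul_le_mul_of_nonneg_left h7 hK]

end EntropyBounds

/-! ### The mixture bound in extended form, and the variance over Θ -/

section ConditionalDensity

/-- Integrability is not needed, because a non-integrable function has Bochner integral 0. -/
lemma ofReal_integral_le_lintegral_ofReal {α : Type*} [MeasurableSpace α] {μ : Measure α}
    (f : α → ℝ) : ENNReal.ofReal (∫ a, f a ∂μ) ≤ ∫⁻ a, ENNReal.ofReal (f a) ∂μ := by
  by_cases hf : Integrable f μ
  · calc ENNReal.ofReal (∫ a, f a ∂μ) ≤ ENNReal.ofReal (∫ a, max (f a) 0 ∂μ) :=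
          ENNReal.ofReal_le_ofReal (integral_mono hf hf.pos_part fun a ↦ le_max_left _ _)
      _ = ∫⁻ a, ENNReal.ofReal (max (f a) 0) ∂μ :=
          ofReal_integral_eq_lintegral_ofReal hf.pos_part (ae_of_all _ fun a ↦ le_max_right _ _)
      _ = ∫⁻ a, ENNReal.ofReal (f a) ∂μ := by
          refine lintegral_congr fun a ↦ ?_
          rcases le_total (f a) 0 with h | h
          · rw [max_eq_right h, ENNReal.ofReal_zero, ENNReal.ofReal_of_nonpos h]
          · rw [max_eq_left h]
  · rw [integral_undef hf, ENNReal.ofReal_zero]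
    exact zero_le

lemma lintegral_klFun_mixture_le {Ω : Type*} [MeasurableSpace Ω] {P : Measure Ω}
    [IsProbabilityMeasure P] {F : Ω → Ω → ℝ} (hF : Measurable (Function.uncurry F))
    (hF0 : ∀ θ x, 0 < F θ x) {M : ℝ} (hFM : ∀ θ x, F θ x ≤ M) {g : ℝ} (hg : 0 < g)
    {A : Set Ω} (hA : MeasurableSet A) :
    ∫⁻ θ, ENNReal.ofReal (g * klFun ((∫ x, F θ x ∂P) / g)) ∂P
      ≤ (∫⁻ x in Aᶜ, ∫⁻ θ, ENNReal.ofReal (g * klFun (F θ x / g)) ∂P ∂P)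
        + (∫⁻ x in A, ENNReal.ofReal (g * klFun ((∫ θ, F θ x ∂P) / g)) ∂P)
        + ENNReal.ofReal
          (√(∫ θ, (∫ x in A, F θ x ∂P) ^ 2 ∂P - (∫ θ, ∫ x in A, F θ x ∂P ∂P) ^ 2)) := by
  have hFx : ∀ θ, Measurable (F θ) := fun θ ↦ hF.of_uncurry_left
  have hFi : ∀ θ, Integrable (F θ) P := fun θ ↦
    Integrable.of_bound (hFx θ).aestronglyMeasurable M
      (ae_of_all _ fun x ↦ by rw [Real.norm_of_nonneg (hF0 θ x).le]; exact hFM θ x)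
  have hp0 : ∀ θ, 0 ≤ (∫ x, F θ x ∂P) / g := fun θ ↦
    div_nonneg (integral_nonneg fun x ↦ (hF0 θ x).le) hg.le
  have hpM : ∀ θ, (∫ x, F θ x ∂P) / g ≤ M / g := fun θ ↦ div_le_div_of_nonneg_right (by
    calc ∫ x, F θ x ∂P ≤ ∫ _, M ∂P := integral_mono (hFi θ) (integrable_const _) (hFM θ)
      _ = M := by simp) hg.le
  have hpm : Measurable fun θ ↦ ∫ x, F θ x ∂P :=
    (hF.stronglyMeasurable.integral_prod_right (ν := P)).measurable
  rw [← ofReal_integral_eq_lintegral_ofReal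
    ((integrable_klFun_of_bounded (hpm.div_const g) hp0 hpM).const_mul g)
    (ae_of_all _ fun θ ↦ mul_nonneg hg.le (klFun_nonneg (hp0 θ)))]
  refine (ENNReal.ofReal_le_ofReal (integral_klFun_mixture_le hF hF0 hFM hg hA)).trans ?_
  refine ENNReal.ofReal_add_le.trans (add_le_add_left ?_ _)
  refine ENNReal.ofReal_add_le.trans (add_le_add ?_ ?_)
  · refine (ofReal_integral_le_lintegral_ofReal _).trans (lintegral_mono fun x ↦ ?_)
    exact ofReal_integral_le_lintegral_ofReal _
  · exact ofReal_integral_le_lintegral_ofReal _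

/-- Two replicas of the mixing variable: this is how the pair X₁, X₂ of β_r enters. -/
lemma sq_setIntegral_eq {Ω : Type*} [MeasurableSpace Ω] {P : Measure Ω} [IsProbabilityMeasure P]
    (f : Ω → ℝ) (A : Set Ω) :
    (∫ x in A, f x ∂P) ^ 2 = ∫ z in A ×ˢ A, f z.1 * f z.2 ∂(P.prod P) := by
  rw [← Measure.prod_restrict, integral_prod_mul, sq]

variable {k n : ℕ}

lemma gaussDens_mul_eq_overlap {a b : ℝ} (ha : 0 < a) (hb : 0 < b)
    (y : EuclideanSpace ℝ (Fin k)) :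
    gaussDens a y * gaussDens b y = overlap k a b 0 (‖y‖ ^ 2) := by
  rw [gaussDens, gaussDens, overlap, mul_mul_mul_comm, sqrt_mul_gaussDens_aux (by positivity),
    ← Real.exp_add]
  congr 3
  · congr 1
    ring
  · field_simp
    ring

lemma measurable_overlap {α : Type*} [MeasurableSpace α] {a b s r : α → ℝ} (ha : Measurable a)
    (hb : Measurable b) (hs : Measurable s) (hr : Measurable r) :
    Measurable fun x ↦ overlap k (a x) (b x) (s x) (r x) := by
  unfold overlap
  fun_prop

variable {Ω : Type*} [MeasurableSpace Ω] {P : Measure Ω} [IsProbabilityMeasure P]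
  {Θ : Ω → Fin k → Fin n → ℝ} {X : Ω → EuclideanSpace ℝ (Fin n)}

/-- The variance over `Θ` of the (truncated) conditional density at a point `y`. -/
lemma variance_condDens_eq (hΘm : Measurable Θ) (hXm : Measurable X)
    (hΘlaw : ∀ i j, HasLaw (fun ω => Θ ω i j) (gaussianReal 0 (1 / (n : ℝ≥0))) P)
    (hΘindep : iIndepFun (fun (ij : Fin k × Fin n) ω => Θ ω ij.1 ij.2) P) (hn : 0 < n)
    {t : ℝ} (ht : 0 < t) {A : Set Ω} (hA : MeasurableSet A) (hAX : ∀ x ∈ A, X x ≠ 0)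
    (y : EuclideanSpace ℝ (Fin k)) :
    ∫ θ, (∫ x in A, gaussDens t (y - randProj (Θ θ) (X x)) ∂P) ^ 2 ∂P
        - (∫ θ, ∫ x in A, gaussDens t (y - randProj (Θ θ) (X x)) ∂P ∂P) ^ 2
      = ∫ z in A ×ˢ A, (overlap k (‖X z.1‖ ^ 2 / n + t) (‖X z.2‖ ^ 2 / n + t)
            (⟪X z.1, X z.2⟫ / n) (‖y‖ ^ 2)
          - overlap k (‖X z.1‖ ^ 2 / n + t) (‖X z.2‖ ^ 2 / n + t) 0 (‖y‖ ^ 2)) ∂(P.prod P) := by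
  set M : ℝ := (√(2 * Real.pi * t))⁻¹ ^ k with hM
  have hF0 : ∀ θ x, 0 ≤ gaussDens t (y - randProj (Θ θ) (X x)) := fun _ _ ↦ gaussDens_nonneg _ _
  have hFM : ∀ θ x, gaussDens t (y - randProj (Θ θ) (X x)) ≤ M := fun _ _ ↦ gaussDens_le ht _
  have hi1 : Integrable (fun p : Ω × Ω ↦ gaussDens t (y - randProj (Θ p.1) (X p.2)))
      (P.prod (P.restrict A)) :=
    Integrable.of_bound (Measurable.aestronglyMeasurable (by fun_prop)) M
      (ae_of_all _ fun z ↦ by rw [Real.norm_of_nonneg (hF0 _ _)]; exact hFM _ _)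
  have hi2 : Integrable (fun p : Ω × (Ω × Ω) ↦ gaussDens t (y - randProj (Θ p.1) (X p.2.1)) *
      gaussDens t (y - randProj (Θ p.1) (X p.2.2))) (P.prod ((P.prod P).restrict (A ×ˢ A))) :=
    Integrable.of_bound (Measurable.aestronglyMeasurable (by fun_prop)) (M * M)
      (ae_of_all _ fun z ↦ by
        rw [Real.norm_of_nonneg (mul_nonneg (hF0 _ _) (hF0 _ _))]
        exact mul_le_mul (hFM _ _) (hFM _ _) (hF0 _ _) ((hF0 z.1 z.1).trans (hFM _ _)))
  have hW : ∀ x, 0 < ‖X x‖ ^ 2 / n + t := fun x ↦ by positivity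
  have e1 : ∫ θ, (∫ x in A, gaussDens t (y - randProj (Θ θ) (X x)) ∂P) ^ 2 ∂P
      = ∫ z in A ×ˢ A, overlap k (‖X z.1‖ ^ 2 / n + t) (‖X z.2‖ ^ 2 / n + t)
            (⟪X z.1, X z.2⟫ / n) (‖y‖ ^ 2) ∂(P.prod P) := by
    simp_rw [sq_setIntegral_eq]
    rw [integral_integral_swap hi2]
    refine setIntegral_congr_fun (hA.prod hA) fun z hz ↦ ?_
    exact integral_gaussDens_mul_randProj hΘm hΘlaw hΘindep hn ht (hAX _ hz.1) _ _
  have e2 : (∫ θ, ∫ x in A, gaussDens t (y - randProj (Θ θ) (X x)) ∂P ∂P) ^ 2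
      = ∫ z in A ×ˢ A, overlap k (‖X z.1‖ ^ 2 / n + t) (‖X z.2‖ ^ 2 / n + t) 0 (‖y‖ ^ 2)
          ∂(P.prod P) := by
    rw [integral_integral_swap hi1, sq_setIntegral_eq]
    refine setIntegral_congr_fun (hA.prod hA) fun z hz ↦ ?_
    rw [integral_gaussDens_randProj hΘm hΘlaw hΘindep ht,
      integral_gaussDens_randProj hΘm hΘlaw hΘindep ht, gaussDens_mul_eq_overlap (hW _) (hW _)]
  rw [e1, e2, ← integral_sub]
  · refine (hi2.integral_prod_right).congr ?_
    filter_upwards [ae_restrict_mem (hA.prod hA)] with z hz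
    exact integral_gaussDens_mul_randProj hΘm hΘlaw hΘindep hn ht (hAX _ hz.1) _ _
  · refine Integrable.of_bound (C := (√(2 * Real.pi * t))⁻¹ ^ k * (√(2 * Real.pi * t))⁻¹ ^ k)
      (measurable_overlap (by fun_prop) (by fun_prop) (by fun_prop)
        (by fun_prop)).aestronglyMeasurable (ae_of_all _ fun z ↦ ?_)
    rw [← gaussDens_mul_eq_overlap (hW _) (hW _), ← integral_gaussDens_randProj hΘm hΘlaw hΘindep ht,
      ← integral_gaussDens_randProj hΘm hΘlaw hΘindep ht]
    have hb : ∀ x, ∫ ω, gaussDens t (y - randProj (Θ ω) x) ∂P ≤ M := fun x ↦ by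
      calc ∫ ω, gaussDens t (y - randProj (Θ ω) x) ∂P ≤ ∫ _, M ∂P :=
            integral_mono (Integrable.of_bound (Measurable.aestronglyMeasurable (by fun_prop)) M
              (ae_of_all _ fun z ↦ by
                rw [Real.norm_of_nonneg (gaussDens_nonneg _ _)]; exact gaussDens_le ht _))
              (integrable_const _) fun ω ↦ gaussDens_le ht _
        _ = M := by simp
    have h0 : ∀ x, 0 ≤ ∫ ω, gaussDens t (y - randProj (Θ ω) x) ∂P := fun x ↦
      integral_nonneg fun ω ↦ gaussDens_nonneg _ _
    rw [Real.norm_of_nonneg (mul_nonneg (h0 _) (h0 _))]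
    exact mul_le_mul (hb _) (hb _) (h0 _) ((h0 0).trans (hb 0))

end ConditionalDensity

/-! ### Integrating the standard deviation over ℝᵏ -/

section FluctuationBound

/-- Elementary estimates for the geometric means `d = √((W₁ + t)(W₂ + t))` and `ω = √(W₁ W₂)`. -/
lemma geometric_mean_bounds {lo hi t W₁ W₂ : ℝ} (hlo : 0 < lo) (ht : 0 < t)
    (h1 : lo ≤ W₁) (h1' : W₁ ≤ hi) (h2 : lo ≤ W₂) (h2' : W₂ ≤ hi) :
    lo + t ≤ √((W₁ + t) * (W₂ + t)) ∧ √((W₁ + t) * (W₂ + t)) ≤ hi + t ∧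
      lo ≤ √(W₁ * W₂) ∧ √(W₁ * W₂) ≤ hi ∧
      √(W₁ * W₂) + t ≤ √((W₁ + t) * (W₂ + t)) := by
  have hhi : 0 < hi := by linarith
  refine ⟨?_, ?_, ?_, ?_, ?_⟩
  · refine Real.le_sqrt_of_sq_le ?_
    rw [sq]
    exact mul_le_mul (by linarith) (by linarith) (by linarith) (by linarith)
  · refine Real.sqrt_le_iff.2 ⟨by linarith, ?_⟩
    rw [sq]
    exact mul_le_mul (by linarith) (by linarith) (by linarith) (by linarith)
  · refine Real.le_sqrt_of_sq_le ?_
    rw [sq]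
    exact mul_le_mul (by linarith) (by linarith) (by linarith) (by linarith)
  · refine Real.sqrt_le_iff.2 ⟨by linarith, ?_⟩
    rw [sq]
    exact mul_le_mul (by linarith) (by linarith) (by linarith) (by linarith)
  · refine Real.le_sqrt_of_sq_le ?_
    have hsq : √(W₁ * W₂) ^ 2 = W₁ * W₂ := Real.sq_sqrt (by nlinarith)
    have hamgm : 2 * √(W₁ * W₂) ≤ W₁ + W₂ := by
      refine abs_le_of_sq_le_sq' ?_ (by linarith) |>.2
      nlinarith [sq_nonneg (W₁ - W₂)]
    nlinarith

variable {k n : ℕ} {Ω : Type*} [MeasurableSpace Ω] {P : Measure Ω}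
  {Θ : Ω → Fin k → Fin n → ℝ} {X : Ω → EuclideanSpace ℝ (Fin n)}

lemma integrable_sq_inner_prod [SFinite P] (hX2 : MemLp X 2 P) (hXm : Measurable X) :
    Integrable (fun z : Ω × Ω ↦ ⟪X z.1, X z.2⟫ ^ 2) (P.prod P) := by
  have h := hX2.integrable_norm_pow two_ne_zero
  refine (h.mul_prod h).mono (Measurable.aestronglyMeasurable (by fun_prop))
    (ae_of_all _ fun z ↦ ?_)
  rw [Real.norm_of_nonneg (sq_nonneg _), Real.norm_of_nonneg (by positivity), ← mul_pow, ← sq_abs]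
  exact pow_le_pow_left₀ (abs_nonneg _) (abs_real_inner_le_norm _ _) 2

lemma integrable_abs_inner_prod [IsProbabilityMeasure P] (hX2 : MemLp X 2 P) (hXm : Measurable X) :
    Integrable (fun z : Ω × Ω ↦ |⟪X z.1, X z.2⟫|) (P.prod P) := by
  have h : Integrable (fun x ↦ ‖X x‖) P := (hX2.integrable (by norm_num)).norm
  refine (h.mul_prod h).mono (Measurable.aestronglyMeasurable (by fun_prop))
    (ae_of_all _ fun z ↦ ?_)
  rw [Real.norm_of_nonneg (abs_nonneg _), Real.norm_of_nonneg (by positivity)]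
  exact abs_real_inner_le_norm _ _

lemma betaCorr_nonneg (r : ℝ) : 0 ≤ betaCorr P r X := by
  unfold betaCorr
  have : 0 ≤ ∫ p : Ω × Ω, |⟪X p.1, X p.2⟫| ^ r ∂(P.prod P) :=
    integral_nonneg fun z ↦ by positivity
  positivity

lemma lintegral_abs_inner_eq [IsProbabilityMeasure P] (hX2 : MemLp X 2 P) (hXm : Measurable X) :
    ∫⁻ z, ENNReal.ofReal |⟪X z.1, X z.2⟫ / n| ∂(P.prod P) = ENNReal.ofReal (betaCorr P 1 X) := by
  have e : ∀ z : Ω × Ω, |⟪X z.1, X z.2⟫ / (n : ℝ)| = 1 / n * |⟪X z.1, X z.2⟫| := fun z ↦ by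
    rw [abs_div, Nat.abs_cast]
    ring
  simp_rw [e]
  rw [← ofReal_integral_eq_lintegral_ofReal ((integrable_abs_inner_prod hX2 hXm).const_mul _)
    (ae_of_all _ fun z ↦ by positivity), integral_const_mul]
  simp [betaCorr]

lemma lintegral_sq_inner_eq [IsProbabilityMeasure P] (hX2 : MemLp X 2 P) (hXm : Measurable X) :
    ∫⁻ z, ENNReal.ofReal ((⟪X z.1, X z.2⟫ / n) ^ 2) ∂(P.prod P)
      = ENNReal.ofReal (betaCorr P 2 X ^ 2) := by
  have e : ∀ z : Ω × Ω, (⟪X z.1, X z.2⟫ / (n : ℝ)) ^ 2 = (1 / n) ^ 2 * ⟪X z.1, X z.2⟫ ^ 2 :=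
    fun z ↦ by ring
  simp_rw [e]
  rw [← ofReal_integral_eq_lintegral_ofReal ((integrable_sq_inner_prod hX2 hXm).const_mul _)
    (ae_of_all _ fun z ↦ by positivity), integral_const_mul]
  have h0 : 0 ≤ ∫ z : Ω × Ω, ⟪X z.1, X z.2⟫ ^ 2 ∂(P.prod P) :=
    integral_nonneg fun z ↦ sq_nonneg _
  simp only [betaCorr, Real.rpow_two, sq_abs]
  rw [mul_pow, ← Real.sqrt_eq_rpow, Real.sq_sqrt h0]

lemma ofReal_sqrt_eq_rpow (x : ℝ) :
    ENNReal.ofReal (√x) = ENNReal.ofReal x ^ (1 / 2 : ℝ) := by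
  rcases le_total 0 x with h | h
  · rw [Real.sqrt_eq_rpow, ENNReal.ofReal_rpow_of_nonneg h (by norm_num)]
  · rw [Real.sqrt_eq_zero_of_nonpos h, ENNReal.ofReal_of_nonpos h]
    simp

/-- The total fluctuation of the conditional density over `Θ`. -/
lemma lintegral_sqrt_variance_le [IsProbabilityMeasure P] (hk : 0 < k) (hn : 0 < n) (hΘm : Measurable Θ)
    (hXm : Measurable X)
    (hΘlaw : ∀ i j, HasLaw (fun ω => Θ ω i j) (gaussianReal 0 (1 / (n : ℝ≥0))) P)
    (hΘindep : iIndepFun (fun (ij : Fin k × Fin n) ω => Θ ω ij.1 ij.2) P) (hX2 : MemLp X 2 P)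
    {t γ ε : ℝ} (ht : 0 < t) (hγ : 0 < γ) (hε : 0 < ε) (hε1 : ε ≤ 1) {A : Set Ω}
    (hA : A = {x | |‖X x‖ ^ 2 / n - γ| ≤ ε * γ / 5}) :
    ∫⁻ y : EuclideanSpace ℝ (Fin k), ENNReal.ofReal
        (√(∫ θ, (∫ x in A, gaussDens t (y - randProj (Θ θ) (X x)) ∂P) ^ 2 ∂P
          - (∫ θ, ∫ x in A, gaussDens t (y - randProj (Θ θ) (X x)) ∂P ∂P) ^ 2))
      ≤ ENNReal.ofReal (3 * (k : ℝ) ^ (3 / 4 : ℝ) * (betaCorr P 1 X / γ) ^ (1 / 2 : ℝ))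
        + ENNReal.ofReal (3 * (k : ℝ) ^ (1 / 4 : ℝ) * (1 + (2 + ε) * γ / t) ^ ((k : ℝ) / 4)
                * (betaCorr P 2 X / γ)) := by
  have hk0 : (0 : ℝ) < k := by exact_mod_cast hk
  have hn0 : (0 : ℝ) < n := by exact_mod_cast hn
  have hAm : MeasurableSet A := by
    rw [hA]
    exact measurableSet_le (by fun_prop) (by fun_prop)
  set lo := (1 - ε / 5) * γ with hlo
  set hi := (1 + ε / 5) * γ with hhi
  have hlo0 : 4 / 5 * γ ≤ lo := by rw [hlo]; nlinarith
  have hlopos : 0 < lo := by linarith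
  -- The width ε/5 is chosen for this: (1 + 1/5)/(1 - 1/5) = 3/2 is the variance range covered by
  -- `exists_weight`.
  have hhilo : hi ≤ 3 / 2 * lo := by rw [hlo, hhi]; nlinarith
  have hAW : ∀ x ∈ A, lo ≤ ‖X x‖ ^ 2 / n ∧ ‖X x‖ ^ 2 / n ≤ hi := by
    intro x hx
    rw [hA, Set.mem_ofPred_eq, abs_le] at hx
    constructor <;> nlinarith [hx.1, hx.2]
  have hAX : ∀ x ∈ A, X x ≠ 0 := by
    intro x hx h0
    have := (hAW x hx).1
    rw [h0] at this
    simp at this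
    linarith
  set W : Ω → ℝ := fun x ↦ ‖X x‖ ^ 2 / n with hW
  have hWm : Measurable W := by fun_prop
  set d : Ω × Ω → ℝ := fun z ↦ √((W z.1 + t) * (W z.2 + t)) with hd
  set om : Ω × Ω → ℝ := fun z ↦ √(W z.1 * W z.2) with hom
  set S : Ω × Ω → ℝ := fun z ↦ ⟪X z.1, X z.2⟫ / n with hS
  have hdm : Measurable d := by fun_prop
  have homm : Measurable om := by fun_prop
  have hSm : Measurable S := by fun_prop
  have hgeo : ∀ z ∈ A ×ˢ A, lo + t ≤ d z ∧ d z ≤ hi + t ∧ lo ≤ om z ∧ om z ≤ hi ∧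
      om z + t ≤ d z := fun z hz ↦
    geometric_mean_bounds hlopos ht (hAW _ hz.1).1 (hAW _ hz.1).2 (hAW _ hz.2).1 (hAW _ hz.2).2
  have hSom : ∀ z, |S z| ≤ om z := by
    intro z
    refine Real.le_sqrt_of_sq_le ?_
    have h := pow_le_pow_left₀ (abs_nonneg _) (abs_real_inner_le_norm (X z.1) (X z.2)) 2
    rw [sq_abs, mul_pow] at h
    rw [hS, hW, sq_abs, div_pow, div_mul_div_comm, ← sq]
    gcongr
  set R := 1 + (2 + ε) * γ / t with hR
  have hR1 : 1 ≤ R := by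
    have : 0 ≤ (2 + ε) * γ / t := by positivity
    linarith
  set w₁ : Ω × Ω → ℝ≥0∞ := (A ×ˢ A).indicator fun z ↦ ENNReal.ofReal (2 * k * (|S z| / d z))
    with hw₁
  set w₂ : Ω × Ω → ℝ≥0∞ := (A ×ˢ A).indicator fun z ↦
    ENNReal.ofReal (4 * (S z / om z) ^ 2 * √((d z + om z) / (d z - om z)) ^ k) with hw₂
  have hw₁m : Measurable w₁ := Measurable.indicator (by fun_prop) (hAm.prod hAm)
  have hw₂m : Measurable w₂ := Measurable.indicator (by fun_prop) (hAm.prod hAm)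
  have hmem₁ : ∀ z, w₁ z ≠ 0 → z ∈ A ×ˢ A := fun z hz ↦ Set.mem_of_indicator_ne_zero hz
  have hmem₂ : ∀ z, w₂ z ≠ 0 → z ∈ A ×ˢ A := fun z hz ↦ Set.mem_of_indicator_ne_zero hz
  have hpt : ∀ y : EuclideanSpace ℝ (Fin k), ENNReal.ofReal
        (√(∫ θ, (∫ x in A, gaussDens t (y - randProj (Θ θ) (X x)) ∂P) ^ 2 ∂P
          - (∫ θ, ∫ x in A, gaussDens t (y - randProj (Θ θ) (X x)) ∂P ∂P) ^ 2))
      ≤ (∫⁻ z, w₁ z * ENNReal.ofReal (gaussDens (d z * (1 + 1 / k)) y ^ 2) ∂(P.prod P))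
            ^ (1 / 2 : ℝ)
        + (∫⁻ z, w₂ z * ENNReal.ofReal (gaussDens (d z + om z) y ^ 2) ∂(P.prod P))
            ^ (1 / 2 : ℝ) := by
    intro y
    rw [variance_condDens_eq hΘm hXm hΘlaw hΘindep hn ht hAm hAX, ofReal_sqrt_eq_rpow]
    -- Subadditivity of the square root separates the β₁ and β₂ contributions.
    refine le_trans ?_ (ENNReal.rpow_add_le_add_rpow _ _ (by norm_num) (by norm_num))
    refine ENNReal.rpow_le_rpow ?_ (by norm_num)
    refine (ofReal_integral_le_lintegral_ofReal _).trans ?_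
    rw [← lintegral_add_left (by unfold gaussDens; fun_prop),
      ← lintegral_indicator (hAm.prod hAm)]
    refine lintegral_mono fun z ↦ ?_
    by_cases hz : z ∈ A ×ˢ A
    · obtain ⟨g1, g2, g3, g4, g5⟩ := hgeo z hz
      have hov := overlap_sub_le hk (a := W z.1 + t) (b := W z.2 + t) (s := S z) (ω := om z)
        (by positivity) (by positivity) (hSom z) (by linarith)
        (by change om z < d z; linarith) y
      rw [Set.indicator_of_mem hz, hw₁, hw₂, Set.indicator_of_mem hz, Set.indicator_of_mem hz]
      have hdo : 0 < d z - om z := by linarith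
      have hd0 : 0 < d z := by linarith
      rw [← ENNReal.ofReal_mul (by positivity), ← ENNReal.ofReal_mul (by positivity),
        ← ENNReal.ofReal_add (by positivity) (by positivity)]
      refine ENNReal.ofReal_le_ofReal (hov.trans (le_of_eq ?_))
      simp only [hd]
      ring
    · rw [Set.indicator_of_notMem hz]
      exact zero_le
  refine (lintegral_mono hpt).trans ?_
  have hmeas : Measurable fun y : EuclideanSpace ℝ (Fin k) ↦
      (∫⁻ z, w₁ z * ENNReal.ofReal (gaussDens (d z * (1 + 1 / k)) y ^ 2) ∂(P.prod P))
            ^ (1 / 2 : ℝ) := by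
    refine Measurable.pow_const (Measurable.lintegral_prod_right'
      (f := fun p : EuclideanSpace ℝ (Fin k) × (Ω × Ω) ↦
        w₁ p.2 * ENNReal.ofReal (gaussDens (d p.2 * (1 + 1 / k)) p.1 ^ 2)) ?_) _
    unfold gaussDens
    fun_prop
  rw [lintegral_add_left hmeas]
  refine add_le_add ?_ ?_
  · refine (lintegral_sqrt_mixture_le (P.prod P) hk (D₀ := (lo + t) * (1 + 1 / k)) (by positivity)
      hw₁m (by fun_prop) fun z hz ↦ ?_).trans ?_
    · obtain ⟨g1, g2, -⟩ := hgeo z (hmem₁ z hz)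
      constructor
      · gcongr
      · rw [← mul_assoc]
        gcongr
        linarith
    have hβ := betaCorr_nonneg (P := P) (X := X) 1
    have hle : ∫⁻ z, w₁ z ∂(P.prod P) ≤ ENNReal.ofReal (5 / 2 * k * (betaCorr P 1 X / γ)) := by
      calc ∫⁻ z, w₁ z ∂(P.prod P)
          ≤ ∫⁻ z, ENNReal.ofReal (5 / 2 * k / γ) * ENNReal.ofReal |S z| ∂(P.prod P) := by
            refine lintegral_mono (Set.indicator_le (g := fun z ↦
              ENNReal.ofReal (5 / 2 * k / γ) * ENNReal.ofReal |S z|) fun z hz ↦ ?_)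
            obtain ⟨g1, -⟩ := hgeo z hz
            rw [← ENNReal.ofReal_mul (by positivity)]
            refine ENNReal.ofReal_le_ofReal ?_
            have hdz : 4 / 5 * γ ≤ d z := by linarith
            calc 2 * k * (|S z| / d z) ≤ 2 * k * (|S z| / (4 / 5 * γ)) := by gcongr
              _ = 5 / 2 * k / γ * |S z| := by field_simp; ring
        _ = ENNReal.ofReal (5 / 2 * k * (betaCorr P 1 X / γ)) := by
            rw [lintegral_const_mul _ (by fun_prop), lintegral_abs_inner_eq hX2 hXm,
              ← ENNReal.ofReal_mul (by positivity)]
            congr 1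
            ring
    refine (ENNReal.rpow_le_rpow (mul_le_mul_right hle _) (by norm_num)).trans ?_
    rw [← ENNReal.ofReal_mul (by positivity), ← ofReal_sqrt_eq_rpow]
    -- After squaring, the constants are 6/5 · 5/2 = 3 against 9.
    refine ENNReal.ofReal_le_ofReal (Real.sqrt_le_iff.2 ⟨by positivity, ?_⟩)
    have e1 : ((k : ℝ) ^ (3 / 4 : ℝ)) ^ 2 = k * √k := by
      rw [Real.sqrt_eq_rpow, ← Real.rpow_natCast, ← Real.rpow_mul hk0.le]
      nth_rewrite 2 [← Real.rpow_one (k : ℝ)]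
      rw [← Real.rpow_add hk0]
      norm_num
    have e2 : ((betaCorr P 1 X / γ) ^ (1 / 2 : ℝ)) ^ 2 = betaCorr P 1 X / γ := by
      rw [← Real.sqrt_eq_rpow, Real.sq_sqrt (by positivity)]
    rw [mul_pow, mul_pow, e1, e2]
    have : 0 ≤ k * √k * (betaCorr P 1 X / γ) := by positivity
    nlinarith
  · refine (lintegral_sqrt_mixture_le (P.prod P) hk (D₀ := 2 * lo + t) (by positivity)
      hw₂m (by fun_prop) fun z hz ↦ ?_).trans ?_
    · obtain ⟨g1, g2, g3, g4, -⟩ := hgeo z (hmem₂ z hz)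
      constructor <;> linarith
    have hβ := betaCorr_nonneg (P := P) (X := X) 2
    have hle : ∫⁻ z, w₂ z ∂(P.prod P)
        ≤ ENNReal.ofReal (25 / 4 * √R ^ k * (betaCorr P 2 X / γ) ^ 2) := by
      calc ∫⁻ z, w₂ z ∂(P.prod P)
          ≤ ∫⁻ z, ENNReal.ofReal (25 / 4 / γ ^ 2 * √R ^ k) * ENNReal.ofReal (S z ^ 2)
              ∂(P.prod P) := by
            refine lintegral_mono (Set.indicator_le (g := fun z ↦
              ENNReal.ofReal (25 / 4 / γ ^ 2 * √R ^ k) * ENNReal.ofReal (S z ^ 2)) fun z hz ↦ ?_)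
            obtain ⟨g1, g2, g3, g4, g5⟩ := hgeo z hz
            rw [← ENNReal.ofReal_mul (by positivity)]
            refine ENNReal.ofReal_le_ofReal ?_
            have hoz : 4 / 5 * γ ≤ om z := by linarith
            have hdo : t ≤ d z - om z := by linarith
            -- Here the gap d - ω is at least t, and 2ω ≤ 2(1 + ε/5)γ ≤ (2 + ε)γ.
            have hratio : (d z + om z) / (d z - om z) ≤ R := by
              have e : (d z + om z) / (d z - om z) = 1 + 2 * om z / (d z - om z) := by
                rw [div_eq_iff (by linarith), add_mul, div_mul_cancel₀ _ (by linarith)]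
                ring
              rw [e, hR]
              have : 2 * om z ≤ (2 + ε) * γ := by rw [hhi] at g4; nlinarith
              gcongr
            have hS2 : (S z / om z) ^ 2 ≤ 25 / 16 / γ ^ 2 * S z ^ 2 := by
              rw [div_pow]
              calc S z ^ 2 / om z ^ 2 ≤ S z ^ 2 / (4 / 5 * γ) ^ 2 := by gcongr
                _ = _ := by field_simp; ring
            calc 4 * (S z / om z) ^ 2 * √((d z + om z) / (d z - om z)) ^ k
                ≤ 4 * (25 / 16 / γ ^ 2 * S z ^ 2) * √R ^ k := by gcongr
              _ = _ := by ring
        _ = _ := by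
            rw [lintegral_const_mul _ (by fun_prop), lintegral_sq_inner_eq hX2 hXm,
              ← ENNReal.ofReal_mul (by positivity)]
            congr 1
            ring
    refine (ENNReal.rpow_le_rpow (mul_le_mul_right hle _) (by norm_num)).trans ?_
    rw [← ENNReal.ofReal_mul (by positivity), ← ofReal_sqrt_eq_rpow]
    -- After squaring, the constants are 6/5 · 25/4 = 15/2 against 9.
    refine ENNReal.ofReal_le_ofReal (Real.sqrt_le_iff.2 ⟨by positivity, ?_⟩)
    have e1 : ((k : ℝ) ^ (1 / 4 : ℝ)) ^ 2 = √k := by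
      rw [Real.sqrt_eq_rpow, ← Real.rpow_natCast, ← Real.rpow_mul hk0.le]
      norm_num
    have e2 : (R ^ ((k : ℝ) / 4)) ^ 2 = √R ^ k := by
      rw [Real.sqrt_eq_rpow, ← Real.rpow_natCast, ← Real.rpow_natCast, ← Real.rpow_mul (by linarith),
        ← Real.rpow_mul (by linarith)]
      congr 1
      push_cast
      ring
    rw [mul_pow, mul_pow, mul_pow, e1, e2]
    have : 0 ≤ √k * √R ^ k * (betaCorr P 2 X / γ) ^ 2 := by positivity
    nlinarith

end FluctuationBound

/-! ### Assembling the averaged divergence of the conditional densities -/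

section EntropyBound

variable {k n : ℕ} {Ω : Type*} [MeasurableSpace Ω] {P : Measure Ω} [IsProbabilityMeasure P]
  {Θ : Ω → Fin k → Fin n → ℝ} {X : Ω → EuclideanSpace ℝ (Fin n)}

lemma integral_norm_sq_randProj (hΘm : Measurable Θ)
    (hΘlaw : ∀ i j, HasLaw (fun ω => Θ ω i j) (gaussianReal 0 (1 / (n : ℝ≥0))) P)
    (hΘindep : iIndepFun (fun (ij : Fin k × Fin n) ω => Θ ω ij.1 ij.2) P)
    (x : EuclideanSpace ℝ (Fin n)) :
    Integrable (fun ω ↦ ‖randProj (Θ ω) x‖ ^ 2) P ∧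
      ∫ ω, ‖randProj (Θ ω) x‖ ^ 2 ∂P = k * (‖x‖ ^ 2 / n) := by
  have hm : Measurable fun ω ↦ randProj (Θ ω) x := by fun_prop
  have e : ∀ z : EuclideanSpace ℝ (Fin k), ‖√(‖x‖ ^ 2 / n) • z‖ ^ 2 = (‖x‖ ^ 2 / n) * ‖z‖ ^ 2 := by
    intro z
    rw [norm_smul, mul_pow, Real.norm_eq_abs, sq_abs, Real.sq_sqrt (by positivity)]
  constructor
  · have : Integrable (fun u ↦ ‖u‖ ^ 2) (P.map fun ω ↦ randProj (Θ ω) x) := by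
      rw [map_randProj hΘm hΘlaw hΘindep, integrable_map_measure (by fun_prop) (by fun_prop)]
      simp only [Function.comp_def, e]
      exact integrable_norm_sq_stdGaussian.const_mul _
    exact (integrable_map_measure (by fun_prop) hm.aemeasurable).1 this
  · rw [← integral_map (f := fun u ↦ ‖u‖ ^ 2) hm.aemeasurable (by fun_prop),
      map_randProj hΘm hΘlaw hΘindep, integral_map (by fun_prop) (by fun_prop)]
    simp_rw [e]
    rw [integral_const_mul, integral_norm_sq_stdGaussian, mul_comm]

lemma lintegral_alphaDev {γ : ℝ} (hn : 0 < n) (hX2 : MemLp X 2 P)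
    (hγ : 1 / (n : ℝ) * ∫ ω, ‖X ω‖ ^ 2 ∂P = γ) :
    ∫⁻ x, ENNReal.ofReal |‖X x‖ ^ 2 / n - γ| ∂P = ENNReal.ofReal (alphaDev P X) := by
  have hn0 : (0 : ℝ) < n := by exact_mod_cast hn
  have hi := hX2.integrable_norm_pow two_ne_zero
  have hi' : Integrable (fun x ↦ |‖X x‖ ^ 2 / n - γ|) P :=
    ((hi.div_const _).sub (integrable_const γ)).abs
  rw [← ofReal_integral_eq_lintegral_ofReal hi'
    (ae_of_all _ fun x ↦ abs_nonneg _), alphaDev, ← integral_const_mul]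
  congr 1
  refine integral_congr_ae (ae_of_all _ fun x ↦ ?_)
  simp only
  rw [← hγ, ← abs_of_pos (show 0 < 1 / (n : ℝ) by positivity), ← abs_mul,
    abs_of_pos (show 0 < 1 / (n : ℝ) by positivity)]
  congr 1
  ring

/-- The averaged relative entropy of the conditional density of `Θ X + √t N` given `Θ`. -/
lemma lintegral_condDens_klFun_le (hk : 0 < k) (hn : 0 < n) (hΘm : Measurable Θ)
    (hXm : Measurable X)
    (hΘlaw : ∀ i j, HasLaw (fun ω => Θ ω i j) (gaussianReal 0 (1 / (n : ℝ≥0))) P)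
    (hΘindep : iIndepFun (fun (ij : Fin k × Fin n) ω => Θ ω ij.1 ij.2) P) (hX2 : MemLp X 2 P)
    {t γ ε : ℝ} (ht : 0 < t) (hγ : 1 / (n : ℝ) * ∫ ω, ‖X ω‖ ^ 2 ∂P = γ) (hγ0 : 0 < γ)
    (hε : 0 < ε) (hε1 : ε ≤ 1) :
    ∫⁻ θ, (∫⁻ y : EuclideanSpace ℝ (Fin k), ENNReal.ofReal (gaussDens (γ + t) y *
        klFun ((∫ x, gaussDens t (y - randProj (Θ θ) (X x)) ∂P) / gaussDens (γ + t) y))) ∂P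
      ≤ ENNReal.ofReal
          (3 * (k : ℝ) * Real.log (1 + γ / t) * (alphaDev P X / (ε * γ))
            + 3 * (k : ℝ) ^ (3 / 4 : ℝ) * (betaCorr P 1 X / γ) ^ (1 / 2 : ℝ)
            + 3 * (k : ℝ) ^ (1 / 4 : ℝ) * (1 + (2 + ε) * γ / t) ^ ((k : ℝ) / 4)
                * (betaCorr P 2 X / γ)) := by
  have hc : 0 < γ + t := by positivity
  have hn0 : (0 : ℝ) < n := by exact_mod_cast hn
  set A : Set Ω := {x | |‖X x‖ ^ 2 / n - γ| ≤ ε * γ / 5} with hA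
  have hAm : MeasurableSet A := measurableSet_le (by fun_prop) (by fun_prop)
  have hfm : Measurable fun p : (EuclideanSpace ℝ (Fin k) × Ω) × Ω ↦
      gaussDens t (p.1.1 - randProj (Θ p.1.2) (X p.2)) := by fun_prop
  have hpm : Measurable fun p : EuclideanSpace ℝ (Fin k) × Ω ↦
      ∫ x, gaussDens t (p.1 - randProj (Θ p.2) (X x)) ∂P :=
    (hfm.stronglyMeasurable.integral_prod_right' (ν := P)).measurable
  have hkm := measurable_klFun
  have hgm : Measurable fun p : EuclideanSpace ℝ (Fin k) × Ω ↦ gaussDens (γ + t) p.1 := by fun_prop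
  rw [lintegral_lintegral_swap]
  swap
  · exact ((hgm.mul (hkm.comp (hpm.div hgm))).ennreal_ofReal.comp measurable_swap).aemeasurable
  -- θ and x are separate points of Ω, so the double average runs over P × P, as for independent Θ
  -- and X.
  have hpt := fun y : EuclideanSpace ℝ (Fin k) ↦ lintegral_klFun_mixture_le (P := P)
    (F := fun θ x ↦ gaussDens t (y - randProj (Θ θ) (X x)))
    (by change Measurable fun p : Ω × Ω ↦ gaussDens t (y - randProj (Θ p.1) (X p.2)); fun_prop)
    (fun _ _ ↦ gaussDens_pos ht _) (fun _ _ ↦ gaussDens_le ht _) (gaussDens_pos hc y) hAm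
  refine (lintegral_mono hpt).trans ?_
  have hF3 : Measurable fun p : (EuclideanSpace ℝ (Fin k) × Ω) × Ω ↦
      ENNReal.ofReal (gaussDens (γ + t) p.1.1 *
        klFun (gaussDens t (p.1.1 - randProj (Θ p.2) (X p.1.2)) / gaussDens (γ + t) p.1.1)) := by
    have h1 : Measurable fun p : (EuclideanSpace ℝ (Fin k) × Ω) × Ω ↦
      gaussDens t (p.1.1 - randProj (Θ p.2) (X p.1.2)) := by fun_prop
    have h2 : Measurable fun p : (EuclideanSpace ℝ (Fin k) × Ω) × Ω ↦
      gaussDens (γ + t) p.1.1 := by fun_prop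
    exact (h2.mul (hkm.comp (h1.div h2))).ennreal_ofReal
  have hF2 : Measurable fun p : EuclideanSpace ℝ (Fin k) × Ω ↦
      ∫⁻ θ, ENNReal.ofReal (gaussDens (γ + t) p.1 *
        klFun (gaussDens t (p.1 - randProj (Θ θ) (X p.2)) / gaussDens (γ + t) p.1)) ∂P :=
    hF3.lintegral_prod_right'
  have hF1 : Measurable fun y : EuclideanSpace ℝ (Fin k) ↦
      ∫⁻ x in Aᶜ, ∫⁻ θ, ENNReal.ofReal (gaussDens (γ + t) y *
        klFun (gaussDens t (y - randProj (Θ θ) (X x)) / gaussDens (γ + t) y)) ∂P ∂P :=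
    hF2.lintegral_prod_right'
  have hWm : Measurable fun x ↦ ‖X x‖ ^ 2 / n + t := by fun_prop
  have hG2 : Measurable fun p : EuclideanSpace ℝ (Fin k) × Ω ↦
      ENNReal.ofReal (gaussDens (γ + t) p.1 *
        klFun (gaussDens (‖X p.2‖ ^ 2 / n + t) p.1 / gaussDens (γ + t) p.1)) := by
    have h1 : Measurable fun p : EuclideanSpace ℝ (Fin k) × Ω ↦
        gaussDens (‖X p.2‖ ^ 2 / n + t) p.1 := by
      unfold gaussDens
      fun_prop
    exact (hgm.mul (hkm.comp (h1.div hgm))).ennreal_ofReal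
  have hG1 : Measurable fun y : EuclideanSpace ℝ (Fin k) ↦
      ∫⁻ x in A, ENNReal.ofReal (gaussDens (γ + t) y *
        klFun (gaussDens (‖X x‖ ^ 2 / n + t) y / gaussDens (γ + t) y)) ∂P :=
    hG2.lintegral_prod_right'
  simp_rw [integral_gaussDens_randProj hΘm hΘlaw hΘindep ht]
  rw [lintegral_add_left, lintegral_add_left hF1]
  swap
  · exact hF1.add hG1
  set G : Ω → ℝ≥0∞ := fun x ↦
    ENNReal.ofReal (3 * k * Real.log (1 + γ / t) * (|‖X x‖ ^ 2 / n - γ| / (ε * γ))) with hG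
  have hlog0 : 0 ≤ Real.log (1 + γ / t) := Real.log_nonneg (by
    have : 0 ≤ γ / t := by positivity
    linarith)
  have hfar : ∫⁻ y : EuclideanSpace ℝ (Fin k), ∫⁻ x in Aᶜ, ∫⁻ θ,
      ENNReal.ofReal (gaussDens (γ + t) y *
        klFun (gaussDens t (y - randProj (Θ θ) (X x)) / gaussDens (γ + t) y)) ∂P ∂P
      ≤ ∫⁻ x in Aᶜ, G x ∂P := by
    rw [lintegral_lintegral_swap]
    swap
    · exact hF2.aemeasurable
    refine setLIntegral_mono' hAm.compl fun x hx ↦ ?_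
    rw [lintegral_lintegral_swap]
    swap
    · have h1 : Measurable fun p : EuclideanSpace ℝ (Fin k) × Ω ↦
        gaussDens t (p.1 - randProj (Θ p.2) (X x)) := by fun_prop
      exact (hgm.mul (hkm.comp (h1.div hgm))).ennreal_ofReal.aemeasurable
    simp_rw [lintegral_gaussDens_mul_klFun ht hc]
    obtain ⟨hni, hnv⟩ := integral_norm_sq_randProj hΘm hΘlaw hΘindep (X x)
    have hkl0 : 0 ≤ t / (γ + t) - 1 + Real.log ((γ + t) / t) := by
      have h := Real.log_le_sub_one_of_pos (show 0 < t / (γ + t) by positivity)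
      have h2 : Real.log ((γ + t) / t) = -Real.log (t / (γ + t)) := by
        rw [← Real.log_inv, inv_div]
      linarith
    have hci : Integrable (fun _ : Ω ↦ (k : ℝ) / 2 * (t / (γ + t) - 1 + Real.log ((γ + t) / t))) P :=
      integrable_const _
    have hni' := hni.div_const (2 * (γ + t))
    rw [← ofReal_integral_eq_lintegral_ofReal (hci.fun_add hni') (ae_of_all _ fun θ ↦
      add_nonneg (mul_nonneg (by positivity) hkl0) (by positivity)), integral_add hci hni',
      integral_div, hnv]
    refine ENNReal.ofReal_le_ofReal ?_
    have hx' : ε * γ / 5 < |‖X x‖ ^ 2 / n - γ| := not_le.1 hx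
    have := fluctuation_cost_far (K := k) (by positivity) hγ0 ht hε hε1 hx'
    simpa using this
  have hnear : ∫⁻ y : EuclideanSpace ℝ (Fin k), ∫⁻ x in A, ENNReal.ofReal (gaussDens (γ + t) y *
        klFun (gaussDens (‖X x‖ ^ 2 / n + t) y / gaussDens (γ + t) y)) ∂P
      ≤ ∫⁻ x in A, G x ∂P := by
    rw [lintegral_lintegral_swap]
    swap
    · exact hG2.aemeasurable
    refine setLIntegral_mono' hAm fun x hx ↦ ?_
    have h := lintegral_gaussDens_mul_klFun (k := k) (v := ‖X x‖ ^ 2 / n + t) (by positivity) hc 0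
    simp only [sub_zero] at h
    rw [h]
    refine ENNReal.ofReal_le_ofReal ?_
    have := fluctuation_cost_near (K := k) (by positivity) hγ0 ht hε hε1 hx
    simpa using this
  have hGtot : (∫⁻ x in Aᶜ, G x ∂P) + ∫⁻ x in A, G x ∂P
      = ENNReal.ofReal (3 * (k : ℝ) * Real.log (1 + γ / t) * (alphaDev P X / (ε * γ))) := by
    rw [add_comm, lintegral_add_compl G hAm, hG]
    have e : ∀ x, 3 * (k : ℝ) * Real.log (1 + γ / t) * (|‖X x‖ ^ 2 / n - γ| / (ε * γ))
        = (3 * k * Real.log (1 + γ / t) / (ε * γ)) * |‖X x‖ ^ 2 / n - γ| := fun x ↦ by ring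
    have hq : 0 ≤ 3 * (k : ℝ) * Real.log (1 + γ / t) / (ε * γ) := by positivity
    simp_rw [e, ENNReal.ofReal_mul hq]
    have hXm' : Measurable fun x ↦ ENNReal.ofReal |‖X x‖ ^ 2 / n - γ| := by fun_prop
    rw [lintegral_const_mul _ hXm', lintegral_alphaDev hn hX2 hγ, ← ENNReal.ofReal_mul hq]
    congr 1
    ring
  have hvar := lintegral_sqrt_variance_le hk hn hΘm hXm hΘlaw hΘindep hX2 ht hγ0 hε hε1 hA
  have hα0 : 0 ≤ alphaDev P X := mul_nonneg (by positivity) (integral_nonneg fun _ ↦ abs_nonneg _)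
  have hβ1 := betaCorr_nonneg (P := P) (X := X) 1
  have hβ2 := betaCorr_nonneg (P := P) (X := X) 2
  refine (add_le_add (add_le_add hfar hnear) hvar).trans_eq ?_
  rw [hGtot, ← ENNReal.ofReal_add (by positivity) (by positivity),
    ← ENNReal.ofReal_add (by positivity) (by positivity), add_assoc]

end EntropyBound

/-! ### Identification of the conditional law and its divergence -/

section ConditionalDensity

variable {k n : ℕ} {Ω : Type*} [MeasurableSpace Ω]

/-- The density of `θ X + √t N` for a fixed matrix `θ`. -/
noncomputable def condDens (P : Measure Ω) (X : Ω → EuclideanSpace ℝ (Fin n)) (t : ℝ)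
    (θ : Fin k → Fin n → ℝ) (y : EuclideanSpace ℝ (Fin k)) : ℝ :=
  ∫ x, gaussDens t (y - randProj θ (X x)) ∂P

variable {P : Measure Ω} {Θ : Ω → Fin k → Fin n → ℝ}
  {X : Ω → EuclideanSpace ℝ (Fin n)} {N : Ω → EuclideanSpace ℝ (Fin k)} {t : ℝ}

lemma condDens_nonneg (θ : Fin k → Fin n → ℝ) (y : EuclideanSpace ℝ (Fin k)) :
    0 ≤ condDens P X t θ y :=
  integral_nonneg fun _ ↦ gaussDens_nonneg _ _

variable [IsProbabilityMeasure P]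

lemma measurable_condDens (hXm : Measurable X) :
    Measurable fun p : (Fin k → Fin n → ℝ) × EuclideanSpace ℝ (Fin k) ↦
      condDens P X t p.1 p.2 := by
  have hfm : Measurable fun p : ((Fin k → Fin n → ℝ) × EuclideanSpace ℝ (Fin k)) × Ω ↦
      gaussDens t (p.1.2 - randProj p.1.1 (X p.2)) := by fun_prop
  exact (hfm.stronglyMeasurable.integral_prod_right' (ν := P)).measurable

lemma ofReal_condDens (hXm : Measurable X) (ht : 0 < t) (θ : Fin k → Fin n → ℝ)
    (y : EuclideanSpace ℝ (Fin k)) :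
    ENNReal.ofReal (condDens P X t θ y)
      = ∫⁻ x, ENNReal.ofReal (gaussDens t (y - randProj θ (X x))) ∂P := by
  refine ofReal_integral_eq_lintegral_ofReal ?_ (ae_of_all _ fun x ↦ gaussDens_nonneg _ _)
  exact Integrable.of_bound (Measurable.aestronglyMeasurable (by fun_prop)) _
    (ae_of_all _ fun x ↦ (Real.norm_of_nonneg (gaussDens_nonneg _ _)).trans_le (gaussDens_le ht _))

/-- Averaging a function over `θ X + √t Z` with `Z` standard Gaussian. -/
lemma lintegral_noise_eq (hXm : Measurable X) (ht : 0 < t) (θ : Fin k → Fin n → ℝ)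
    {f : EuclideanSpace ℝ (Fin k) → ℝ≥0∞} (hf : Measurable f) :
    ∫⁻ x, (∫⁻ z, f (randProj θ (X x) + √t • z) ∂(stdGaussian (EuclideanSpace ℝ (Fin k)))) ∂P
      = ∫⁻ y, ENNReal.ofReal (condDens P X t θ y) * f y := by
  have h1 : ∀ m : EuclideanSpace ℝ (Fin k),
      ∫⁻ z, f (m + √t • z) ∂(stdGaussian (EuclideanSpace ℝ (Fin k)))
        = ∫⁻ y, ENNReal.ofReal (gaussDens t (y - m)) * f y := by
    intro m
    have hm : Measurable fun u ↦ f (m + u) := by fun_prop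
    rw [← lintegral_map (f := fun u ↦ f (m + u)) (g := fun z ↦ √t • z) hm (by fun_prop),
      map_sqrt_smul_stdGaussian ht, gaussMeas,
      lintegral_withDensity_eq_lintegral_mul _ (by fun_prop) hm,
      ← lintegral_sub_right_eq_self _ m]
    refine lintegral_congr fun y ↦ ?_
    simp
  simp_rw [h1]
  have hm2 : Measurable fun p : Ω × EuclideanSpace ℝ (Fin k) ↦
      ENNReal.ofReal (gaussDens t (p.2 - randProj θ (X p.1))) * f p.2 := by fun_prop
  rw [lintegral_lintegral_swap]
  swap
  · exact hm2.aemeasurable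
  refine lintegral_congr fun y ↦ ?_
  rw [lintegral_mul_const _ (by fun_prop), ofReal_condDens hXm ht]

lemma lintegral_ofReal_condDens (hXm : Measurable X) (ht : 0 < t) (θ : Fin k → Fin n → ℝ) :
    ∫⁻ y, ENNReal.ofReal (condDens P X t θ y) = 1 := by
  have := lintegral_noise_eq (P := P) hXm ht θ (f := 1) measurable_one
  simpa using this.symm

/-- The conditional law of `Θ X + √t N` given `Θ`, as a kernel. -/
noncomputable def condKernel (P : Measure Ω) (X : Ω → EuclideanSpace ℝ (Fin n)) (t : ℝ) :
    Kernel (Fin k → Fin n → ℝ) (EuclideanSpace ℝ (Fin k)) :=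
  Kernel.withDensity (Kernel.const _ volume) fun θ y ↦ ENNReal.ofReal (condDens P X t θ y)

lemma condKernel_apply (hXm : Measurable X) (θ : Fin k → Fin n → ℝ) :
    condKernel P X t θ
      = (volume : Measure (EuclideanSpace ℝ (Fin k))).withDensity
        fun y ↦ ENNReal.ofReal (condDens P X t θ y) := by
  rw [condKernel, Kernel.withDensity_apply, Kernel.const_apply]
  exact (measurable_condDens hXm).ennreal_ofReal

lemma isMarkovKernel_condKernel (hXm : Measurable X) (ht : 0 < t) :
    IsMarkovKernel (condKernel (k := k) P X t) :=
  ⟨fun θ ↦ ⟨by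
    rw [condKernel_apply hXm, withDensity_apply _ .univ, setLIntegral_univ,
      lintegral_ofReal_condDens hXm ht]⟩⟩

/-- Independence factors the law of (Θ, X, N), and for fixed θ the noise smooths θX into `condDens`.
Uniqueness of disintegration then identifies `condDistrib` with this kernel almost surely. -/
lemma map_prodMk_noisyProj (hΘm : Measurable Θ) (hXm : Measurable X) (hNm : Measurable N)
    (hNlaw : HasLaw N (stdGaussian (EuclideanSpace ℝ (Fin k))) P) (hΘX : IndepFun Θ X P)
    (hN : IndepFun N (fun ω => (Θ ω, X ω)) P) (ht : 0 < t) :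
    P.map (fun ω ↦ (Θ ω, noisyProj Θ X N t ω)) = P.map Θ ⊗ₘ condKernel P X t := by
  have := isMarkovKernel_condKernel (k := k) (P := P) hXm ht
  have hYm : Measurable (noisyProj Θ X N t) := by
    change Measurable fun ω ↦ randProj (Θ ω) (X ω) + √t • N ω
    fun_prop
  have hΘp := Measure.isProbabilityMeasure_map (μ := P) hΘm.aemeasurable
  have hXp := Measure.isProbabilityMeasure_map (μ := P) hXm.aemeasurable
  have hjoint : P.map (fun ω ↦ ((Θ ω, X ω), N ω))
      = ((P.map Θ).prod (P.map X)).prod (stdGaussian (EuclideanSpace ℝ (Fin k))) := by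
    have h1 := (indepFun_iff_map_prod_eq_prod_map_map (by fun_prop) (by fun_prop)).1 hN.symm
    have h2 := (indepFun_iff_map_prod_eq_prod_map_map (by fun_prop) (by fun_prop)).1 hΘX
    rw [h1, h2, hNlaw.map_eq]
  refine Measure.ext_of_lintegral _ fun f hf ↦ ?_
  have hg : Measurable fun q : ((Fin k → Fin n → ℝ) × EuclideanSpace ℝ (Fin n)) ×
      EuclideanSpace ℝ (Fin k) ↦ f (q.1.1, randProj q.1.1 q.1.2 + √t • q.2) := by fun_prop
  have e1 : ∫⁻ ω, f (Θ ω, noisyProj Θ X N t ω) ∂P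
      = ∫⁻ q, f (q.1.1, randProj q.1.1 q.1.2 + √t • q.2)
        ∂(P.map fun ω ↦ ((Θ ω, X ω), N ω)) := by
    rw [lintegral_map hg (by fun_prop)]
    rfl
  rw [lintegral_map hf (by fun_prop), e1, hjoint, lintegral_prod _ hg.aemeasurable,
    lintegral_prod _ hg.lintegral_prod_right'.aemeasurable, Measure.lintegral_compProd hf]
  refine lintegral_congr fun θ ↦ ?_
  have hfθ : Measurable fun y ↦ f (θ, y) := by fun_prop
  have hin : Measurable fun x ↦ ∫⁻ z, f (θ, randProj θ x + √t • z)
      ∂(stdGaussian (EuclideanSpace ℝ (Fin k))) := by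
    have : Measurable fun q : EuclideanSpace ℝ (Fin n) × EuclideanSpace ℝ (Fin k) ↦
      f (θ, randProj θ q.1 + √t • q.2) := by fun_prop
    exact this.lintegral_prod_right'
  rw [lintegral_map hin hXm, lintegral_noise_eq hXm ht θ hfθ, condKernel_apply hXm,
    lintegral_withDensity_eq_lintegral_mul _ ?_ hfθ]
  · rfl
  · exact ((measurable_condDens hXm).comp measurable_prodMk_left).ennreal_ofReal

lemma condDistrib_noisyProj (hΘm : Measurable Θ) (hXm : Measurable X) (hNm : Measurable N)
    (hNlaw : HasLaw N (stdGaussian (EuclideanSpace ℝ (Fin k))) P) (hΘX : IndepFun Θ X P)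
    (hN : IndepFun N (fun ω => (Θ ω, X ω)) P) (ht : 0 < t) :
    ∀ᵐ ω ∂P, condDistrib (noisyProj Θ X N t) Θ P (Θ ω) = condKernel P X t (Θ ω) := by
  have := isMarkovKernel_condKernel (k := k) (P := P) hXm ht
  have hYm : Measurable (noisyProj Θ X N t) := by
    change Measurable fun ω ↦ randProj (Θ ω) (X ω) + √t • N ω
    fun_prop
  exact ae_of_ae_map hΘm.aemeasurable
    (condDistrib_ae_eq_of_measure_eq_compProd_of_measurable hΘm hYm
      (map_prodMk_noisyProj hΘm hXm hNm hNlaw hΘX hN ht))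

/-- The Gaussian density is strictly positive, so p/g is a Radon-Nikodym derivative and absolute
continuity is automatic. -/
lemma klDiv_withDensity_gaussMeas {c : ℝ} (hc : 0 < c) {p : EuclideanSpace ℝ (Fin k) → ℝ}
    (hp : Measurable p) (hp0 : ∀ y, 0 ≤ p y)
    (hp1 : ∫⁻ y, ENNReal.ofReal (p y) = 1) :
    klDiv ((volume : Measure (EuclideanSpace ℝ (Fin k))).withDensity fun y ↦ ENNReal.ofReal (p y))
        (gaussMeas k c)
      = ∫⁻ y, ENNReal.ofReal (gaussDens c y * klFun (p y / gaussDens c y)) := by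
  have := isProbabilityMeasure_gaussMeas (k := k) hc
  have hr : Measurable fun y ↦ ENNReal.ofReal (p y / gaussDens c y) := by fun_prop
  have e : ((volume : Measure (EuclideanSpace ℝ (Fin k))).withDensity
      fun y ↦ ENNReal.ofReal (p y))
      = (gaussMeas k c).withDensity fun y ↦ ENNReal.ofReal (p y / gaussDens c y) := by
    rw [gaussMeas, ← withDensity_mul _ (by fun_prop) hr]
    congr 1
    ext y
    rw [Pi.mul_apply, ← ENNReal.ofReal_mul (gaussDens_nonneg _ _),
      mul_div_cancel₀ _ (gaussDens_pos hc y).ne']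
  have hprob : IsProbabilityMeasure ((volume : Measure (EuclideanSpace ℝ (Fin k))).withDensity
      fun y ↦ ENNReal.ofReal (p y)) :=
    ⟨by rw [withDensity_apply _ .univ, setLIntegral_univ, hp1]⟩
  have hrn := Measure.rnDeriv_withDensity (gaussMeas k c) hr
  rw [e] at hprob ⊢
  rw [klDiv_eq_lintegral_klFun_of_ac (withDensity_absolutelyContinuous _ _)]
  have hm : Measurable fun y ↦ ENNReal.ofReal (klFun (p y / gaussDens c y)) := by
    have := measurable_klFun
    fun_prop
  have e2 : ∫⁻ y, ENNReal.ofReal (klFun (((gaussMeas k c).withDensity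
      fun y ↦ ENNReal.ofReal (p y / gaussDens c y)).rnDeriv (gaussMeas k c) y).toReal)
        ∂(gaussMeas k c)
      = ∫⁻ y, ENNReal.ofReal (klFun (p y / gaussDens c y)) ∂(gaussMeas k c) := by
    refine lintegral_congr_ae ?_
    filter_upwards [hrn] with y hy
    rw [hy, ENNReal.toReal_ofReal (div_nonneg (hp0 y) (gaussDens_nonneg _ _))]
  rw [e2, gaussMeas, lintegral_withDensity_eq_lintegral_mul _ (by fun_prop) hm]
  refine lintegral_congr fun y ↦ ?_
  rw [Pi.mul_apply, ENNReal.ofReal_mul (gaussDens_nonneg _ _)]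

end ConditionalDensity

/-! ### Mean and covariance of Y -/

section Moments

variable {k n : ℕ} {Ω : Type*} [MeasurableSpace Ω] {P : Measure Ω}
  {Θ : Ω → Fin k → Fin n → ℝ} {X : Ω → EuclideanSpace ℝ (Fin n)}
  {N : Ω → EuclideanSpace ℝ (Fin k)} {t : ℝ}

/-- Square-integrable factors alone give only an integrable product; independence of the squares
upgrades this to L². -/
lemma memLp_mul_of_indepFun [IsProbabilityMeasure P] {f g : Ω → ℝ} (hf : MemLp f 2 P)
    (hg : MemLp g 2 P) (h : IndepFun f g P) : MemLp (fun ω ↦ f ω * g ω) 2 P := by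
  refine (memLp_two_iff_integrable_sq (hf.1.mul hg.1)).2 ?_
  have h2 := (h.comp (φ := fun x ↦ x ^ 2) (ψ := fun x ↦ x ^ 2) (by fun_prop)
    (by fun_prop)).integrable_mul hf.integrable_sq hg.integrable_sq
  refine h2.congr (ae_of_all _ fun ω ↦ ?_)
  simp [mul_pow]

lemma memLp_entry 
    (hΘlaw : ∀ i j, HasLaw (fun ω => Θ ω i j) (gaussianReal 0 (1 / (n : ℝ≥0))) P)
    (i : Fin k) (j : Fin n) : MemLp (fun ω ↦ Θ ω i j) 2 P := by
  have h := memLp_id_gaussianReal (μ := 0) (v := 1 / (n : ℝ≥0)) 2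
  rw [← (hΘlaw i j).map_eq] at h
  exact (memLp_map_measure_iff (by fun_prop) (hΘlaw i j).aemeasurable).1 h

lemma integral_entry 
    (hΘlaw : ∀ i j, HasLaw (fun ω => Θ ω i j) (gaussianReal 0 (1 / (n : ℝ≥0))) P)
    (i : Fin k) (j : Fin n) : ∫ ω, Θ ω i j ∂P = 0 := by
  rw [(hΘlaw i j).integral_eq, integral_id_gaussianReal]

lemma integral_entry_mul_entry [IsProbabilityMeasure P]
    (hΘlaw : ∀ i j, HasLaw (fun ω => Θ ω i j) (gaussianReal 0 (1 / (n : ℝ≥0))) P)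
    (hΘindep : iIndepFun (fun (ij : Fin k × Fin n) ω => Θ ω ij.1 ij.2) P)
    (i i' : Fin k) (j j' : Fin n) :
    ∫ ω, Θ ω i j * Θ ω i' j' ∂P = if i = i' ∧ j = j' then 1 / (n : ℝ) else 0 := by
  have hcov := covariance_eq_sub (memLp_entry hΘlaw i j) (memLp_entry hΘlaw i' j')
  rw [integral_entry hΘlaw, zero_mul, sub_zero] at hcov
  change cov[_, _; P] = ∫ ω, Θ ω i j * Θ ω i' j' ∂P at hcov
  rw [← hcov]
  split_ifs with h
  · obtain ⟨rfl, rfl⟩ := h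
    rw [covariance_self (hΘlaw i j).aemeasurable, (hΘlaw i j).variance_eq,
      variance_id_gaussianReal]
    simp
  · exact (hΘindep.indepFun (i := (i, j)) (j := (i', j'))
      (by simpa using h)).covariance_eq_zero (memLp_entry hΘlaw i j) (memLp_entry hΘlaw i' j')

lemma memLp_noise (hNlaw : HasLaw N (stdGaussian (EuclideanSpace ℝ (Fin k))) P) (i : Fin k) :
    MemLp (fun ω ↦ N ω i) 2 P := by
  have h := IsGaussian.memLp_two_id (μ := stdGaussian (EuclideanSpace ℝ (Fin k)))
  rw [← hNlaw.map_eq, memLp_map_measure_iff (by fun_prop) hNlaw.aemeasurable] at h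
  exact h.eval_piLp i

lemma integral_noise (hNlaw : HasLaw N (stdGaussian (EuclideanSpace ℝ (Fin k))) P) (i : Fin k) :
    ∫ ω, N ω i ∂P = 0 := by
  have h := hNlaw.integral_comp (f := fun z ↦ z i) (by fun_prop)
  exact h.trans (integral_strongDual_stdGaussian
    (EuclideanSpace.proj i : EuclideanSpace ℝ (Fin k) →L[ℝ] ℝ))

lemma covariance_noise (hNlaw : HasLaw N (stdGaussian (EuclideanSpace ℝ (Fin k))) P)
    (i i' : Fin k) :
    cov[fun ω ↦ N ω i, fun ω ↦ N ω i'; P] = (1 : Matrix (Fin k) (Fin k) ℝ) i i' := by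
  have h := hNlaw.covariance_fun_comp (f := fun z ↦ z i) (g := fun z ↦ z i')
    (by fun_prop) (by fun_prop)
  rw [h, ← multivariateGaussian_zero_one, covariance_eval_multivariateGaussian .one]

lemma indepFun_entry_coord (hΘX : IndepFun Θ X P) (i : Fin k) (j : Fin n) :
    IndepFun (fun ω ↦ Θ ω i j) (fun ω ↦ X ω j) P :=
  hΘX.comp (φ := fun θ : Fin k → Fin n → ℝ ↦ θ i j)
    (ψ := fun x : EuclideanSpace ℝ (Fin n) ↦ x j) (by fun_prop) (by fun_prop)

lemma integral_entry_mul
    (hΘlaw : ∀ i j, HasLaw (fun ω => Θ ω i j) (gaussianReal 0 (1 / (n : ℝ≥0))) P)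
    (hX2 : MemLp X 2 P) (hΘX : IndepFun Θ X P)
    (i : Fin k) (j : Fin n) : ∫ ω, Θ ω i j * X ω j ∂P = 0 := by
  rw [(indepFun_entry_coord hΘX i j).integral_fun_mul_eq_mul_integral (memLp_entry hΘlaw i j).1
    (hX2.eval_piLp j).1, integral_entry hΘlaw, zero_mul]

lemma memLp_entry_mul [IsProbabilityMeasure P]
    (hΘlaw : ∀ i j, HasLaw (fun ω => Θ ω i j) (gaussianReal 0 (1 / (n : ℝ≥0))) P)
    (hX2 : MemLp X 2 P) (hΘX : IndepFun Θ X P)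
    (i : Fin k) (j : Fin n) : MemLp (fun ω ↦ Θ ω i j * X ω j) 2 P :=
  memLp_mul_of_indepFun (memLp_entry hΘlaw i j) (hX2.eval_piLp j)
    (indepFun_entry_coord hΘX i j)

/-- Coordinates of X may be correlated, but distinct entries of Θ are uncorrelated and centred, so
only diagonal terms survive. This is why the covariance of ΘX is isotropic. -/
lemma covariance_entry_mul [IsProbabilityMeasure P]
    (hΘlaw : ∀ i j, HasLaw (fun ω => Θ ω i j) (gaussianReal 0 (1 / (n : ℝ≥0))) P)
    (hX2 : MemLp X 2 P) (hΘX : IndepFun Θ X P)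
    (hΘindep : iIndepFun (fun (ij : Fin k × Fin n) ω => Θ ω ij.1 ij.2) P)
    (i i' : Fin k) (j j' : Fin n) :
    cov[fun ω ↦ Θ ω i j * X ω j, fun ω ↦ Θ ω i' j' * X ω j'; P]
      = (if i = i' ∧ j = j' then 1 / (n : ℝ) else 0) * ∫ ω, X ω j * X ω j' ∂P := by
  rw [covariance_eq_sub (memLp_entry_mul hΘlaw hX2 hΘX i j)
    (memLp_entry_mul hΘlaw hX2 hΘX i' j'), integral_entry_mul hΘlaw hX2 hΘX, zero_mul, sub_zero,
    ← integral_entry_mul_entry hΘlaw hΘindep]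
  have hind : IndepFun (fun ω ↦ Θ ω i j * Θ ω i' j') (fun ω ↦ X ω j * X ω j') P :=
    hΘX.comp (φ := fun θ : Fin k → Fin n → ℝ ↦ θ i j * θ i' j')
      (ψ := fun x : EuclideanSpace ℝ (Fin n) ↦ x j * x j') (by fun_prop) (by fun_prop)
  rw [← hind.integral_fun_mul_eq_mul_integral
    ((memLp_entry hΘlaw i j).1.mul (memLp_entry hΘlaw i' j').1)
    ((hX2.eval_piLp j).1.mul (hX2.eval_piLp j').1)]
  refine integral_congr_ae (ae_of_all _ fun ω ↦ ?_)
  simp only [Pi.mul_apply]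
  ring

lemma memLp_randProj [IsProbabilityMeasure P]
    (hΘlaw : ∀ i j, HasLaw (fun ω => Θ ω i j) (gaussianReal 0 (1 / (n : ℝ≥0))) P)
    (hX2 : MemLp X 2 P) (hΘX : IndepFun Θ X P)
    (i : Fin k) : MemLp (fun ω ↦ randProj (Θ ω) (X ω) i) 2 P := by
  simp only [randProj_apply]
  exact memLp_finsetSum _ fun j _ ↦ memLp_entry_mul hΘlaw hX2 hΘX i j

lemma covariance_randProj [IsProbabilityMeasure P]
    (hΘlaw : ∀ i j, HasLaw (fun ω => Θ ω i j) (gaussianReal 0 (1 / (n : ℝ≥0))) P)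
    (hX2 : MemLp X 2 P) (hΘX : IndepFun Θ X P)
    {γ : ℝ} (hγ : 1 / (n : ℝ) * ∫ ω, ‖X ω‖ ^ 2 ∂P = γ)
    (hΘindep : iIndepFun (fun (ij : Fin k × Fin n) ω => Θ ω ij.1 ij.2) P) (i i' : Fin k) :
    cov[fun ω ↦ randProj (Θ ω) (X ω) i, fun ω ↦ randProj (Θ ω) (X ω) i'; P]
      = γ * (1 : Matrix (Fin k) (Fin k) ℝ) i i' := by
  simp only [randProj_apply]
  rw [covariance_fun_sum_fun_sum (memLp_entry_mul hΘlaw hX2 hΘX i)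
    (memLp_entry_mul hΘlaw hX2 hΘX i')]
  simp_rw [covariance_entry_mul hΘlaw hX2 hΘX hΘindep]
  rw [Matrix.one_apply]
  split_ifs with h
  · subst h
    rw [← hγ]
    simp_rw [EuclideanSpace.real_norm_sq_eq]
    rw [integral_finsetSum _ fun j _ ↦ (hX2.eval_piLp j).integrable_sq]
    simp [Finset.mul_sum, sq]
  · simp [h]

/-- The Gaussian approximation of `Θ X + √t N` is isotropic and centred. -/
lemma gaussianApprox_noisyProj [IsProbabilityMeasure P]
    (hΘlaw : ∀ i j, HasLaw (fun ω => Θ ω i j) (gaussianReal 0 (1 / (n : ℝ≥0))) P)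
    (hX2 : MemLp X 2 P) (hΘX : IndepFun Θ X P)
    {γ : ℝ} (hγ : 1 / (n : ℝ) * ∫ ω, ‖X ω‖ ^ 2 ∂P = γ)
    (hΘindep : iIndepFun (fun (ij : Fin k × Fin n) ω => Θ ω ij.1 ij.2) P)
    (hNlaw : HasLaw N (stdGaussian (EuclideanSpace ℝ (Fin k))) P)
    (hN : IndepFun N (fun ω => (Θ ω, X ω)) P) (ht : 0 < t) :
    gaussianApprox P (noisyProj Θ X N t)
      = multivariateGaussian 0 ((γ + t) • (1 : Matrix (Fin k) (Fin k) ℝ)) := by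
  have hY : ∀ i, (fun ω ↦ noisyProj Θ X N t ω i)
      = fun ω ↦ randProj (Θ ω) (X ω) i + √t * N ω i := fun i ↦ rfl
  have hU := memLp_randProj (k := k) hΘlaw hX2 hΘX
  have hV : ∀ i, MemLp (fun ω ↦ √t * N ω i) 2 P := fun i ↦ (memLp_noise hNlaw i).const_mul _
  have hUV : ∀ i i',
      cov[fun ω ↦ randProj (Θ ω) (X ω) i, fun ω ↦ √t * N ω i'; P] = 0 := by
    intro i i'
    have hφ : Measurable fun q : (Fin k → Fin n → ℝ) × EuclideanSpace ℝ (Fin n) ↦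
        randProj q.1 q.2 i := by
      simp only [randProj_apply]
      fun_prop
    have hψ : Measurable fun z : EuclideanSpace ℝ (Fin k) ↦ √t * z i' := by fun_prop
    exact IndepFun.covariance_eq_zero (hN.symm.comp hφ hψ) (hU i) (hV i')
  have hmean : ∫ ω, noisyProj Θ X N t ω ∂P = 0 := by
    ext i
    rw [eval_integral_piLp fun i ↦ by
      rw [hY]
      exact ((hU i).add (hV i)).integrable one_le_two]
    rw [hY, integral_add ((hU i).integrable one_le_two) ((hV i).integrable one_le_two),
      integral_const_mul, integral_noise hNlaw]
    simp only [randProj_apply]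
    rw [integral_finsetSum _ fun j _ ↦ (memLp_entry_mul hΘlaw hX2 hΘX i j).integrable one_le_two]
    simp [integral_entry_mul hΘlaw hX2 hΘX]
  rw [gaussianApprox, hmean]
  congr 1
  ext i i'
  rw [Matrix.of_apply, hY, hY]
  change cov[(fun ω ↦ randProj (Θ ω) (X ω) i) + (fun ω ↦ √t * N ω i),
    (fun ω ↦ randProj (Θ ω) (X ω) i') + (fun ω ↦ √t * N ω i'); P] = _
  rw [covariance_add_left (hU i) (hV i) ((hU i').add (hV i')),
    covariance_add_right (hU i) (hU i') (hV i'), covariance_add_right (hV i) (hU i') (hV i'),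
    hUV, covariance_comm (fun ω ↦ √t * N ω i), hUV, covariance_const_mul_left,
    covariance_const_mul_right, covariance_noise hNlaw,
    covariance_randProj hΘlaw hX2 hΘX hγ hΘindep, Matrix.smul_apply, ← mul_assoc,
    Real.mul_self_sqrt ht.le, smul_eq_mul]
  ring

/-- The relative entropy of the conditional law with respect to an isotropic Gaussian. -/
lemma klDiv_condKernel [IsProbabilityMeasure P] (hXm : Measurable X) (ht : 0 < t) {c : ℝ}
    (hc : 0 < c) (θ : Fin k → Fin n → ℝ) :
    klDiv (condKernel P X t θ) (gaussMeas k c)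
      = ∫⁻ y, ENNReal.ofReal (gaussDens c y * klFun (condDens P X t θ y / gaussDens c y)) := by
  have hfm : Measurable fun p : EuclideanSpace ℝ (Fin k) × Ω ↦
      gaussDens t (p.1 - randProj θ (X p.2)) := by fun_prop
  have hm : Measurable fun y ↦ condDens P X t θ y :=
    (hfm.stronglyMeasurable.integral_prod_right' (ν := P)).measurable
  rw [condKernel_apply hXm]
  exact klDiv_withDensity_gaussMeas hc hm (condDens_nonneg θ) (lintegral_ofReal_condDens hXm ht θ)

end Moments

theorem theorem2 {Ω : Type*} [MeasurableSpace Ω] (P : Measure Ω) [IsProbabilityMeasure P]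
    {k n : ℕ} (hk : 0 < k) (γ : ℝ)
    (Θ : Ω → Fin k → Fin n → ℝ)
    (X : Ω → EuclideanSpace ℝ (Fin n))
    (N : Ω → EuclideanSpace ℝ (Fin k))
    (hΘm : Measurable Θ) (hXm : Measurable X) (hNm : Measurable N)
    -- the entries of `Θ` are i.i.d. Gaussian with mean zero and variance `1 / n`
    (hΘlaw : ∀ i j, HasLaw (fun ω => Θ ω i j) (gaussianReal 0 (1 / (n : ℝ≥0))) P)
    (hΘindep : iIndepFun (fun (ij : Fin k × Fin n) ω => Θ ω ij.1 ij.2) P)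
    -- `X` has finite second moment `E ‖X‖² = n γ` with `γ ∈ (0, ∞)`
    (hX2 : MemLp X 2 P)
    (hγ : 1 / (n : ℝ) * ∫ ω, ‖X ω‖ ^ 2 ∂P = γ) (hγpos : 0 < γ)
    -- `N` is standard Gaussian on `ℝᵏ`, and `Θ`, `X`, `N` are independent
    (hNlaw : HasLaw N (stdGaussian (EuclideanSpace ℝ (Fin k))) P)
    (hΘX : IndepFun Θ X P)
    (hN : IndepFun N (fun ω => (Θ ω, X ω)) P)
    (t : ℝ) (ht : 0 < t) (ε : ℝ) (hε : 0 < ε) (hε1 : ε ≤ 1) :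
    gaussianApprox P (noisyProj Θ X N t)
        = multivariateGaussian 0 ((γ + t) • (1 : Matrix (Fin k) (Fin k) ℝ)) ∧
    ∫⁻ ω, klDiv (condDistrib (noisyProj Θ X N t) Θ P (Θ ω))
        (gaussianApprox P (noisyProj Θ X N t)) ∂P
      ≤ ENNReal.ofReal
          (3 * (k : ℝ) * Real.log (1 + γ / t) * (alphaDev P X / (ε * γ))
            + 3 * (k : ℝ) ^ (3 / 4 : ℝ) * (betaCorr P 1 X / γ) ^ (1 / 2 : ℝ)
            + 3 * (k : ℝ) ^ (1 / 4 : ℝ) * (1 + (2 + ε) * γ / t) ^ ((k : ℝ) / 4)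
                * (betaCorr P 2 X / γ)) := by
  have hG := gaussianApprox_noisyProj hΘlaw hX2 hΘX hγ hΘindep hNlaw hN ht
  refine ⟨hG, ?_⟩
  -- For n = 0 the convention 1/0 = 0 would force γ = 0.
  have hn : 0 < n := Nat.pos_of_ne_zero fun h ↦ by
    subst h
    simp at hγ
    exact hγpos.ne hγ
  have hc : 0 < γ + t := by positivity
  rw [hG, multivariateGaussian_smul_one hc]
  have h := lintegral_condDens_klFun_le hk hn hΘm hXm hΘlaw hΘindep hX2 ht hγ hγpos hε hε1
  refine le_of_eq_of_le (lintegral_congr_ae ?_) h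
  filter_upwards [condDistrib_noisyProj hΘm hXm hNm hNlaw hΘX hN ht] with ω hω
  rw [hω, klDiv_condKernel hXm ht hc]
  rfl
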